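/- Let $(\Omega,\mathcal F,P)$ be a probability space with a filtration $(\mathcal F_t)_{t\in[0,T]}$, $T<\infty$, satisfying the usual conditions, let $d\in\mathbb N$, and let $|\cdot|$ be the Euclidean norm on $\mathbb R^d$. Random variables are identified when they are a.s. equal, and processes $X,Y$ on $[0,T]$ when $X_t=Y_t$ a.s. for every $t$. A random vector $X$ is called conditionally integrable with respect to a $\sigma$-algebra $\mathcal E\subseteq\mathcal F$ if there are $A_1\subseteq A_2\subseteq\cdots$ in $\mathcal E$ with $\bigcup_n A_n=\Omega$ and $E(|X|I_{A_n})<\infty$ for all $n$; its generalized conditional expectation $E[X\mid\mathcal E]$ is then the a.s. unique $\mathcal E$-measurable $Z$ with $E(XI_A)=E(ZI_A)$ for all $A\in\mathcal E$ with $E(|X|I_A)<\infty$. For $p\in(1,\infty]$ let $L^p_{\mathcal F_0}(\mathcal F_T,\mathbb R^d)=\{\eta x:\eta\in L^0(\mathcal F_0),\ x\in L^p(\mathcal F_T,\mathbb R^d)\}$, where $L^0(\mathcal F_0)$ is the set of real $\mathcal F_0$-measurable random variables. Let $S^p_{\mathcal F_0}$ be the set of $\mathbb R^d$-valued adapted right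 continuous processes $Y$ with left limits such that $(\sup_{t\in[0,T]}|Y_t|)^p$ is conditionally integrable with respect to $\mathcal F_0$ (for $p=\infty$: such that $\sup_{t}|Y_t|\le\eta$ a.s. for some $\eta\in L^0(\mathcal F_0)$). On $S^p_{\mathcal F_0}$ put $|||Y|||_p=E[(\sup_t|Y_t|)^p\mid\mathcal F_0]^{1/p}$ for $p<\infty$, and let $|||Y|||_\infty$ be the essential infimum of the $[0,\infty]$-valued $\mathcal F_0$-measurable $\eta$ with $\sup_t|Y_t|\le\eta$ a.s. Let $S^p_{\mathcal F_0,0}=\{Y\in S^p_{\mathcal F_0}:Y_0=0\}$, and let $M^p_{\mathcal F_0,0}$ be the set of $M\in S^p_{\mathcal F_0,0}$ that are generalized martingales, i.e. for $s<t$ the vector $M_t$ is conditionally integrable with respect to $\mathcal F_s$ and $E[M_t\mid\mathcal F_s]=M_s$ a.s. Let $F:S^p_{\mathcal F_0}\times M^p_{\mathcal F_0,0}\to S^p_{\mathcal F_0,0}$. It is called stable if $F\big(\sum_n I_{A_n}(Y^{(n)},M^{(n)})\big)=\sum_n I_{A_n}F(Y^{(n)},M^{(n)})$ for every countable partition $(A_n)$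 of $\Omega$ into sets of $\mathcal F_0$ and every sequence $(Y^{(n)},M^{(n)})$ in $S^p_{\mathcal F_0}\times M^p_{\mathcal F_0,0}$. For $k\ge1$ put $F^{(k)}(Y,M)=F(Y^{(k,M)},M)$, where $Y^{(1,M)}=Y$ and $Y^{(k,M)}_t=Y_0-F_t(Y^{(k-1,M)},M)-M_t$ for $k\ge2$; for an $\mathcal F_0$-measurable $L:\Omega\to\{1,2,\dots\}$ put $F^{(L)}=\sum_{k\ge1}I_{\{L=k\}}F^{(k)}$. Let $c_2=\frac15$, $c_\infty=\frac14$, and $c_p=\frac{p-1}{4p-1}$ for $p\in(1,\infty)\setminus\{2\}$. Theorem 5.4. Let $p\in(1,\infty]$ and $\xi\in L^p_{\mathcal F_0}(\mathcal F_T,\mathbb R^d)$. Suppose that $F$ is stable and that there are an $\mathcal F_0$-measurable $L:\Omega\to\{1,2,\dots\}$ and an $\mathcal F_0$-measurable real random variable $C$ with $0\le C<c_p$ a.s. such that $$|||F^{(L)}(Y,M)-F^{(L)}(Y',M')|||_p\le C\,\big(|||Y-Y'|||_p+|||M-M'|||_p\big)\quad\text{a.s.}$$ for all $Y,Y'\in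 S^p_{\mathcal F_0}$ and $M,M'\in M^p_{\mathcal F_0,0}$. Then the backward stochastic equation $$Y_t+F_t(Y,M)+M_t=\xi+F_T(Y,M)+M_T,\qquad t\in[0,T],$$ has a unique solution $(Y,M)$ in $S^p_{\mathcal F_0}\times M^p_{\mathcal F_0,0}$. If $L$ is a constant $k\ge1$, the conclusion holds without the stability of $F$. -/

import Mathlib

open MeasureTheory ProbabilityTheory Filter Topology
open scoped ENNReal NNReal

noncomputable section

namespace RandomBSE

/-! ### Conditional integrability and conditional norms -/

section Conditional

variable {Ω : Type*}

/-- `X` is conditionally integrable (σ-integrable) with respect to the sub-σ-algebra `m`: it is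
integrable over each set of a nondecreasing sequence of `m`-measurable sets with union `Ω`. -/
def CondIntegrable {G : Type*} [NormedAddCommGroup G] (m : MeasurableSpace Ω)
    {mΩ : MeasurableSpace Ω} (P : Measure Ω) (X : Ω → G) : Prop :=
  ∃ A : ℕ → Set Ω, Monotone A ∧ (∀ n, MeasurableSet[m] (A n)) ∧ (⋃ n, A n) = Set.univ ∧
    ∀ n, IntegrableOn X (A n) P

/-- `Z` is (a version of) the generalized conditional expectation `E[X | m]` of a conditionally
integrable random vector `X`. -/
def IsGenCondExp {G : Type*} [NormedAddCommGroup G] [NormedSpace ℝ G] (m : MeasurableSpace Ω)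
    {mΩ : MeasurableSpace Ω} (P : Measure Ω) (X Z : Ω → G) : Prop :=
  CondIntegrable m P X ∧ AEStronglyMeasurable[m] Z P ∧
    ∀ A, MeasurableSet[m] A → IntegrableOn X A P →
      IntegrableOn Z A P ∧ ∫ ω in A, Z ω ∂P = ∫ ω in A, X ω ∂P

/-- `N` is the least (up to null sets) of the `m`-measurable `[0,∞]`-valued functions that
dominate `R` almost surely. -/
def IsLeastMajorant (m : MeasurableSpace Ω) {mΩ : MeasurableSpace Ω} (P : Measure Ω)
    (R N : Ω → ℝ≥0∞) : Prop :=
  Measurable[m] N ∧ R ≤ᵐ[P] N ∧ ∀ η : Ω → ℝ≥0∞, Measurable[m] η → R ≤ᵐ[P] η → N ≤ᵐ[P] η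

theorem exists_isLeastMajorant {m mΩ : MeasurableSpace Ω} (hm : m ≤ mΩ) (P : Measure Ω)
    [IsProbabilityMeasure P] (R : Ω → ℝ≥0∞) : ∃ N, IsLeastMajorant m P R N := by
  let H : Set (Ω → ℝ≥0∞) := {η | Measurable[m] η ∧ R ≤ᵐ[P] η}
  let ψ : (Ω → ℝ≥0∞) → ℝ≥0∞ := fun η => ∫⁻ ω, (1 + η ω)⁻¹ ∂P
  have hH : H.Nonempty := ⟨fun _ => ⊤, measurable_const, Eventually.of_forall fun _ => le_top⟩
  obtain ⟨u, -, hu, huH⟩ := exists_seq_tendsto_sSup (hH.image ψ) (OrderTop.bddAbove _)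
  choose η hη hηu using huH
  have hNm : Measurable[m] fun ω => ⨅ n, η n ω := Measurable.iInf fun n => (hη n).1
  have hNR : R ≤ᵐ[P] fun ω => ⨅ n, η n ω := by
    filter_upwards [ae_all_iff.2 fun n => (hη n).2] with ω h using le_iInf h
  have hmono : ∀ f g : Ω → ℝ≥0∞, f ≤ g → ψ g ≤ ψ f := fun f g hfg =>
    lintegral_mono fun ω => ENNReal.inv_le_inv.2 (add_le_add_right (hfg ω) 1)
  have hsup : sSup (ψ '' H) ≤ ψ fun ω => ⨅ n, η n ω :=
    le_of_tendsto' hu fun n => by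
      rw [← hηu n]
      exact hmono _ _ fun ω => iInf_le _ n
  refine ⟨_, hNm, hNR, fun ζ hζ hRζ => ?_⟩
  have hmem : (fun ω => (⨅ n, η n ω) ⊓ ζ ω) ∈ H := by
    refine ⟨Measurable.min hNm hζ, ?_⟩
    filter_upwards [hNR, hRζ] with ω h1 h2 using le_inf h1 h2
  have hle : ψ (fun ω => (⨅ n, η n ω) ⊓ ζ ω) ≤ ψ fun ω => ⨅ n, η n ω :=
    (le_sSup (Set.mem_image_of_mem ψ hmem)).trans hsup
  have hfin : (∫⁻ ω, (1 + ⨅ n, η n ω)⁻¹ ∂P) ≠ ⊤ := by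
    refine ne_top_of_le_ne_top ENNReal.one_ne_top
      ((lintegral_mono (g := fun _ => 1) fun ω => ?_).trans (by simp))
    exact ENNReal.inv_le_one.2 le_self_add
  have hae := ae_eq_of_ae_le_of_lintegral_le
    (f := fun ω => (1 + ⨅ n, η n ω)⁻¹) (g := fun ω => (1 + (⨅ n, η n ω) ⊓ ζ ω)⁻¹) (μ := P)
    (Eventually.of_forall fun ω => ENNReal.inv_le_inv.2 (add_le_add_right inf_le_left 1))
    hfin (Measurable.inv (Measurable.const_add (hmem.1.mono hm le_rfl) 1)).aemeasurable hle
  filter_upwards [hae] with ω h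
  have h1 : 1 + (⨅ n, η n ω) = 1 + (⨅ n, η n ω) ⊓ ζ ω := inv_injective h
  have h2 := (ENNReal.add_right_inj ENNReal.one_ne_top).1 h1
  exact h2.le.trans inf_le_right

/-- The conditional `p`-norm, with respect to the sub-σ-algebra `m`, of a random quantity of
size `R`: it is `E[R ^ p | m] ^ (1 / p)` for `p < ∞`, and for `p = ∞` the essential infimum of the
`m`-measurable functions that dominate `R`. The conditional expectation is that of
`[0,∞]`-valued functions, hence always defined. -/
def condNorm {m mΩ : MeasurableSpace Ω} (hm : m ≤ mΩ) (P : Measure Ω) [IsProbabilityMeasure P]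
    (p : ℝ≥0∞) (R : Ω → ℝ≥0∞) : Ω → ℝ≥0∞ :=
  if p = ∞ then (exists_isLeastMajorant hm P R).choose
  else fun ω => (condLExp m P (fun ω' => R ω' ^ p.toReal) ω) ^ (1 / p.toReal)

end Conditional

/-! ### Classes of processes on `[0, T]`

A process is considered up to stochastic equivalence (`X_t = Y_t` a.s. for every `t`), so that its
class is the same thing as the family, indexed by `t`, of the classes of the random vectors
`X_t`. -/

/-- The time set `[0, T]`; its least and greatest elements `⊥` and `⊤` are the times `0`, `T`. -/
abbrev TimeSet (T : ℝ≥0) : Type := Set.Iic T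

/-- Stochastic equivalence classes of `ℝ^d`-valued processes on `[0, T]`. -/
abbrev Proc (T : ℝ≥0) {Ω : Type*} {mΩ : MeasurableSpace Ω} (P : Measure Ω) (d : ℕ) : Type _ :=
  TimeSet T → (Ω →ₘ[P] EuclideanSpace ℝ (Fin d))

/-- The usual conditions: the filtration is right continuous and the σ-algebra at time `0` contains
every subset of a null set (so that, in particular, the probability space is complete). -/
structure UsualConditions {T : ℝ≥0} {Ω : Type*} {mΩ : MeasurableSpace Ω}
    (𝓕 : Filtration (TimeSet T) mΩ) (P : Measure Ω) : Prop where
  rightCont : 𝓕.IsRightContinuous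
  null : ∀ s : Set Ω, P s = 0 → MeasurableSet[𝓕 ⊥] s

/-- A path on `[0, T]` that is right continuous and has left limits. -/
def IsRCLL {T : ℝ≥0} {G : Type*} [TopologicalSpace G] (f : TimeSet T → G) : Prop :=
  ∀ t, ContinuousWithinAt f (Set.Ici t) t ∧ ∃ l, Tendsto f (𝓝[<] t) (𝓝 l)

section Spaces

variable {T : ℝ≥0} {Ω : Type*} {mΩ : MeasurableSpace Ω} {d : ℕ}

/-- `x` is an adapted process with RCLL paths in the class `X`. -/
structure IsRCLLVersion (𝓕 : Filtration (TimeSet T) mΩ) (P : Measure Ω)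
    (x : TimeSet T → Ω → EuclideanSpace ℝ (Fin d)) (X : Proc T P d) : Prop where
  adapted : ∀ t, StronglyMeasurable[𝓕 t] (x t)
  rcll : ∀ ω, IsRCLL fun t => x t ω
  version : ∀ t, x t =ᵐ[P] X t

/-- The space of classes of RCLL adapted processes. -/
def spaceS (𝓕 : Filtration (TimeSet T) mΩ) (P : Measure Ω) (d : ℕ) : Set (Proc T P d) :=
  {X | ∃ x, IsRCLLVersion 𝓕 P x X}

open Classical in
/-- An RCLL adapted process in the class `X` (unique up to indistinguishability), if there is one;
otherwise some process in the class. -/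
def rcllVersion (𝓕 : Filtration (TimeSet T) mΩ) (P : Measure Ω) (X : Proc T P d) :
    TimeSet T → Ω → EuclideanSpace ℝ (Fin d) :=
  if h : ∃ x, IsRCLLVersion 𝓕 P x X then h.choose else fun t => X t

/-- The random variable `sup_{0 ≤ t ≤ T} |X_t|`, for an RCLL process `X`. -/
def pathSup (𝓕 : Filtration (TimeSet T) mΩ) (P : Measure Ω) (X : Proc T P d) : Ω → ℝ≥0∞ :=
  fun ω => ⨆ t, ‖rcllVersion 𝓕 P X t ω‖ₑ

/-- The conditional norm `|||X|||_p` of an RCLL process `X`, given the σ-algebra at time `0`. -/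
def procNorm (𝓕 : Filtration (TimeSet T) mΩ) (P : Measure Ω) [IsProbabilityMeasure P] (p : ℝ≥0∞)
    (X : Proc T P d) : Ω → ℝ≥0∞ :=
  condNorm (𝓕.le ⊥) P p (pathSup 𝓕 P X)

/-- The space `S^p_{F_0}`: RCLL adapted processes for which `(sup_t |Y_t|) ^ p` is conditionally
integrable with respect to `F_0` or, for `p = ∞`, for which `sup_t |Y_t|` is dominated by a real
`F_0`-measurable random variable. -/
def spaceSp (𝓕 : Filtration (TimeSet T) mΩ) (P : Measure Ω) (p : ℝ≥0∞) (d : ℕ) :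
    Set (Proc T P d) :=
  {Y | Y ∈ spaceS 𝓕 P d ∧
    (p ≠ ∞ → CondIntegrable (𝓕 ⊥) P fun ω => (pathSup 𝓕 P Y ω).toReal ^ p.toReal) ∧
    (p = ∞ → ∃ η : Ω → ℝ, Measurable[𝓕 ⊥] η ∧ ∀ᵐ ω ∂P, pathSup 𝓕 P Y ω ≤ ENNReal.ofReal (η ω))}

/-- The processes of `S^p_{F_0}` that start at `0`. -/
def spaceSp0 (𝓕 : Filtration (TimeSet T) mΩ) (P : Measure Ω) (p : ℝ≥0∞) (d : ℕ) :
    Set (Proc T P d) :=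
  {Y | Y ∈ spaceSp 𝓕 P p d ∧ Y ⊥ = 0}

/-- `X` is a generalized martingale (adaptedness is part of membership in `spaceS`). -/
def IsGenMartingale (𝓕 : Filtration (TimeSet T) mΩ) (P : Measure Ω) (X : Proc T P d) : Prop :=
  ∀ s t, s < t → IsGenCondExp (𝓕 s) P (X t) (X s)

/-- The space `M^p_{F_0,0}` of generalized martingales in `S^p_{F_0}` that start at `0`. -/
def spaceMp0 (𝓕 : Filtration (TimeSet T) mΩ) (P : Measure Ω) (p : ℝ≥0∞) (d : ℕ) :
    Set (Proc T P d) :=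
  {M | M ∈ spaceSp0 𝓕 P p d ∧ IsGenMartingale 𝓕 P M}

/-- The space `L^p_{F_0}(F_T, ℝ^d)`: the products `η • x` of a real `F_0`-measurable random variable
`η` and an `F_T`-measurable `x` in `L^p`. -/
def spaceLp (𝓕 : Filtration (TimeSet T) mΩ) (P : Measure Ω) (p : ℝ≥0∞) (d : ℕ) :
    Set (Ω →ₘ[P] EuclideanSpace ℝ (Fin d)) :=
  {V | ∃ (η : Ω → ℝ) (x : Ω → EuclideanSpace ℝ (Fin d)), Measurable[𝓕 ⊥] η ∧
    StronglyMeasurable[𝓕 ⊤] x ∧ MemLp x p P ∧ V =ᵐ[P] fun ω => η ω • x ω}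

end Spaces

/-! ### Generators -/

section Generators

variable {T : ℝ≥0} {Ω : Type*} {mΩ : MeasurableSpace Ω} {P : Measure Ω} {d : ℕ}

/-- `1_A X = 1_A X'`, as classes of processes. -/
def EqOnEvent (A : Set Ω) (X X' : Proc T P d) : Prop :=
  ∀ t, ∀ᵐ ω ∂P, ω ∈ A → X t ω = X' t ω

/-- Stability of a generator on `S^p_{F_0} × M^p_{F_0,0}`: for every countable partition `(A n)` of
`Ω` into `F_0`-measurable sets, `F (∑ 1_{A n} (Y n, M n)) = ∑ 1_{A n} F (Y n, M n)`, where the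
concatenation `∑ 1_{A n} X n` is the unique `X` with `1_{A n} X = 1_{A n} X n` for all `n`. -/
def IsStableGen (𝓕 : Filtration (TimeSet T) mΩ) (p : ℝ≥0∞)
    (F : Proc T P d → Proc T P d → Proc T P d) : Prop :=
  ∀ A : ℕ → Set Ω, (∀ n, MeasurableSet[𝓕 ⊥] (A n)) → Pairwise (Function.onFun Disjoint A) →
    (⋃ n, A n) = Set.univ →
    ∀ Yn Mn : ℕ → Proc T P d, (∀ n, Yn n ∈ spaceSp 𝓕 P p d) → (∀ n, Mn n ∈ spaceMp0 𝓕 P p d) →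
    ∀ Y ∈ spaceSp 𝓕 P p d, ∀ M ∈ spaceMp0 𝓕 P p d,
      (∀ n, EqOnEvent (A n) Y (Yn n)) → (∀ n, EqOnEvent (A n) M (Mn n)) →
      ∀ n, EqOnEvent (A n) (F Y M) (F (Yn n) (Mn n))

/-- The recursion `Y^(1,M) = Y`, `Y^(k,M)_t = Y_0 - F_t(Y^(k-1,M), M) - M_t`; the argument `n` of
`picard` stands for `k = n + 1`. -/
def picard (F : Proc T P d → Proc T P d → Proc T P d) (Y M : Proc T P d) : ℕ → Proc T P d
  | 0 => Y
  | n + 1 => fun t => Y ⊥ - F (picard F Y M n) M t - M t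

/-- The iterate `F^(k)(Y, M) = F(Y^(k,M), M)`, for `k ≥ 1`. -/
def iterGen (F : Proc T P d → Proc T P d → Proc T P d) (k : ℕ) (Y M : Proc T P d) :
    Proc T P d :=
  F (picard F Y M (k - 1)) M

/-- The random iterate `F^(L) = ∑_{k ≥ 1} 1_{L = k} F^(k)`. -/
def randIterGen (F : Proc T P d → Proc T P d → Proc T P d) (L : Ω → ℕ) (hL : Measurable L)
    (Y M : Proc T P d) : Proc T P d := fun t =>
  AEEqFun.mk (fun ω => iterGen F (L ω) Y M t ω)
    ((measurable_from_prod_countable_right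
      (f := fun q : ℕ × Ω => iterGen F q.1 Y M t q.2)
      (fun k => (iterGen F k Y M t).measurable)).comp
        (hL.prodMk measurable_id)).aestronglyMeasurable

/-- The pair `(Y, M)` solves `Y_t + F_t(Y,M) + M_t = ξ + F_T(Y,M) + M_T` for all `t ∈ [0, T]`. -/
def SolvesBSE (F : Proc T P d → Proc T P d → Proc T P d)
    (ξ : Ω →ₘ[P] EuclideanSpace ℝ (Fin d)) (Y M : Proc T P d) : Prop :=
  ∀ t, Y t + F Y M t + M t = ξ + F Y M ⊤ + M ⊤

end Generators

open Classical in
/-- The constants `c_2 = 1/5`, `c_∞ = 1/4` and `c_p = (p - 1) / (4 p - 1)` otherwise. -/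
def cConst (p : ℝ≥0∞) : ℝ :=
  if p = 2 then 1 / 5 else if p = ∞ then 1 / 4 else (p.toReal - 1) / (4 * p.toReal - 1)

end RandomBSE

end

/-! Given (Y, M), let K be the martingale with K_T = ξ + F_T(Y, M). The pair solves the equation
exactly when Y = K - F(Y, M) and M = K_0 - K (`solvesBSE_iff_exists`), so solutions are the fixed
points of (Y, M) ↦ (K - F(Y, M), K_0 - K). For two inputs, the difference k of the martingales and
the difference g of the drivers have the same terminal value. Doob's inequality with constant q =
p/(p-1) (q = 1 if p = ∞) gives |||k||| ≤ q |||g|||, hence |||k - g||| + |||k_0 - k||| ≤ (1 + 3q)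
|||g|||, and 1 + 3q = 1/c_p. For p = 2 orthogonality of k_T - k_0 to F_0 improves 7 to 5
(`procNorm_step_le`). So C < c_p makes the map a contraction with the random factor C/c_p < 1.

This factor need not be bounded away from 1, so Banach's iteration is run ω by ω
(`existsUnique_fixedPoint_of_random_contraction`). It requires only that sequences whose increments
have a.s. summable conditional norms converge (`exists_spaceSp_limit`,
`exists_genMartingale_limit`), and this rests on a countable conditional Minkowski inequality
(`condNorm_tsum_le`). Classical martingale facts are transferred by localisation: Ω is exhausted by
F_0-measurable sets B on which the relevant conditional norms are bounded, and there 1_B X is an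
ordinary martingale (`MartOn`).

The martingale K must have RCLL paths. For a bounded terminal value, an L² estimate shows that a
bounded martingale makes only finitely many moves of a given size along a countable dense set of
times (`ae_hasFiniteOsc`), so one-sided limits exist and the usual conditions make the right limits
an adapted version. A general terminal value is divided by an F_0-measurable factor to have
conditional norm at most 1, and is then, for p < ∞, approximated in L^p by simple functions, Doob's
inequality controlling the closing martingales (`exists_genMartingale`).

The Lipschitz hypothesis concerns F^(L), so this argument solves the equation for F^(L). A solution
for F is stationary under the recursion, so F^(L) = F there. Conversely, if (Y, M) solves the
equation for F^(L), put Y' = Y_0 - F(Y, M) - M. Locality of F on the events {L = k} gives F^(L)(Y',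
M) = F(Y, M), so Y - Y' = F^(L)(Y', M) - F^(L)(Y, M), and C < 1 forces Y = Y' and F(Y, M) = F^(L)(Y,
M) (`randIterGen_eq_of_solvesBSE`). Locality follows from stability, or trivially when L is
constant. -/

namespace RandomBSE

/-! ### Conditional expectations of [0,∞]-valued functions and conditional p-norms -/

section CondNorm

variable {Ω : Type*} {m mΩ : MeasurableSpace Ω} {P : Measure Ω} [IsProbabilityMeasure P]
  {p : ℝ≥0∞}

/-- The measures with densities X and E[X | m] agree on `m`, and an `m`-measurable g only sees their
restrictions to `m`. -/
theorem lintegral_mul_condLExp (hm : m ≤ mΩ) {g X : Ω → ℝ≥0∞} (hg : Measurable[m] g)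
    (hX : AEMeasurable X P) : ∫⁻ ω, g ω * condLExp m P X ω ∂P = ∫⁻ ω, g ω * X ω ∂P := by
  have htrim : (P.withDensity (condLExp m P X)).trim hm = (P.withDensity X).trim hm := by
    refine @Measure.ext _ m _ _ fun s hs => ?_
    rw [trim_measurableSet_eq hm hs, trim_measurableSet_eq hm hs, withDensity_apply _ (hm s hs),
      withDensity_apply _ (hm s hs), setLIntegral_condLExp hm P X hs]
  have hgm : Measurable g := hg.mono hm le_rfl
  calc ∫⁻ ω, g ω * condLExp m P X ω ∂P
      = ∫⁻ ω, g ω ∂(P.withDensity (condLExp m P X)) := by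
        rw [lintegral_withDensity_eq_lintegral_mul₀ (measurable_condLExp' m P X).aemeasurable
          hgm.aemeasurable]
        simp [mul_comm]
    _ = ∫⁻ ω, g ω ∂(P.withDensity X) := by
        rw [← lintegral_trim hm hg, htrim, lintegral_trim hm hg]
    _ = ∫⁻ ω, g ω * X ω ∂P := by
        rw [lintegral_withDensity_eq_lintegral_mul₀ hX hgm.aemeasurable]
        simp [mul_comm]

theorem condLExp_mul (hm : m ≤ mΩ) {g X : Ω → ℝ≥0∞} (hg : Measurable[m] g)
    (hX : AEMeasurable X P) :
    condLExp m P (fun ω => g ω * X ω) =ᵐ[P] fun ω => g ω * condLExp m P X ω := by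
  refine (ae_eq_condLExp hm P _ (Measurable.mul hg (measurable_condLExp m P X)) ?_).symm
  intro s hs
  have h := lintegral_mul_condLExp (P := P) hm (hg.indicator hs) hX
  rw [← lintegral_indicator (hm s hs), ← lintegral_indicator (hm s hs)]
  refine (Eq.trans (lintegral_congr fun ω => ?_) h).trans (lintegral_congr fun ω => ?_)
  · exact Set.indicator_mul_left s g (condLExp m P X)
  · exact (Set.indicator_mul_left s g X).symm

theorem condLExp_le_of_setLIntegral_le (hm : m ≤ mΩ) {X Y : Ω → ℝ≥0∞} (hY : Measurable[m] Y)
    (h : ∀ s, MeasurableSet[m] s → ∫⁻ ω in s, X ω ∂P ≤ ∫⁻ ω in s, Y ω ∂P) :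
    condLExp m P X ≤ᵐ[P] Y := by
  apply ae_le_of_ae_le_trim (hm := hm)
  apply ae_le_of_forall_setLIntegral_le_of_sigmaFinite (μ := P.trim hm)
    (measurable_condLExp m P X)
  intro s hs _
  rw [setLIntegral_condLExp_trim hm _ _ hs, setLIntegral_trim hm hY hs]
  exact h s hs

theorem condNorm_top (hm : m ≤ mΩ) (R : Ω → ℝ≥0∞) :
    IsLeastMajorant m P R (condNorm hm P ∞ R) := by
  rw [condNorm, if_pos rfl]
  exact (exists_isLeastMajorant hm P R).choose_spec

theorem condNorm_of_ne_top (hm : m ≤ mΩ) (hp : p ≠ ∞) (R : Ω → ℝ≥0∞) (ω : Ω) :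
    condNorm hm P p R ω = (condLExp m P (fun ω' => R ω' ^ p.toReal) ω) ^ (1 / p.toReal) := by
  rw [condNorm, if_neg hp]

theorem toReal_pos_of_one_le (hp1 : 1 ≤ p) (hp : p ≠ ∞) : 0 < p.toReal :=
  ENNReal.toReal_pos (zero_lt_one.trans_le hp1).ne' hp

theorem one_le_toReal (hp1 : 1 ≤ p) (hp : p ≠ ∞) : 1 ≤ p.toReal :=
  by
  simpa using (ENNReal.toReal_le_toReal ENNReal.one_ne_top hp).2 hp1

theorem condNorm_rpow (hm : m ≤ mΩ) (hp1 : 1 ≤ p) (hp : p ≠ ∞) (R : Ω → ℝ≥0∞) (ω : Ω) :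
    condNorm hm P p R ω ^ p.toReal = condLExp m P (fun ω' => R ω' ^ p.toReal) ω := by
  rw [condNorm_of_ne_top hm hp, ← ENNReal.rpow_mul,
    one_div_mul_cancel (toReal_pos_of_one_le hp1 hp).ne', ENNReal.rpow_one]

theorem measurable_condNorm (hm : m ≤ mΩ) (p : ℝ≥0∞) (R : Ω → ℝ≥0∞) :
    Measurable[m] (condNorm hm P p R) := by
  by_cases hp : p = ∞
  · subst hp
    exact (condNorm_top hm R).1
  · rw [condNorm, if_neg hp]
    exact (measurable_condLExp m P _).pow_const _

theorem measurable_condNorm' (hm : m ≤ mΩ) (p : ℝ≥0∞) (R : Ω → ℝ≥0∞) :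
    Measurable (condNorm hm P p R) :=
  (measurable_condNorm hm p R).mono hm le_rfl

theorem setLIntegral_condNorm_rpow (hm : m ≤ mΩ) (hp1 : 1 ≤ p) (hp : p ≠ ∞) (R : Ω → ℝ≥0∞)
    {s : Set Ω} (hs : MeasurableSet[m] s) :
    ∫⁻ ω in s, condNorm hm P p R ω ^ p.toReal ∂P = ∫⁻ ω in s, R ω ^ p.toReal ∂P := by
  simp_rw [condNorm_rpow hm hp1 hp R]
  exact setLIntegral_condLExp hm P _ hs

theorem condNorm_le_of_condLExp_le (hm : m ≤ mΩ) (hp1 : 1 ≤ p) (hp : p ≠ ∞)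
    {R N : Ω → ℝ≥0∞}
    (h : condLExp m P (fun ω => R ω ^ p.toReal) ≤ᵐ[P] fun ω => N ω ^ p.toReal) :
    condNorm hm P p R ≤ᵐ[P] N := by
  filter_upwards [h] with ω hω
  rw [← condNorm_rpow hm hp1 hp] at hω
  exact (ENNReal.rpow_le_rpow_iff (toReal_pos_of_one_le hp1 hp)).1 hω

/-- The bridge from unconditional to conditional estimates: an L^p bound holding on every set of `m`
becomes an a.s. bound of conditional norms. Doob's inequality and the L² orthogonality enter through
it. -/
theorem condNorm_le_of_setLIntegral_le (hm : m ≤ mΩ) (hp1 : 1 ≤ p) (hp : p ≠ ∞)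
    {R N : Ω → ℝ≥0∞} (hN : Measurable[m] N)
    (h : ∀ s, MeasurableSet[m] s →
      ∫⁻ ω in s, R ω ^ p.toReal ∂P ≤ ∫⁻ ω in s, N ω ^ p.toReal ∂P) :
    condNorm hm P p R ≤ᵐ[P] N :=
  condNorm_le_of_condLExp_le hm hp1 hp
    (condLExp_le_of_setLIntegral_le hm (hN.pow_const _) h)

theorem condNorm_mono (hm : m ≤ mΩ) (hp1 : 1 ≤ p) {R S : Ω → ℝ≥0∞} (h : R ≤ᵐ[P] S) :
    condNorm hm P p R ≤ᵐ[P] condNorm hm P p S := by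
  by_cases hp : p = ∞
  · subst hp
    exact (condNorm_top hm R).2.2 _ (condNorm_top hm S).1 (h.trans (condNorm_top hm S).2.1)
  · refine condNorm_le_of_setLIntegral_le hm hp1 hp (measurable_condNorm hm p S) fun s hs => ?_
    rw [setLIntegral_condNorm_rpow hm hp1 hp S hs]
    refine lintegral_mono_ae (ae_restrict_of_ae ?_)
    filter_upwards [h] with ω hω using ENNReal.rpow_le_rpow hω ENNReal.toReal_nonneg

theorem condNorm_congr (hm : m ≤ mΩ) (hp1 : 1 ≤ p) {R S : Ω → ℝ≥0∞} (h : R =ᵐ[P] S) :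
    condNorm hm P p R =ᵐ[P] condNorm hm P p S :=
  (condNorm_mono hm hp1 h.le).antisymm (condNorm_mono hm hp1 h.symm.le)

theorem condNorm_le_of_le (hm : m ≤ mΩ) (hp1 : 1 ≤ p) {R N : Ω → ℝ≥0∞} (hN : Measurable[m] N)
    (h : R ≤ᵐ[P] N) : condNorm hm P p R ≤ᵐ[P] N := by
  by_cases hp : p = ∞
  · subst hp
    exact (condNorm_top hm R).2.2 _ hN h
  · refine condNorm_le_of_setLIntegral_le hm hp1 hp hN fun s hs => ?_
    refine lintegral_mono_ae (ae_restrict_of_ae ?_)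
    filter_upwards [h] with ω hω using ENNReal.rpow_le_rpow hω ENNReal.toReal_nonneg

theorem condNorm_mul_le (hm : m ≤ mΩ) (hp1 : 1 ≤ p) {g R : Ω → ℝ≥0∞} (hg : Measurable[m] g)
    (hR : AEMeasurable R P) :
    condNorm hm P p (fun ω => g ω * R ω) ≤ᵐ[P] fun ω => g ω * condNorm hm P p R ω := by
  by_cases hp : p = ∞
  · subst hp
    refine condNorm_le_of_le hm hp1 (Measurable.mul hg (measurable_condNorm hm ∞ R)) ?_
    filter_upwards [(condNorm_top (P := P) hm R).2.1] with ω hω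
    gcongr
  · refine condNorm_le_of_condLExp_le hm hp1 hp ?_
    have hp0 := (toReal_pos_of_one_le hp1 hp).le
    have h := condLExp_mul (P := P) hm (hg.pow_const p.toReal) (hR.pow_const p.toReal)
    simp_rw [ENNReal.mul_rpow_of_nonneg _ _ hp0, condNorm_rpow hm hp1 hp]
    exact h.le

/-- A crude conditional Jensen inequality. -/
theorem condLExp_le_two_mul_condNorm (hm : m ≤ mΩ) (hp1 : 1 ≤ p) {R : Ω → ℝ≥0∞}
    (hR : AEMeasurable R P) :
    condLExp m P R ≤ᵐ[P] fun ω => 2 * condNorm hm P p R ω := by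
  by_cases hp : p = ∞
  · subst hp
    have h := condLExp_mono (mΩ := m) (condNorm_top (P := P) hm R).2.1
    rw [condLExp_eq_self hm P (measurable_condNorm hm ∞ R)] at h
    filter_upwards [h] with ω hω
    exact hω.trans (le_mul_of_one_le_left zero_le one_le_two)
  · have hq := one_le_toReal hp1 hp
    -- With N the conditional norm and a = N + ε, separating R ≤ a from R ≥ a gives R ≤ a + a^(1-p)
    -- R^p. The conditional expectation of the right side is a + a^(1-p) N^p ≤ 2a. The factor 2 is
    -- harmless, as only finiteness, vanishing and convergence are deduced from this bound.
    have key : ∀ ε : ℝ≥0, 0 < ε →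
        ∀ᵐ ω ∂P, condLExp m P R ω ≤ 2 * (condNorm hm P p R ω + ε) := by
      intro ε hε
      set a : Ω → ℝ≥0∞ := fun ω => condNorm hm P p R ω + ε with ha
      have ham : Measurable[m] a := Measurable.add_const (measurable_condNorm hm p R) _
      have ha0 : ∀ ω, a ω ≠ 0 := fun ω => by simp [ha, hε.ne']
      have hpt : ∀ ω, R ω ≤ a ω + a ω ^ (1 - p.toReal) * R ω ^ p.toReal := by
        intro ω
        rcases le_total (R ω) (a ω) with h | h
        · exact h.trans le_self_add
        · rcases eq_or_ne (R ω) ∞ with hRt | hRt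
          · rcases eq_or_ne (a ω) ∞ with hat | hat
            · simp [hat]
            · have : a ω ^ (1 - p.toReal) ≠ 0 := by
                simp [ENNReal.rpow_eq_zero_iff, ha0, hat]
              rw [hRt, ENNReal.top_rpow_of_pos (by linarith), ENNReal.mul_top this]
              simp
          · have hR0 : R ω ≠ 0 := fun h0 => ha0 ω (le_antisymm (h0 ▸ h) zero_le)
            have hat : a ω ≠ ∞ := ne_top_of_le_ne_top hRt h
            refine le_trans ?_ le_add_self
            calc R ω = R ω ^ (1 - p.toReal) * R ω ^ p.toReal := by
                  rw [← ENNReal.rpow_add _ _ hR0 hRt]; simp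
              _ ≤ a ω ^ (1 - p.toReal) * R ω ^ p.toReal := by
                  gcongr ?_ * _
                  rw [show 1 - p.toReal = -(p.toReal - 1) by ring, ENNReal.rpow_neg,
                    ENNReal.rpow_neg]
                  exact ENNReal.inv_le_inv.2 (ENNReal.rpow_le_rpow h (by linarith))
      have h1 := condLExp_mono (P := P) (mΩ := m) (Eventually.of_forall hpt)
      have h2 := condLExp_add_left (P := P) (mΩ := m) (X := a)
        (fun ω => a ω ^ (1 - p.toReal) * R ω ^ p.toReal) (ham.mono hm le_rfl).aemeasurable
      have h3 := condLExp_mul (P := P) hm (ham.pow_const (1 - p.toReal)) (hR.pow_const p.toReal)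
      rw [condLExp_eq_self hm P ham] at h2
      filter_upwards [h1, h2, h3] with ω h1 h2 h3
      rw [two_mul]
      refine h1.trans ?_
      have h2' : condLExp m P (fun ω => a ω + a ω ^ (1 - p.toReal) * R ω ^ p.toReal) ω =
        a ω + condLExp m P (fun ω => a ω ^ (1 - p.toReal) * R ω ^ p.toReal) ω := h2
      rw [h2', h3, ← condNorm_rpow hm hp1 hp]
      gcongr a ω + ?_
      rcases eq_or_ne (a ω) ∞ with hat | hat
      · exact le_top.trans_eq hat.symm
      calc a ω ^ (1 - p.toReal) * condNorm hm P p R ω ^ p.toReal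
          ≤ a ω ^ (1 - p.toReal) * a ω ^ p.toReal := by
            gcongr
            exact le_self_add
        _ = a ω := by rw [← ENNReal.rpow_add _ _ (ha0 ω) hat]; simp
    have hall := ae_all_iff.2 fun n : ℕ =>
      key (1 / ((n : ℝ≥0) + 1)) (by positivity)
    filter_upwards [hall] with ω hω
    have hlim : Tendsto (fun n : ℕ => 2 * (condNorm hm P p R ω + ((1 / ((n : ℝ≥0) + 1) : ℝ≥0) : ℝ≥0∞)))
        atTop (𝓝 (2 * (condNorm hm P p R ω + ((0 : ℝ≥0) : ℝ≥0∞)))) := by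
      refine ENNReal.Tendsto.const_mul (tendsto_const_nhds.add ?_) (Or.inr (by simp))
      exact ENNReal.tendsto_coe.2 tendsto_one_div_add_atTop_nhds_zero_nat
    simpa using ge_of_tendsto' hlim hω

theorem setLIntegral_le_two_mul_condNorm (hm : m ≤ mΩ) (hp1 : 1 ≤ p) {R : Ω → ℝ≥0∞}
    (hR : AEMeasurable R P) {s : Set Ω} (hs : MeasurableSet[m] s) :
    ∫⁻ ω in s, R ω ∂P ≤ 2 * ∫⁻ ω in s, condNorm hm P p R ω ∂P := by
  rw [← setLIntegral_condLExp hm P R hs, ← lintegral_const_mul _ (measurable_condNorm' hm p R)]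
  exact lintegral_mono_ae (ae_restrict_of_ae (condLExp_le_two_mul_condNorm hm hp1 hR))

/-- On the `m`-measurable set where the conditional norm is at most n, the L¹ bound makes the
integral of R finite. -/
theorem ae_lt_top_of_condNorm_lt_top (hm : m ≤ mΩ) (hp1 : 1 ≤ p) {R : Ω → ℝ≥0∞}
    (hR : AEMeasurable R P) (h : ∀ᵐ ω ∂P, condNorm hm P p R ω < ∞) : ∀ᵐ ω ∂P, R ω < ∞ := by
  have hs : ∀ n : ℕ, MeasurableSet[m] {ω | condNorm hm P p R ω ≤ n} := fun n =>
    measurable_condNorm hm p R measurableSet_Iic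
  have hn : ∀ n : ℕ, ∀ᵐ ω ∂P, condNorm hm P p R ω ≤ n → R ω < ∞ := by
    intro n
    refine (ae_restrict_iff' (hm _ (hs n))).1 (ae_lt_top' hR.restrict ?_)
    refine ne_top_of_le_ne_top ?_ (setLIntegral_le_two_mul_condNorm hm hp1 hR (hs n))
    refine ENNReal.mul_ne_top (by simp) (ne_top_of_le_ne_top (b := (n : ℝ≥0∞)) (by simp) ?_)
    calc ∫⁻ ω in {ω | condNorm hm P p R ω ≤ n}, condNorm hm P p R ω ∂P
        ≤ ∫⁻ ω in {ω | condNorm hm P p R ω ≤ n}, (n : ℝ≥0∞) ∂P :=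
          setLIntegral_mono' (hm _ (hs n)) fun ω hω => hω
      _ ≤ n := by
        rw [setLIntegral_const]
        exact mul_le_of_le_one_right zero_le prob_le_one
  filter_upwards [h, ae_all_iff.2 hn] with ω h1 h2
  obtain ⟨n, hn⟩ := ENNReal.exists_nat_gt h1.ne
  exact h2 n hn.le

theorem ae_eq_zero_of_condNorm_eq_zero (hm : m ≤ mΩ) (hp1 : 1 ≤ p) {R : Ω → ℝ≥0∞}
    (hR : AEMeasurable R P) (h : ∀ᵐ ω ∂P, condNorm hm P p R ω = 0) : ∀ᵐ ω ∂P, R ω = 0 := by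
  have h1 := setLIntegral_le_two_mul_condNorm (P := P) hm hp1 hR (s := Set.univ) MeasurableSet.univ
  rw [setLIntegral_univ, setLIntegral_univ, (lintegral_eq_zero_iff (measurable_condNorm' hm p R)).2 h,
    mul_zero] at h1
  exact (lintegral_eq_zero_iff' hR).1 (le_antisymm h1 zero_le)

/-- Convexity of t ↦ t^r at the points x/w₁ and y/w₂ with weights w₁ and w₂. With weights measurable
for the conditioning σ-algebra, this becomes the conditional Minkowski inequality. -/
theorem ennreal_add_rpow_le {w₁ w₂ x y : ℝ≥0∞} {r : ℝ} (hr : 1 ≤ r) (hw : w₁ + w₂ = 1)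
    (h1 : w₁ ≠ 0) (h2 : w₂ ≠ 0) :
    (x + y) ^ r ≤ w₁ ^ (1 - r) * x ^ r + w₂ ^ (1 - r) * y ^ r := by
  have aux : ∀ {w x : ℝ≥0∞}, w ≠ 0 → w ≤ 1 → w * (x / w) = x ∧
      w * (x / w) ^ r = w ^ (1 - r) * x ^ r := by
    intro w x hw hw1
    have hwt : w ≠ ∞ := ne_top_of_le_ne_top ENNReal.one_ne_top hw1
    refine ⟨ENNReal.mul_div_cancel hw hwt, ?_⟩
    rw [ENNReal.div_rpow_of_nonneg _ _ (by linarith), ENNReal.rpow_sub _ _ hw hwt,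
      ENNReal.rpow_one, div_eq_mul_inv, div_eq_mul_inv]
    ring
  have a1 := aux (x := x) h1 (hw ▸ le_self_add)
  have a2 := aux (x := y) h2 (hw ▸ le_add_self)
  have := ENNReal.rpow_arith_mean_le_arith_mean2_rpow w₁ w₂ (x / w₁) (y / w₂) hw hr
  rwa [a1.1, a1.2, a2.1, a2.2] at this

/-- The conditional Minkowski inequality. -/
theorem condNorm_add_le (hm : m ≤ mΩ) (hp1 : 1 ≤ p) {R S : Ω → ℝ≥0∞}
    (hR : AEMeasurable R P) (hS : AEMeasurable S P) :
    condNorm hm P p (fun ω => R ω + S ω) ≤ᵐ[P]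
      fun ω => condNorm hm P p R ω + condNorm hm P p S ω := by
  classical
  by_cases hp : p = ∞
  · subst hp
    refine condNorm_le_of_le hm hp1
      (Measurable.add (measurable_condNorm hm ∞ R) (measurable_condNorm hm ∞ S)) ?_
    filter_upwards [(condNorm_top (P := P) hm R).2.1, (condNorm_top (P := P) hm S).2.1]
      with ω h1 h2 using add_le_add h1 h2
  · have hq := one_le_toReal hp1 hp
    have hq0 := toReal_pos_of_one_le hp1 hp
    set a := condNorm hm P p R with ha
    set b := condNorm hm P p S with hb
    have ham : Measurable[m] a := measurable_condNorm hm p R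
    have hbm : Measurable[m] b := measurable_condNorm hm p S
    have key : ∀ ε : ℝ≥0, 0 < ε →
        ∀ᵐ ω ∂P, condNorm hm P p (fun ω => R ω + S ω) ω ≤ (a ω + ε) + (b ω + ε) := by
      intro ε hε
      have hD : MeasurableSet[m] ({ω | a ω = ∞} ∪ {ω | b ω = ∞}) :=
        MeasurableSet.union (ham (measurableSet_singleton ∞)) (hbm (measurableSet_singleton ∞))
      -- The optimal weights are a/(a+b) and b/(a+b). To make them well defined, a and b are shifted
      -- by ε, and replaced by 1 where one of them is infinite; on that set the claim is trivial.
      let a' : Ω → ℝ≥0∞ := ({ω | a ω = ∞} ∪ {ω | b ω = ∞}).piecewise (fun _ => 1) fun ω => a ω + ε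
      let b' : Ω → ℝ≥0∞ := ({ω | a ω = ∞} ∪ {ω | b ω = ∞}).piecewise (fun _ => 1) fun ω => b ω + ε
      have ham' : Measurable[m] a' :=
        Measurable.piecewise hD measurable_const (Measurable.add_const ham _)
      have hbm' : Measurable[m] b' :=
        Measurable.piecewise hD measurable_const (Measurable.add_const hbm _)
      have hε' : (ε : ℝ≥0∞) ≠ 0 := by simpa using hε.ne'
      have hprop : ∀ ω, a' ω ≠ 0 ∧ a' ω ≠ ∞ ∧ b' ω ≠ 0 ∧ b' ω ≠ ∞ := by
        intro ω
        by_cases hω : ω ∈ {ω | a ω = ∞} ∪ {ω | b ω = ∞}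
        · simp [a', b', Set.piecewise_eq_of_mem _ _ _ hω]
        · simp only [a', b', Set.piecewise_eq_of_notMem _ _ _ hω]
          have h' : a ω ≠ ∞ ∧ b ω ≠ ∞ := by
            constructor
            · exact fun h => hω (Or.inl h)
            · exact fun h => hω (Or.inr h)
          simp [hε.ne', h'.1, h'.2]
      let w₁ : Ω → ℝ≥0∞ := fun ω => a' ω / (a' ω + b' ω)
      let w₂ : Ω → ℝ≥0∞ := fun ω => b' ω / (a' ω + b' ω)
      have hw₁ : Measurable[m] w₁ := Measurable.div ham' (Measurable.add ham' hbm')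
      have hw₂ : Measurable[m] w₂ := Measurable.div hbm' (Measurable.add ham' hbm')
      have hw : ∀ ω, w₁ ω + w₂ ω = 1 ∧ w₁ ω ≠ 0 ∧ w₂ ω ≠ 0 := by
        intro ω
        obtain ⟨h1, h2, h3, h4⟩ := hprop ω
        have h5 : a' ω + b' ω ≠ ∞ := ENNReal.add_ne_top.2 ⟨h2, h4⟩
        refine ⟨?_, ?_, ?_⟩
        · simp only [w₁, w₂]
          rw [ENNReal.div_add_div_same, ENNReal.div_self (by simp [h1]) h5]
        · exact (ENNReal.div_pos h1 h5).ne'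
        · exact (ENNReal.div_pos h3 h5).ne'
      have e1 := condLExp_mul (P := P) hm (hw₁.pow_const (1 - p.toReal)) (hR.pow_const p.toReal)
      have e2 := condLExp_mul (P := P) hm (hw₂.pow_const (1 - p.toReal)) (hS.pow_const p.toReal)
      have e3 := condLExp_mono (P := P) (mΩ := m) (Eventually.of_forall fun ω =>
        ennreal_add_rpow_le (x := R ω) (y := S ω) hq (hw ω).1 (hw ω).2.1 (hw ω).2.2)
      have e4 := condLExp_add_left (P := P) (mΩ := m)
        (X := fun ω => w₁ ω ^ (1 - p.toReal) * R ω ^ p.toReal)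
        (fun ω => w₂ ω ^ (1 - p.toReal) * S ω ^ p.toReal)
        (((hw₁.mono hm le_rfl).pow_const _).aemeasurable.mul (hR.pow_const _))
      filter_upwards [e1, e2, e3, e4] with ω e1 e2 e3 e4
      by_cases hω : ω ∈ {ω | a ω = ∞} ∪ {ω | b ω = ∞}
      · rcases hω with h | h <;> simp only [Set.mem_ofPred_eq] at h <;> simp [h]
      have ea : a' ω = a ω + ε := Set.piecewise_eq_of_notMem _ _ _ hω
      have eb : b' ω = b ω + ε := Set.piecewise_eq_of_notMem _ _ _ hω
      obtain ⟨h1, h2, h3, h4⟩ := hprop ω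
      have h5 : a' ω + b' ω ≠ ∞ := ENNReal.add_ne_top.2 ⟨h2, h4⟩
      have h6 : a' ω + b' ω ≠ 0 := by simp [h1]
      rw [← ea, ← eb, ← ENNReal.rpow_le_rpow_iff hq0, condNorm_rpow hm hp1 hp]
      refine e3.trans ?_
      change condLExp m P ((fun ω => w₁ ω ^ (1 - p.toReal) * R ω ^ p.toReal) +
        fun ω => w₂ ω ^ (1 - p.toReal) * S ω ^ p.toReal) ω ≤ _
      rw [e4, Pi.add_apply, e1, e2, ← condNorm_rpow hm hp1 hp, ← condNorm_rpow hm hp1 hp]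
      -- With this choice both terms of the convexity bound become weight times (a'+b')^p, and the
      -- weights add up to 1.
      have aux : ∀ x : ℝ≥0∞, x ≠ 0 → x ≠ ∞ →
          (x / (a' ω + b' ω)) ^ (1 - p.toReal) * x ^ p.toReal =
            x / (a' ω + b' ω) * (a' ω + b' ω) ^ p.toReal := by
        intro x hx hx'
        have hd0 : x / (a' ω + b' ω) ≠ 0 := (ENNReal.div_pos hx h5).ne'
        have hdt : x / (a' ω + b' ω) ≠ ∞ := ENNReal.div_ne_top hx' h6
        have hx2 : x ^ p.toReal = (x / (a' ω + b' ω)) ^ p.toReal * (a' ω + b' ω) ^ p.toReal := by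
          rw [← ENNReal.mul_rpow_of_nonneg _ _ hq0.le, ENNReal.div_mul_cancel h6 h5]
        rw [hx2, ← mul_assoc, ← ENNReal.rpow_add _ _ hd0 hdt]
        simp
      calc w₁ ω ^ (1 - p.toReal) * a ω ^ p.toReal + w₂ ω ^ (1 - p.toReal) * b ω ^ p.toReal
          ≤ w₁ ω ^ (1 - p.toReal) * a' ω ^ p.toReal + w₂ ω ^ (1 - p.toReal) * b' ω ^ p.toReal := by
            rw [ea, eb]
            gcongr <;> exact le_self_add
        _ = w₁ ω * (a' ω + b' ω) ^ p.toReal + w₂ ω * (a' ω + b' ω) ^ p.toReal := by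
            rw [aux _ h1 h2, aux _ h3 h4]
        _ = (a' ω + b' ω) ^ p.toReal := by rw [← add_mul, (hw ω).1, one_mul]
    have hall := ae_all_iff.2 fun n : ℕ =>
      key (1 / ((n : ℝ≥0) + 1)) (by positivity)
    filter_upwards [hall] with ω hω
    have hz : Tendsto (fun n : ℕ => ((1 / ((n : ℝ≥0) + 1) : ℝ≥0) : ℝ≥0∞)) atTop
        (𝓝 ((0 : ℝ≥0) : ℝ≥0∞)) :=
      ENNReal.tendsto_coe.2 tendsto_one_div_add_atTop_nhds_zero_nat
    have hlim := (tendsto_const_nhds (x := a ω).add hz).add (tendsto_const_nhds (x := b ω).add hz)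
    simpa using ge_of_tendsto' hlim hω

/-- Monotone convergence on each set of `m` for p < ∞; for p = ∞ only a countable union of null sets
is involved. -/
theorem condNorm_iSup_le (hm : m ≤ mΩ) (hp1 : 1 ≤ p) {R : ℕ → Ω → ℝ≥0∞}
    (hR : ∀ n, AEMeasurable (R n) P) (hmono : Monotone R) {N : Ω → ℝ≥0∞} (hN : Measurable[m] N)
    (h : ∀ n, condNorm hm P p (R n) ≤ᵐ[P] N) :
    condNorm hm P p (fun ω => ⨆ n, R n ω) ≤ᵐ[P] N := by
  by_cases hp : p = ∞
  · subst hp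
    refine condNorm_le_of_le hm hp1 hN ?_
    have := ae_all_iff.2 fun n => (condNorm_top (P := P) hm (R n)).2.1.trans (h n)
    filter_upwards [this] with ω hω using iSup_le hω
  · have hq0 := toReal_pos_of_one_le hp1 hp
    refine condNorm_le_of_setLIntegral_le hm hp1 hp hN fun s hs => ?_
    have heq : ∀ ω, (⨆ n, R n ω) ^ p.toReal = ⨆ n, R n ω ^ p.toReal := fun ω =>
      (ENNReal.orderIsoRpow p.toReal hq0).map_iSup _
    simp_rw [heq]
    rw [lintegral_iSup' (fun n => ((hR n).pow_const _).restrict)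
      (Eventually.of_forall fun ω i j hij => ENNReal.rpow_le_rpow (hmono hij ω) hq0.le)]
    refine iSup_le fun n => ?_
    rw [← setLIntegral_condNorm_rpow hm hp1 hp (R n) hs]
    refine lintegral_mono_ae (ae_restrict_of_ae ?_)
    filter_upwards [h n] with ω hω using ENNReal.rpow_le_rpow hω hq0.le

theorem condNorm_zero (hm : m ≤ mΩ) (hp1 : 1 ≤ p) :
    condNorm hm P p (fun _ => 0) ≤ᵐ[P] fun _ => 0 :=
  condNorm_le_of_le hm hp1 measurable_const (Eventually.of_forall fun _ => le_rfl)

theorem condNorm_sum_le (hm : m ≤ mΩ) (hp1 : 1 ≤ p) {R : ℕ → Ω → ℝ≥0∞}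
    (hR : ∀ n, AEMeasurable (R n) P) (n : ℕ) :
    condNorm hm P p (fun ω => ∑ i ∈ Finset.range n, R i ω) ≤ᵐ[P]
      fun ω => ∑ i ∈ Finset.range n, condNorm hm P p (R i) ω := by
  induction n with
  | zero => simpa using condNorm_zero (P := P) hm hp1
  | succ n ih =>
    simp_rw [Finset.sum_range_succ]
    have h1 := condNorm_add_le (P := P) hm hp1 (R := fun ω => ∑ i ∈ Finset.range n, R i ω)
      (Finset.aemeasurable_fun_sum _ fun i _ => hR i) (hR n)
    filter_upwards [h1, ih] with ω h1 h2
    exact h1.trans (add_le_add h2 le_rfl)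

theorem measurable_tsum_condNorm (hm : m ≤ mΩ) (R : ℕ → Ω → ℝ≥0∞) :
    Measurable[m] fun ω => ∑' i, condNorm hm P p (R i) ω := by
  simp_rw [ENNReal.tsum_eq_iSup_nat]
  exact Measurable.iSup fun n => Finset.measurable_fun_sum _ fun i _ => measurable_condNorm hm p _

/-- The countable triangle inequality. It lets a.s. summable conditional norms force a.s. summable
path suprema, which is the heart of completeness. -/
theorem condNorm_tsum_le (hm : m ≤ mΩ) (hp1 : 1 ≤ p) {R : ℕ → Ω → ℝ≥0∞}
    (hR : ∀ n, AEMeasurable (R n) P) :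
    condNorm hm P p (fun ω => ∑' i, R i ω) ≤ᵐ[P] fun ω => ∑' i, condNorm hm P p (R i) ω := by
  simp_rw [ENNReal.tsum_eq_iSup_nat (f := fun i => R i _)]
  refine condNorm_iSup_le hm hp1 (fun n => Finset.aemeasurable_fun_sum _ fun i _ => hR i)
    (fun i j hij ω => Finset.sum_le_sum_of_subset (Finset.range_mono hij))
    (measurable_tsum_condNorm hm R) fun n => ?_
  filter_upwards [condNorm_sum_le (P := P) hm hp1 hR n] with ω hω
  exact hω.trans (ENNReal.sum_le_tsum _)

theorem condNorm_lt_top_of_lintegral_lt_top (hm : m ≤ mΩ) (hp : p ≠ ∞)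
    {R : Ω → ℝ≥0∞} (h : ∫⁻ ω, R ω ^ p.toReal ∂P ≠ ∞) : ∀ᵐ ω ∂P, condNorm hm P p R ω < ∞ := by
  filter_upwards [condLExp_lt_top (mΩ := m) h] with ω hω
  rw [condNorm_of_ne_top hm hp]
  exact ENNReal.rpow_lt_top_of_nonneg (by positivity) hω.ne

end CondNorm

/-! ### RCLL paths and their values on a countable dense set of times -/

section Paths

variable {T : ℝ≥0}

/-- A dense sequence of times in `[0, T]` that contains `T`. -/
noncomputable def timeSeq (T : ℝ≥0) : ℕ → TimeSet T
  | 0 => ⊤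
  | n + 1 => TopologicalSpace.denseSeq (TimeSet T) n

theorem dense_range_timeSeq : Dense (Set.range (timeSeq T)) := by
  refine (TopologicalSpace.denseRange_denseSeq (TimeSet T)).mono ?_
  rintro _ ⟨n, rfl⟩
  exact ⟨n + 1, rfl⟩

theorem top_mem_range_timeSeq : ⊤ ∈ Set.range (timeSeq T) := ⟨0, rfl⟩

theorem nhdsWithin_Ioi_inter_timeSeq_neBot {t : TimeSet T} (ht : t ≠ ⊤) :
    (𝓝[Set.Ioi t ∩ Set.range (timeSeq T)] t).NeBot := by
  rw [← mem_closure_iff_nhdsWithin_neBot]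
  have h1 : t ∈ closure (Set.Ioi t) := by
    rw [closure_Ioi' ⟨⊤, lt_top_iff_ne_top.2 ht⟩]
    exact Set.self_mem_Ici
  exact closure_minimal (dense_range_timeSeq.open_subset_closure_inter isOpen_Ioi)
    isClosed_closure h1

/-- At t = T the only available point is T itself, which is why `timeSeq` contains it. -/
theorem nhdsWithin_Ici_inter_timeSeq_neBot (t : TimeSet T) :
    (𝓝[Set.Ici t ∩ Set.range (timeSeq T)] t).NeBot := by
  rcases eq_or_ne t ⊤ with rfl | ht
  · rw [← mem_closure_iff_nhdsWithin_neBot]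
    exact subset_closure ⟨Set.self_mem_Ici, top_mem_range_timeSeq⟩
  · have := nhdsWithin_Ioi_inter_timeSeq_neBot ht
    exact this.mono (nhdsWithin_mono _ (Set.inter_subset_inter_left _ Set.Ioi_subset_Ici_self))

section

variable {G : Type*} [TopologicalSpace G]

theorem IsRCLL.tendsto_inter_timeSeq {f : TimeSet T → G} (hf : IsRCLL f) (t : TimeSet T) :
    Tendsto f (𝓝[Set.Ici t ∩ Set.range (timeSeq T)] t) (𝓝 (f t)) :=
  (hf t).1.mono_left (nhdsWithin_mono _ Set.inter_subset_left)

end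

/-- Right continuity recovers each value as a limit along `timeSeq`, so the supremum over all times
is a countable one. -/
theorem IsRCLL.iSup_enorm {G : Type*} [NormedAddCommGroup G] {f : TimeSet T → G} (hf : IsRCLL f) :
    ⨆ t, ‖f t‖ₑ = ⨆ n, ‖f (timeSeq T n)‖ₑ := by
  refine le_antisymm (iSup_le fun t => ?_) (iSup_le fun n => le_iSup (fun t => ‖f t‖ₑ) _)
  have := nhdsWithin_Ici_inter_timeSeq_neBot t
  refine le_of_tendsto (hf.tendsto_inter_timeSeq t).enorm ?_
  filter_upwards [self_mem_nhdsWithin] with s hs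
  obtain ⟨n, rfl⟩ := hs.2
  exact le_iSup (fun n => ‖f (timeSeq T n)‖ₑ) n

/-- Compactness of [0, T]: near each time the path is bounded on the right by its value there and on
the left by its left limit, up to 1. -/
theorem IsRCLL.exists_norm_le {G : Type*} [NormedAddCommGroup G] {f : TimeSet T → G}
    (hf : IsRCLL f) : ∃ c : ℝ, ∀ t, ‖f t‖ ≤ c := by
  have h : ∃ c : ℝ, ∀ t ∈ (Set.univ : Set (TimeSet T)), ‖f t‖ ≤ c := by
    have hcomp : CompactSpace (TimeSet T) := isCompact_iff_compactSpace.1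
      (Set.Icc_bot (α := ℝ≥0) (a := T) ▸ isCompact_Icc)
    refine IsCompact.induction_on (p := fun s => ∃ c : ℝ, ∀ t ∈ s, ‖f t‖ ≤ c) isCompact_univ
      ⟨0, by simp⟩ (fun s t hst ⟨c, hc⟩ => ⟨c, fun u hu => hc u (hst hu)⟩)
      (fun s t ⟨c, hc⟩ ⟨c', hc'⟩ => ⟨max c c', ?_⟩) fun t _ => ?_
    · rintro u (hu | hu)
      · exact (hc u hu).trans (le_max_left _ _)
      · exact (hc' u hu).trans (le_max_right _ _)
    · obtain ⟨h1, l, h2⟩ := hf t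
      have e1 : ∀ᶠ s in 𝓝[≥] t, ‖f s‖ < ‖f t‖ + 1 :=
        h1.norm.eventually (gt_mem_nhds (lt_add_one _))
      have e2 : ∀ᶠ s in 𝓝[<] t, ‖f s‖ < ‖l‖ + 1 :=
        h2.norm.eventually (gt_mem_nhds (lt_add_one _))
      refine ⟨{s | ‖f s‖ ≤ max (‖f t‖ + 1) (‖l‖ + 1)}, ?_, _, fun u hu => hu⟩
      rw [nhdsWithin_univ, ← nhdsLT_sup_nhdsGE]
      refine Filter.mem_sup.2 ⟨?_, ?_⟩
      · filter_upwards [e2] with s hs using hs.le.trans (le_max_right _ _)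
      · filter_upwards [e1] with s hs using hs.le.trans (le_max_left _ _)
  obtain ⟨c, hc⟩ := h
  exact ⟨c, fun t => hc t trivial⟩

theorem IsRCLL.iSup_enorm_lt_top {G : Type*} [NormedAddCommGroup G] {f : TimeSet T → G}
    (hf : IsRCLL f) : ⨆ t, ‖f t‖ₑ < ∞ := by
  obtain ⟨c, hc⟩ := hf.exists_norm_le
  refine lt_of_le_of_lt (iSup_le fun t => ?_) (ENNReal.ofReal_lt_top (r := c))
  rw [← ofReal_norm]
  exact ENNReal.ofReal_le_ofReal (hc t)

theorem isRCLL_const {G : Type*} [TopologicalSpace G] (c : G) : IsRCLL fun _ : TimeSet T => c :=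
  fun _ => ⟨continuousWithinAt_const, c, tendsto_const_nhds⟩

theorem IsRCLL.sub {G : Type*} [NormedAddCommGroup G] {f g : TimeSet T → G} (hf : IsRCLL f)
    (hg : IsRCLL g) : IsRCLL fun t => f t - g t := fun t =>
  ⟨(hf t).1.sub (hg t).1, by
    obtain ⟨l, hl⟩ := (hf t).2
    obtain ⟨l', hl'⟩ := (hg t).2
    exact ⟨l - l', hl.sub hl'⟩⟩

theorem IsRCLL.const_smul {G : Type*} [NormedAddCommGroup G] [NormedSpace ℝ G]
    {f : TimeSet T → G} (hf : IsRCLL f) (c : ℝ) : IsRCLL fun t => c • f t := fun t =>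
  ⟨(hf t).1.const_smul c, by
    obtain ⟨l, hl⟩ := (hf t).2
    exact ⟨c • l, hl.const_smul c⟩⟩

theorem isRCLL_of_tendstoUniformly {G : Type*} [NormedAddCommGroup G] [CompleteSpace G]
    {f : ℕ → TimeSet T → G} {g : TimeSet T → G} (hf : ∀ n, IsRCLL (f n))
    (h : TendstoUniformly f g atTop) : IsRCLL g := by
  intro t
  constructor
  · refine continuousWithinAt_of_locally_uniform_approx_of_continuousWithinAt Set.self_mem_Ici
      fun u hu => ?_
    obtain ⟨n, hn⟩ := (h u hu).exists
    exact ⟨Set.univ, Filter.univ_mem, f n, (hf n t).1, fun s _ => hn s⟩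
  · rcases eq_or_neBot (𝓝[<] t) with hbot | hne
    · exact ⟨g t, by rw [hbot]; exact tendsto_bot⟩
    refine cauchy_map_iff_exists_tendsto.1 ?_
    rw [Metric.cauchy_iff]
    refine ⟨inferInstance, fun ε hε => ?_⟩
    rw [Metric.tendstoUniformly_iff] at h
    obtain ⟨n, hn⟩ := (h (ε / 4) (by positivity)).exists
    obtain ⟨l, hl⟩ := (hf n t).2
    refine ⟨g '' {s | dist (f n s) l < ε / 4}, image_mem_map (hl (Metric.ball_mem_nhds _
      (by positivity))), ?_⟩
    rintro _ ⟨s, hs, rfl⟩ _ ⟨s', hs', rfl⟩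
    have h1 := hn s
    have h2 := hn s'
    have h3 : dist (f n s) l < ε / 4 := hs
    have h4 : dist (f n s') l < ε / 4 := hs'
    have := dist_triangle4 (g s) (f n s) (f n s') (g s')
    have := dist_triangle_right (f n s) (f n s') l
    rw [dist_comm (f n s') (g s')] at *
    linarith

end Paths

/-! ### Exhausting sequences of measurable sets -/

section Levels

variable {Ω : Type*} {m mΩ : MeasurableSpace Ω} {P : Measure Ω}

/-- An almost surely finite `m`-measurable function is bounded on each set of an exhausting
sequence of `m`-measurable sets. -/
theorem exists_levels {h : Ω → ℝ≥0∞} (hh : Measurable[m] h) (hfin : ∀ᵐ ω ∂P, h ω < ∞) :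
    ∃ B : ℕ → Set Ω, Monotone B ∧ (∀ n, MeasurableSet[m] (B n)) ∧ (⋃ n, B n) = Set.univ ∧
      ∀ n, ∀ᵐ ω ∂P, ω ∈ B n → h ω ≤ n := by
  -- The null set {h = ∞} is added to every level because the union has to be all of Ω, not almost
  -- all of it.
  refine ⟨fun n => {ω | h ω ≤ n} ∪ {ω | h ω = ∞}, ?_, ?_, ?_, ?_⟩
  · intro i j hij
    refine Set.union_subset_union_left _ fun ω (hω : h ω ≤ i) => ?_
    exact hω.trans (by exact_mod_cast hij)
  · exact fun n => MeasurableSet.union (hh measurableSet_Iic) (hh (measurableSet_singleton ∞))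
  · refine Set.eq_univ_of_forall fun ω => Set.mem_iUnion.2 ?_
    by_cases hω : h ω = ∞
    · exact ⟨0, Or.inr hω⟩
    · obtain ⟨n, hn⟩ := ENNReal.exists_nat_gt hω
      exact ⟨n, Or.inl hn.le⟩
  · intro n
    filter_upwards [hfin] with ω hω h'
    rcases h' with h' | h'
    · exact h'
    · exact absurd h' hω.ne

end Levels

/-! ### Path suprema, triangle inequalities for the conditional norm, and the space S^p -/

section Spaces

variable {T : ℝ≥0} {Ω : Type*} {mΩ : MeasurableSpace Ω} {P : Measure Ω} {d : ℕ}
  {𝓕 : Filtration (TimeSet T) mΩ} {p : ℝ≥0∞} {X Y : Proc T P d}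

/-- The supremum of the norms of a process over the times of `timeSeq`. -/
noncomputable def seqSup (X : Proc T P d) (ω : Ω) : ℝ≥0∞ := ⨆ n, ‖X (timeSeq T n) ω‖ₑ

theorem measurable_seqSup (X : Proc T P d) : Measurable (seqSup X) :=
  Measurable.iSup fun n => (X (timeSeq T n)).measurable.enorm

/-- `seqSup` involves countably many classes X_t, so it is measurable and independent of a version.
Estimates are made for it and transferred to the path supremum by this identity. -/
theorem IsRCLLVersion.iSup_enorm_ae_eq {x : TimeSet T → Ω → EuclideanSpace ℝ (Fin d)}
    (hx : IsRCLLVersion 𝓕 P x X) : (fun ω => ⨆ t, ‖x t ω‖ₑ) =ᵐ[P] seqSup X := by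
  filter_upwards [ae_all_iff.2 fun n => hx.version (timeSeq T n)] with ω hω
  rw [(hx.rcll ω).iSup_enorm, seqSup]
  simp_rw [hω]

theorem rcllVersion_spec (hX : X ∈ spaceS 𝓕 P d) : IsRCLLVersion 𝓕 P (rcllVersion 𝓕 P X) X := by
  have h : ∃ x, IsRCLLVersion 𝓕 P x X := hX
  rw [rcllVersion, dif_pos h]
  exact h.choose_spec

theorem pathSup_ae_eq (hX : X ∈ spaceS 𝓕 P d) : pathSup 𝓕 P X =ᵐ[P] seqSup X :=
  (rcllVersion_spec hX).iSup_enorm_ae_eq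

theorem pathSup_lt_top (hX : X ∈ spaceS 𝓕 P d) (ω : Ω) : pathSup 𝓕 P X ω < ∞ :=
  ((rcllVersion_spec hX).rcll ω).iSup_enorm_lt_top

theorem enorm_le_seqSup (hX : X ∈ spaceS 𝓕 P d) (t : TimeSet T) :
    ∀ᵐ ω ∂P, ‖X t ω‖ₑ ≤ seqSup X ω := by
  obtain ⟨x, hx⟩ := hX
  filter_upwards [hx.iSup_enorm_ae_eq, hx.version t] with ω h1 h2
  rw [← h1, ← h2]
  exact le_iSup (fun t => ‖x t ω‖ₑ) t

theorem seqSup_sub_le (X Y : Proc T P d) :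
    ∀ᵐ ω ∂P, seqSup (X - Y) ω ≤ seqSup X ω + seqSup Y ω := by
  filter_upwards [ae_all_iff.2 fun n => AEEqFun.coeFn_sub (X (timeSeq T n)) (Y (timeSeq T n))]
    with ω hω
  refine iSup_le fun n => ?_
  rw [Pi.sub_apply, hω n, Pi.sub_apply]
  exact (enorm_sub_le).trans (add_le_add (le_iSup (fun n => ‖X (timeSeq T n) ω‖ₑ) n)
    (le_iSup (fun n => ‖Y (timeSeq T n) ω‖ₑ) n))

theorem eq_of_seqSup_sub_eq_zero (h : X - Y ∈ spaceS 𝓕 P d)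
    (h0 : ∀ᵐ ω ∂P, seqSup (X - Y) ω = 0) : X = Y := by
  funext t
  refine AEEqFun.ext ?_
  filter_upwards [h0, enorm_le_seqSup h t, AEEqFun.coeFn_sub (X t) (Y t)] with ω h1 h2 h3
  rw [h1, Pi.sub_apply, h3] at h2
  have h4 := enorm_eq_zero.1 (le_antisymm h2 zero_le)
  exact sub_eq_zero.1 h4

theorem sub_mem_spaceS (hX : X ∈ spaceS 𝓕 P d) (hY : Y ∈ spaceS 𝓕 P d) :
    X - Y ∈ spaceS 𝓕 P d := by
  obtain ⟨x, hx⟩ := hX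
  obtain ⟨y, hy⟩ := hY
  refine ⟨fun t ω => x t ω - y t ω, fun t => (hx.adapted t).sub (hy.adapted t),
    fun ω => (hx.rcll ω).sub (hy.rcll ω), fun t => ?_⟩
  filter_upwards [hx.version t, hy.version t, AEEqFun.coeFn_sub (X t) (Y t)] with ω h1 h2 h3
  rw [Pi.sub_apply, h3, Pi.sub_apply, h1, h2]

theorem zero_mem_spaceS : (0 : Proc T P d) ∈ spaceS 𝓕 P d := by
  refine ⟨fun t ω => 0, fun t => stronglyMeasurable_const, fun ω => isRCLL_const 0, fun t => ?_⟩
  exact (AEEqFun.coeFn_zero (α := Ω) (β := EuclideanSpace ℝ (Fin d)) (μ := P)).symm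

/-- The constant process with value `X_0`. -/
theorem const_bot_mem_spaceS (hX : X ∈ spaceS 𝓕 P d) :
    (fun _ => X ⊥ : Proc T P d) ∈ spaceS 𝓕 P d := by
  obtain ⟨x, hx⟩ := hX
  exact ⟨fun _ ω => x ⊥ ω, fun t => (hx.adapted ⊥).mono (𝓕.mono bot_le),
    fun ω => isRCLL_const _, fun t => hx.version ⊥⟩

theorem aestronglyMeasurable_of_mem_spaceS (hX : X ∈ spaceS 𝓕 P d) (t : TimeSet T) :
    AEStronglyMeasurable[𝓕 t] (X t) P := by
  obtain ⟨x, hx⟩ := hX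
  exact ⟨x t, hx.adapted t, (hx.version t).symm⟩

theorem seqSup_const_bot_le (hX : X ∈ spaceS 𝓕 P d) :
    seqSup (fun _ => X ⊥ : Proc T P d) ≤ᵐ[P] seqSup X := by
  filter_upwards [enorm_le_seqSup hX ⊥] with ω hω using iSup_le fun _ => hω

variable [IsProbabilityMeasure P]

theorem procNorm_ae_eq (hp1 : 1 ≤ p) (hX : X ∈ spaceS 𝓕 P d) :
    procNorm 𝓕 P p X =ᵐ[P] condNorm (𝓕.le ⊥) P p (seqSup X) :=
  condNorm_congr _ hp1 (pathSup_ae_eq hX)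

theorem measurable_procNorm (X : Proc T P d) : Measurable[𝓕 ⊥] (procNorm 𝓕 P p X) :=
  measurable_condNorm _ _ _

theorem procNorm_le_condNorm (hp1 : 1 ≤ p) (hX : X ∈ spaceS 𝓕 P d) {R : Ω → ℝ≥0∞}
    (h : seqSup X ≤ᵐ[P] R) :
    procNorm 𝓕 P p X ≤ᵐ[P] condNorm (𝓕.le ⊥) P p R :=
  condNorm_mono _ hp1 ((pathSup_ae_eq hX).le.trans h)

theorem condNorm_le_procNorm (hp1 : 1 ≤ p) (hX : X ∈ spaceS 𝓕 P d) {R : Ω → ℝ≥0∞}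
    (h : R ≤ᵐ[P] seqSup X) :
    condNorm (𝓕.le ⊥) P p R ≤ᵐ[P] procNorm 𝓕 P p X :=
  condNorm_mono _ hp1 (h.trans (pathSup_ae_eq hX).symm.le)

theorem procNorm_sub_le (hp1 : 1 ≤ p) (hX : X ∈ spaceS 𝓕 P d) (hY : Y ∈ spaceS 𝓕 P d) :
    ∀ᵐ ω ∂P, procNorm 𝓕 P p (X - Y) ω ≤ procNorm 𝓕 P p X ω + procNorm 𝓕 P p Y ω := by
  filter_upwards [procNorm_le_condNorm hp1 (sub_mem_spaceS hX hY) (seqSup_sub_le X Y),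
    condNorm_add_le (P := P) (𝓕.le ⊥) hp1 (measurable_seqSup X).aemeasurable
      (measurable_seqSup Y).aemeasurable, procNorm_ae_eq hp1 hX, procNorm_ae_eq hp1 hY]
    with ω h1 h2 h3 h4
  rw [h3, h4]
  exact h1.trans h2

theorem procNorm_sub_comm (hp1 : 1 ≤ p) (hX : X ∈ spaceS 𝓕 P d) (hY : Y ∈ spaceS 𝓕 P d) :
    procNorm 𝓕 P p (X - Y) =ᵐ[P] procNorm 𝓕 P p (Y - X) := by
  have h : seqSup (X - Y) =ᵐ[P] seqSup (Y - X) := by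
    filter_upwards [ae_all_iff.2 fun n => AEEqFun.coeFn_sub (X (timeSeq T n)) (Y (timeSeq T n)),
      ae_all_iff.2 fun n => AEEqFun.coeFn_sub (Y (timeSeq T n)) (X (timeSeq T n))] with ω h1 h2
    simp only [seqSup, Pi.sub_apply, h1, h2]
    refine iSup_congr fun n => ?_
    rw [← enorm_neg, neg_sub]
  filter_upwards [procNorm_ae_eq hp1 (sub_mem_spaceS hX hY),
    procNorm_ae_eq hp1 (sub_mem_spaceS hY hX), condNorm_congr (𝓕.le ⊥) hp1 h] with ω h1 h2 h3
  rw [h1, h2, h3]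

theorem procNorm_zero (hp1 : 1 ≤ p) : ∀ᵐ ω ∂P, procNorm 𝓕 P p (0 : Proc T P d) ω = 0 := by
  have hz : seqSup (0 : Proc T P d) ≤ᵐ[P] fun _ => 0 := by
    filter_upwards [AEEqFun.coeFn_zero (α := Ω) (β := EuclideanSpace ℝ (Fin d)) (μ := P)] with ω h
    refine iSup_le fun n => ?_
    rw [Pi.zero_apply, h]
    simp
  filter_upwards [procNorm_le_condNorm hp1 zero_mem_spaceS hz, condNorm_zero (P := P) (𝓕.le ⊥) hp1]
    with ω h1 h2 using le_antisymm (h1.trans h2) zero_le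

theorem procNorm_sub_triangle (hp1 : 1 ≤ p) {Z : Proc T P d} (hX : X ∈ spaceS 𝓕 P d)
    (hY : Y ∈ spaceS 𝓕 P d) (hZ : Z ∈ spaceS 𝓕 P d) :
    ∀ᵐ ω ∂P, procNorm 𝓕 P p (X - Z) ω ≤
      procNorm 𝓕 P p (X - Y) ω + procNorm 𝓕 P p (Y - Z) ω := by
  have h := procNorm_sub_le (p := p) hp1 (sub_mem_spaceS hX hY) (sub_mem_spaceS hZ hY)
  have e : X - Y - (Z - Y) = X - Z := by abel
  rw [e] at h
  filter_upwards [h, procNorm_sub_comm (p := p) hp1 hZ hY] with ω h1 h2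
  rwa [h2] at h1

theorem eq_of_procNorm_sub_eq_zero (hp1 : 1 ≤ p) (hX : X ∈ spaceS 𝓕 P d)
    (hY : Y ∈ spaceS 𝓕 P d) (h : ∀ᵐ ω ∂P, procNorm 𝓕 P p (X - Y) ω = 0) : X = Y := by
  have hs := sub_mem_spaceS hX hY
  refine eq_of_seqSup_sub_eq_zero hs (ae_eq_zero_of_condNorm_eq_zero (p := p) (𝓕.le ⊥) hp1
    (measurable_seqSup _).aemeasurable ?_)
  filter_upwards [h, procNorm_ae_eq hp1 hs] with ω h1 h2
  rw [← h2, h1]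

/-- An a.s. finite F_0-measurable function is bounded on the sets of an exhausting sequence in F_0,
so conditional integrability amounts to a.s. finiteness of the conditional norm. This is the working
form of membership in S^p. -/
theorem mem_spaceSp_iff (hp1 : 1 ≤ p) :
    X ∈ spaceSp 𝓕 P p d ↔ X ∈ spaceS 𝓕 P d ∧ ∀ᵐ ω ∂P, procNorm 𝓕 P p X ω < ∞ := by
  constructor
  · rintro ⟨hS, h1, h2⟩
    refine ⟨hS, ?_⟩
    by_cases hp : p = ∞
    · obtain ⟨η, hη, hle⟩ := h2 hp
      filter_upwards [condNorm_le_of_le (P := P) (p := p) (𝓕.le ⊥) hp1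
        (ENNReal.measurable_ofReal.comp hη) hle] with ω hω
      exact hω.trans_lt ENNReal.ofReal_lt_top
    · obtain ⟨A, -, hA, hAu, hint⟩ := h1 hp
      have hq0 := toReal_pos_of_one_le hp1 hp
      have key : ∀ n, ∀ᵐ ω ∂P, ω ∈ A n → procNorm 𝓕 P p X ω < ∞ := by
        intro n
        have hfin : ∫⁻ ω in A n, procNorm 𝓕 P p X ω ^ p.toReal ∂P ≠ ∞ := by
          rw [procNorm, setLIntegral_condNorm_rpow (𝓕.le ⊥) hp1 hp _ (hA n)]
          refine ne_of_eq_of_ne ?_ (hint n).2.ne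
          refine lintegral_congr fun ω => ?_
          rw [Real.enorm_rpow_of_nonneg ENNReal.toReal_nonneg hq0.le,
            Real.enorm_of_nonneg ENNReal.toReal_nonneg, ENNReal.ofReal_toReal (pathSup_lt_top hS ω).ne]
        have := ae_lt_top ((measurable_procNorm (𝓕 := 𝓕) (p := p) X).mono (𝓕.le ⊥) le_rfl
          |>.pow_const p.toReal) hfin
        filter_upwards [(ae_restrict_iff' ((𝓕.le ⊥) _ (hA n))).1 this] with ω hω h'
        exact (ENNReal.rpow_lt_top_iff_of_pos hq0).1 (hω h')
      filter_upwards [ae_all_iff.2 key] with ω hω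
      obtain ⟨n, hn⟩ := Set.mem_iUnion.1 (hAu ▸ Set.mem_univ ω)
      exact hω n hn
  · rintro ⟨hS, hfin⟩
    refine ⟨hS, fun hp => ?_, fun hp => ?_⟩
    · obtain ⟨B, hmono, hB, hBu, hle⟩ := exists_levels (measurable_procNorm (p := p) X) hfin
      have hq0 := toReal_pos_of_one_le hp1 hp
      refine ⟨B, hmono, hB, hBu, fun n => ⟨?_, ?_⟩⟩
      · have : AEMeasurable (pathSup 𝓕 P X) P :=
          (measurable_seqSup X).aemeasurable.congr (pathSup_ae_eq hS).symm
        exact (this.ennreal_toReal.pow_const _).aestronglyMeasurable.restrict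
      · have e : ∫⁻ ω in B n, ‖(pathSup 𝓕 P X ω).toReal ^ p.toReal‖ₑ ∂P =
            ∫⁻ ω in B n, procNorm 𝓕 P p X ω ^ p.toReal ∂P := by
          rw [procNorm, setLIntegral_condNorm_rpow (𝓕.le ⊥) hp1 hp _ (hB n)]
          refine lintegral_congr fun ω => ?_
          rw [Real.enorm_rpow_of_nonneg ENNReal.toReal_nonneg hq0.le,
            Real.enorm_of_nonneg ENNReal.toReal_nonneg, ENNReal.ofReal_toReal (pathSup_lt_top hS ω).ne]
        rw [hasFiniteIntegral_iff_enorm, e]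
        calc ∫⁻ ω in B n, procNorm 𝓕 P p X ω ^ p.toReal ∂P
            ≤ ∫⁻ ω in B n, (n : ℝ≥0∞) ^ p.toReal ∂P := by
              refine lintegral_mono_ae ((ae_restrict_iff' ((𝓕.le ⊥) _ (hB n))).2 ?_)
              filter_upwards [hle n] with ω hω h'
              exact ENNReal.rpow_le_rpow (hω h') hq0.le
          _ < ∞ := by
              rw [setLIntegral_const]
              exact ENNReal.mul_lt_top (ENNReal.rpow_lt_top_of_nonneg hq0.le (by simp))
                (measure_lt_top _ _)
    · subst hp
      refine ⟨fun ω => (procNorm 𝓕 P ∞ X ω).toReal, (measurable_procNorm X).ennreal_toReal, ?_⟩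
      filter_upwards [hfin, (condNorm_top (P := P) (𝓕.le ⊥) (pathSup 𝓕 P X)).2.1] with ω h1 h2
      rwa [ENNReal.ofReal_toReal h1.ne]

theorem sub_mem_spaceSp (hp1 : 1 ≤ p) (hX : X ∈ spaceSp 𝓕 P p d) (hY : Y ∈ spaceSp 𝓕 P p d) :
    X - Y ∈ spaceSp 𝓕 P p d := by
  rw [mem_spaceSp_iff hp1] at *
  refine ⟨sub_mem_spaceS hX.1 hY.1, ?_⟩
  filter_upwards [hX.2, hY.2, procNorm_sub_le hp1 hX.1 hY.1] with ω h1 h2 h3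
  exact h3.trans_lt (ENNReal.add_lt_top.2 ⟨h1, h2⟩)

theorem zero_mem_spaceSp (hp1 : 1 ≤ p) : (0 : Proc T P d) ∈ spaceSp 𝓕 P p d := by
  rw [mem_spaceSp_iff hp1]
  refine ⟨zero_mem_spaceS, ?_⟩
  filter_upwards [procNorm_zero (𝓕 := 𝓕) (d := d) hp1] with ω h
  rw [h]
  exact ENNReal.zero_lt_top

theorem const_bot_mem_spaceSp (hp1 : 1 ≤ p) (hX : X ∈ spaceSp 𝓕 P p d) :
    (fun _ => X ⊥ : Proc T P d) ∈ spaceSp 𝓕 P p d := by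
  rw [mem_spaceSp_iff hp1] at *
  refine ⟨const_bot_mem_spaceS hX.1, ?_⟩
  filter_upwards [procNorm_le_condNorm hp1 (const_bot_mem_spaceS hX.1) (seqSup_const_bot_le hX.1),
    procNorm_ae_eq hp1 hX.1, hX.2] with ω h1 h2 h3
  exact (h1.trans_eq h2.symm).trans_lt h3

end Spaces

/-! ### Generalized martingales as martingales on F_0-measurable sets -/

section MartOn

variable {T : ℝ≥0} {Ω : Type*} {mΩ : MeasurableSpace Ω} {P : Measure Ω} {d : ℕ}
  {𝓕 : Filtration (TimeSet T) mΩ} {p : ℝ≥0∞} {X Y : Proc T P d} {B B' : Set Ω}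

/-- The process `1_B X` is a martingale. -/
def MartOn (𝓕 : Filtration (TimeSet T) mΩ) (P : Measure Ω) (B : Set Ω) (X : Proc T P d) : Prop :=
  (∀ t, IntegrableOn (X t) B P) ∧
    ∀ s t, s ≤ t → P[B.indicator (X t) | 𝓕 s] =ᵐ[P] B.indicator (X s)

theorem measurableSet_of_bot (hB : MeasurableSet[𝓕 ⊥] B) (t : TimeSet T) : MeasurableSet[𝓕 t] B :=
  𝓕.mono bot_le _ hB

theorem MartOn.sub (hB : MeasurableSet[𝓕 ⊥] B) (hX : MartOn 𝓕 P B X) (hY : MartOn 𝓕 P B Y) :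
    MartOn 𝓕 P B (X - Y) := by
  have hBm := 𝓕.le ⊥ _ hB
  have e : ∀ t, B.indicator ((X - Y) t) =ᵐ[P] B.indicator (X t) - B.indicator (Y t) := by
    intro t
    filter_upwards [AEEqFun.coeFn_sub (X t) (Y t)] with ω hω
    by_cases h : ω ∈ B <;> simp [h, hω]
  refine ⟨fun t => ((hX.1 t).sub (hY.1 t)).congr
    (ae_restrict_of_ae (AEEqFun.coeFn_sub (X t) (Y t)).symm), fun s t hst => ?_⟩
  have h1 := condExp_sub ((integrable_indicator_iff hBm).2 (hX.1 t))
    ((integrable_indicator_iff hBm).2 (hY.1 t)) (𝓕 s)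
  filter_upwards [condExp_congr_ae (m := 𝓕 s) (e t), h1, hX.2 s t hst, hY.2 s t hst, e s]
    with ω a1 a2 a3 a4 a5
  rw [a1, a2, a5, Pi.sub_apply, Pi.sub_apply, a3, a4]

theorem MartOn.mono (hB' : MeasurableSet[𝓕 ⊥] B') (hB : MeasurableSet[𝓕 ⊥] B) (hsub : B' ⊆ B)
    (hX : MartOn 𝓕 P B X) : MartOn 𝓕 P B' X := by
  refine ⟨fun t => (hX.1 t).mono_set hsub, fun s t hst => ?_⟩
  have e : ∀ t, B'.indicator (X t) = B'.indicator (B.indicator (X t)) := fun t => by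
    rw [Set.indicator_indicator, Set.inter_eq_left.2 hsub]
  rw [e t, e s]
  have h := condExp_indicator (m := 𝓕 s)
    ((integrable_indicator_iff (𝓕.le ⊥ _ hB)).2 (hX.1 t)) (measurableSet_of_bot hB' s)
  filter_upwards [h, hX.2 s t hst] with ω h1 h2
  rw [h1]
  by_cases hω : ω ∈ B' <;> simp only [Set.indicator, hω, if_true, if_false]
  rw [h2]
  rfl

theorem aestronglyMeasurable_indicator_of_bot {f : Ω → EuclideanSpace ℝ (Fin d)} {t : TimeSet T}
    (hf : AEStronglyMeasurable[𝓕 t] f P) (hB : MeasurableSet[𝓕 ⊥] B) :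
    AEStronglyMeasurable[𝓕 t] (B.indicator f) P := by
  obtain ⟨g, hg, hfg⟩ := hf
  exact ⟨B.indicator g, hg.indicator (measurableSet_of_bot hB t), hfg.indicator⟩

variable [IsProbabilityMeasure P]

/-- A set A over which X_t is integrable need not lie in any `B n`, so the identity is proved on A ∩
`B n` and passed to the limit. Conditional Jensen bounds the integral of |X_s| over A ∩ `B n` by
that of |X_t| over A, which makes X_s integrable over A. -/
theorem isGenMartingale_of_martOn (hX : X ∈ spaceS 𝓕 P d) {B : ℕ → Set Ω} (hmono : Monotone B)
    (hB : ∀ n, MeasurableSet[𝓕 ⊥] (B n)) (hBu : (⋃ n, B n) = Set.univ)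
    (hM : ∀ n, MartOn 𝓕 P (B n) X) : IsGenMartingale 𝓕 P X := by
  intro s t hst
  refine ⟨⟨B, hmono, fun n => measurableSet_of_bot (hB n) s, hBu, fun n => (hM n).1 t⟩,
    aestronglyMeasurable_of_mem_spaceS hX s, fun A hA hint => ?_⟩
  have hAm := 𝓕.le s _ hA
  have hBm := fun n => 𝓕.le ⊥ _ (hB n)
  have hcov : AECover (P.restrict A) atTop B := by
    refine ⟨Eventually.of_forall fun ω => ?_, hBm⟩
    obtain ⟨n, hn⟩ := Set.mem_iUnion.1 (hBu ▸ Set.mem_univ ω)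
    exact eventually_atTop.2 ⟨n, fun k hk => hmono hk hn⟩
  have hind : ∀ n, Integrable ((B n).indicator (X t)) P := fun n =>
    (integrable_indicator_iff (hBm n)).2 ((hM n).1 t)
  have hi : ∀ n u, IntegrableOn (X u) (B n) (P.restrict A) := fun n u =>
    ((hM n).1 u).mono_measure Measure.restrict_le_self
  have hXs : Integrable (X s) (P.restrict A) := by
    refine hcov.integrable_of_integral_norm_bounded (∫ ω in A, ‖X t ω‖ ∂P) (fun n => hi n s)
      (Eventually.of_forall fun n => ?_)
    have h1 := setIntegral_norm_condExp_le (μ := P) (m := 𝓕 s) hA ((B n).indicator (X t))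
    have h2 : ∫ ω in A, ‖(P[(B n).indicator (X t) | 𝓕 s]) ω‖ ∂P =
        ∫ ω in B n, ‖X s ω‖ ∂(P.restrict A) := by
      rw [← integral_indicator (hBm n)]
      refine integral_congr_ae (ae_restrict_of_ae ?_)
      filter_upwards [(hM n).2 s t hst.le] with ω hω
      rw [hω]
      exact norm_indicator_eq_indicator_norm _ _
    rw [← h2]
    refine h1.trans (integral_mono_ae (hind n).norm.integrableOn hint.norm ?_)
    refine Eventually.of_forall fun ω => ?_
    exact norm_indicator_le_norm_self _ _
  refine ⟨hXs, ?_⟩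
  have l1 := hcov.integral_tendsto_of_countably_generated hXs
  have l2 := hcov.integral_tendsto_of_countably_generated hint
  refine tendsto_nhds_unique (l1.congr fun n => ?_) l2
  rw [← integral_indicator (hBm n), ← integral_indicator (hBm n),
    ← setIntegral_condExp (𝓕.le s) (hind n) hA]
  exact integral_congr_ae (ae_restrict_of_ae ((hM n).2 s t hst.le).symm)

/-- For A in F_s the set A ∩ B lies in F_s and X_t is integrable over it, so the defining identity
of the generalized conditional expectation applies there. -/
theorem IsGenMartingale.martOn (hX : X ∈ spaceS 𝓕 P d) (hM : IsGenMartingale 𝓕 P X)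
    (hB : MeasurableSet[𝓕 ⊥] B) (hint : ∀ t, IntegrableOn (X t) B P) : MartOn 𝓕 P B X := by
  refine ⟨hint, fun s t hst => ?_⟩
  have hBm := 𝓕.le ⊥ _ hB
  have hind : ∀ u, Integrable (B.indicator (X u)) P := fun u =>
    (integrable_indicator_iff hBm).2 (hint u)
  have hmeas : AEStronglyMeasurable[𝓕 s] (B.indicator (X s)) P :=
    aestronglyMeasurable_indicator_of_bot (aestronglyMeasurable_of_mem_spaceS hX s) hB
  rcases hst.eq_or_lt with rfl | hlt
  · exact condExp_of_aestronglyMeasurable' (𝓕.le s) hmeas (hind s)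
  · refine (ae_eq_condExp_of_forall_setIntegral_eq (𝓕.le s) (hind t)
      (fun A _ _ => (hind s).integrableOn) (fun A hA _ => ?_) hmeas).symm
    rw [setIntegral_indicator hBm, setIntegral_indicator hBm]
    exact ((hM s t hlt).2.2 (A ∩ B) (hA.inter (measurableSet_of_bot hB s))
      ((hint t).mono_set Set.inter_subset_right)).2

theorem integrableOn_of_procNorm_le (hp1 : 1 ≤ p) (hX : X ∈ spaceS 𝓕 P d)
    (hB : MeasurableSet[𝓕 ⊥] B) {c : ℝ≥0∞} (hc : c ≠ ∞)
    (h : ∀ᵐ ω ∂P, ω ∈ B → procNorm 𝓕 P p X ω ≤ c) (t : TimeSet T) : IntegrableOn (X t) B P := by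
  have hBm := 𝓕.le ⊥ _ hB
  refine ⟨(X t).aestronglyMeasurable.restrict, ?_⟩
  rw [hasFiniteIntegral_iff_enorm]
  calc ∫⁻ ω in B, ‖X t ω‖ₑ ∂P ≤ ∫⁻ ω in B, seqSup X ω ∂P :=
        lintegral_mono_ae (ae_restrict_of_ae (enorm_le_seqSup hX t))
    _ ≤ 2 * ∫⁻ ω in B, condNorm (𝓕.le ⊥) P p (seqSup X) ω ∂P :=
        setLIntegral_le_two_mul_condNorm (𝓕.le ⊥) hp1 (measurable_seqSup X).aemeasurable hB
    _ ≤ 2 * ∫⁻ ω in B, c ∂P := by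
        gcongr 2 * ?_
        refine lintegral_mono_ae ((ae_restrict_iff' hBm).2 ?_)
        filter_upwards [h, procNorm_ae_eq hp1 hX] with ω h1 h2 h3
        rw [← h2]
        exact h1 h3
    _ < ∞ := by
        rw [setLIntegral_const]
        exact ENNReal.mul_lt_top (by simp) (ENNReal.mul_lt_top hc.lt_top (measure_lt_top _ _))

/-- A generalized martingale in `S^p` is a martingale on the sets of an exhausting sequence on
which a given finite `F_0`-measurable function is bounded. -/
theorem IsGenMartingale.exists_martOn (hp1 : 1 ≤ p) (hX : X ∈ spaceSp 𝓕 P p d)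
    (hM : IsGenMartingale 𝓕 P X) {h : Ω → ℝ≥0∞} (hh : Measurable[𝓕 ⊥] h)
    (hfin : ∀ᵐ ω ∂P, h ω < ∞) :
    ∃ B : ℕ → Set Ω, Monotone B ∧ (∀ n, MeasurableSet[𝓕 ⊥] (B n)) ∧ (⋃ n, B n) = Set.univ ∧
      (∀ n, MartOn 𝓕 P (B n) X) ∧
      ∀ n, ∀ᵐ ω ∂P, ω ∈ B n → procNorm 𝓕 P p X ω + h ω ≤ n := by
  obtain ⟨hS, hN⟩ := (mem_spaceSp_iff hp1).1 hX
  obtain ⟨B, h1, h2, h3, h4⟩ := exists_levels (P := P) (m := 𝓕 ⊥)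
    (h := fun ω => procNorm 𝓕 P p X ω + h ω)
    (Measurable.add (measurable_procNorm X) hh)
    (by filter_upwards [hN, hfin] with ω a b using ENNReal.add_lt_top.2 ⟨a, b⟩)
  refine ⟨B, h1, h2, h3, fun n => hM.martOn hS (h2 n) ?_, h4⟩
  refine integrableOn_of_procNorm_le hp1 hS (h2 n) (c := n) (by simp) ?_
  filter_upwards [h4 n] with ω hω hωB using le_self_add.trans (hω hωB)

theorem IsGenMartingale.sub (hp1 : 1 ≤ p) (hX : X ∈ spaceSp 𝓕 P p d) (hY : Y ∈ spaceSp 𝓕 P p d)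
    (hMX : IsGenMartingale 𝓕 P X) (hMY : IsGenMartingale 𝓕 P Y) :
    IsGenMartingale 𝓕 P (X - Y) := by
  obtain ⟨hYS, hYN⟩ := (mem_spaceSp_iff hp1).1 hY
  obtain ⟨B, h1, h2, h3, h4, h5⟩ := hMX.exists_martOn hp1 hX (measurable_procNorm (p := p) Y) hYN
  refine isGenMartingale_of_martOn (sub_mem_spaceS hX.1 hYS) h1 h2 h3 fun n =>
    (h4 n).sub (h2 n) (hMY.martOn hYS (h2 n) ?_)
  refine integrableOn_of_procNorm_le hp1 hYS (h2 n) (c := n) (by simp) ?_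
  filter_upwards [h5 n] with ω hω hωB using le_add_self.trans (hω hωB)

theorem isGenMartingale_const_bot (hp1 : 1 ≤ p) (hX : X ∈ spaceSp 𝓕 P p d) :
    IsGenMartingale 𝓕 P (fun _ => X ⊥ : Proc T P d) := by
  obtain ⟨hS, hN⟩ := (mem_spaceSp_iff hp1).1 hX
  obtain ⟨B, h1, h2, h3, h4⟩ := exists_levels (measurable_procNorm (p := p) X) hN
  refine isGenMartingale_of_martOn (const_bot_mem_spaceS hS) h1 h2 h3 fun n => ?_
  have hint : IntegrableOn (X ⊥) (B n) P :=
    integrableOn_of_procNorm_le hp1 hS (h2 n) (c := n) (by simp) (h4 n) ⊥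
  refine ⟨fun _ => hint, fun s t _ => condExp_of_aestronglyMeasurable' (𝓕.le s) ?_
    ((integrable_indicator_iff (𝓕.le ⊥ _ (h2 n))).2 hint)⟩
  exact aestronglyMeasurable_indicator_of_bot
    ((aestronglyMeasurable_of_mem_spaceS hS ⊥).mono (𝓕.mono bot_le)) (h2 n)

end MartOn

/-! ### Doob's inequality from the discrete maximal inequality -/

section DoobAbstract

variable {Ω : Type*} {mΩ : MeasurableSpace Ω} {P : Measure Ω}

/-- Doob's `L^p` inequality, deduced from the maximal inequality. -/
theorem lintegral_rpow_le_of_maximal_ineq {S f : Ω → ℝ} {r : ℝ} (hr : 1 < r)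
    (hS : AEMeasurable S P) (hS0 : 0 ≤ S) (hf : AEMeasurable f P)
    (hmax : ∀ t : ℝ, 0 < t →
      ENNReal.ofReal t * P {ω | t ≤ S ω} ≤ ∫⁻ ω in {ω | t ≤ S ω}, ENNReal.ofReal (f ω) ∂P)
    (hfin : ∫⁻ ω, ENNReal.ofReal (S ω) ^ r ∂P ≠ ∞) :
    ∫⁻ ω, ENNReal.ofReal (S ω) ^ r ∂P ≤
      ENNReal.ofReal (r / (r - 1)) ^ r * ∫⁻ ω, ENNReal.ofReal (f ω) ^ r ∂P := by
  have hr0 : 0 < r := by linarith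
  have hr1 : 0 < r - 1 := by linarith
  have hq : r.HolderConjugate (r / (r - 1)) := Real.HolderConjugate.conjExponent hr
  set A := ∫⁻ ω, ENNReal.ofReal (S ω) ^ r ∂P with hA
  set Φ := ∫⁻ ω, ENNReal.ofReal (f ω) ^ r ∂P with hΦ
  rcases eq_or_ne A 0 with hA0 | hA0
  · rw [hA0]; exact zero_le
  have hfm : AEMeasurable (fun ω => ENNReal.ofReal (f ω)) P := hf.ennreal_ofReal
  -- The maximal inequality yields t P(S ≥ t) ≤ ν(S ≥ t). The layer-cake formula for P with exponent
  -- r and for ν with exponent r - 1 then gives E[S^r] ≤ r/(r-1) E[f S^(r-1)], to which Hölder's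
  -- inequality applies.
  let ν := P.withDensity fun ω => ENNReal.ofReal (f ω)
  have hSν : AEMeasurable S ν := hS.mono_ac (withDensity_absolutelyContinuous _ _)
  have e1 : A = ENNReal.ofReal r *
      ∫⁻ t in Set.Ioi 0, P {ω | t ≤ S ω} * ENNReal.ofReal (t ^ (r - 1)) := by
    rw [← lintegral_rpow_eq_lintegral_meas_le_mul P (Eventually.of_forall hS0) hS hr0]
    exact lintegral_congr fun ω => ENNReal.ofReal_rpow_of_nonneg (hS0 ω) hr0.le
  have e2 : ∫⁻ ω, ENNReal.ofReal (S ω ^ (r - 1)) ∂ν = ENNReal.ofReal (r - 1) *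
      ∫⁻ t in Set.Ioi 0, ν {ω | t ≤ S ω} * ENNReal.ofReal (t ^ (r - 1 - 1)) :=
    lintegral_rpow_eq_lintegral_meas_le_mul ν (Eventually.of_forall hS0) hSν hr1
  have e3 : ∫⁻ t in Set.Ioi 0, P {ω | t ≤ S ω} * ENNReal.ofReal (t ^ (r - 1)) ≤
      ∫⁻ t in Set.Ioi 0, ν {ω | t ≤ S ω} * ENNReal.ofReal (t ^ (r - 1 - 1)) := by
    refine setLIntegral_mono' measurableSet_Ioi fun t ht => ?_
    have ht : 0 < t := ht
    have h1 : t ^ (r - 1) = t * t ^ (r - 1 - 1) := by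
      rw [Real.rpow_sub_one ht.ne' (r - 1)]
      field_simp
    rw [h1, ENNReal.ofReal_mul ht.le, ← mul_assoc, mul_comm (P _)]
    gcongr ?_ * _
    refine (hmax t ht).trans ?_
    exact withDensity_apply_le _ _
  have e4 : ∫⁻ ω, ENNReal.ofReal (S ω ^ (r - 1)) ∂ν ≤ Φ ^ (1 / r) * A ^ (1 / (r / (r - 1))) := by
    have hg : AEMeasurable (fun ω => ENNReal.ofReal (S ω ^ (r - 1))) P :=
      (hS.pow_const _).ennreal_ofReal
    rw [lintegral_withDensity_eq_lintegral_mul₀ hfm hg]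
    refine (ENNReal.lintegral_mul_le_Lp_mul_Lq P hq hfm hg).trans_eq ?_
    congr 2
    refine lintegral_congr fun ω => ?_
    rw [← ENNReal.ofReal_rpow_of_nonneg (hS0 ω) hr1.le, ← ENNReal.rpow_mul]
    congr 1
    field_simp
  have e5 : A ≤ ENNReal.ofReal (r / (r - 1)) * (Φ ^ (1 / r) * A ^ (1 / (r / (r - 1)))) := by
    have hc : ENNReal.ofReal r = ENNReal.ofReal (r / (r - 1)) * ENNReal.ofReal (r - 1) := by
      rw [← ENNReal.ofReal_mul (by positivity)]
      congr 1
      field_simp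
    calc A ≤ ENNReal.ofReal r *
          ∫⁻ t in Set.Ioi 0, ν {ω | t ≤ S ω} * ENNReal.ofReal (t ^ (r - 1 - 1)) := by
            rw [e1]; gcongr
      _ = ENNReal.ofReal (r / (r - 1)) * ∫⁻ ω, ENNReal.ofReal (S ω ^ (r - 1)) ∂ν := by
            rw [hc, mul_assoc, ← e2]
      _ ≤ _ := by gcongr
  have e6 : A = A ^ (1 / r) * A ^ (1 / (r / (r - 1))) := by
    rw [← ENNReal.rpow_add _ _ hA0 hfin]
    have : 1 / r + 1 / (r / (r - 1)) = 1 := by field_simp; ring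
    rw [this, ENNReal.rpow_one]
  -- Division by the power of A with the conjugate exponent; finiteness of A is what makes this
  -- legitimate.
  have e7 : A ^ (1 / r) ≤ ENNReal.ofReal (r / (r - 1)) * Φ ^ (1 / r) := by
    have hz : A ^ (1 / (r / (r - 1))) ≠ 0 := by
      simp [ENNReal.rpow_eq_zero_iff, hA0, hfin]
    have ht : A ^ (1 / (r / (r - 1))) ≠ ∞ :=
      ENNReal.rpow_ne_top_of_nonneg (by positivity) hfin
    rw [← ENNReal.mul_le_mul_iff_left hz ht, mul_assoc, ← e6]
    exact e5
  have e8 := ENNReal.rpow_le_rpow e7 hr0.le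
  rwa [ENNReal.mul_rpow_of_nonneg _ _ hr0.le, ← ENNReal.rpow_mul, ← ENNReal.rpow_mul,
    one_div_mul_cancel hr0.ne', ENNReal.rpow_one, ENNReal.rpow_one] at e8

theorem setLIntegral_eq_iSup_inter {B : ℕ → Set Ω} (hmono : Monotone B)
    (hB : ∀ n, MeasurableSet (B n)) (hBu : (⋃ n, B n) = Set.univ) {s : Set Ω}
    (hs : MeasurableSet s) (f : Ω → ℝ≥0∞) :
    ∫⁻ ω in s, f ω ∂P = ⨆ n, ∫⁻ ω in s ∩ B n, f ω ∂P := by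
  have h : s = ⋃ n, s ∩ B n := by rw [← Set.inter_iUnion, hBu, Set.inter_univ]
  have hm : Monotone fun n => s ∩ B n := fun i j hij => Set.inter_subset_inter_right _ (hmono hij)
  simp_rw [← withDensity_apply f (hs.inter (hB _))]
  rw [← withDensity_apply f hs, ← hm.measure_iUnion, ← h]

variable [IsProbabilityMeasure P] {T : ℝ≥0} {𝓕 : Filtration (TimeSet T) mΩ}

/-- The sorted points of I are followed by T forever, so that a maximal inequality along this
sequence ends with the terminal value. -/
theorem exists_monotone_enum (I : Finset (TimeSet T)) :
    ∃ (τ : ℕ → TimeSet T) (n : ℕ), Monotone τ ∧ τ n = ⊤ ∧ (∀ t ∈ I, ∃ k ≤ n, τ k = t) ∧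
      ∀ k, τ k ∈ I ∨ τ k = ⊤ := by
  refine ⟨fun k => if h : k < I.card then I.orderEmbOfFin rfl ⟨k, h⟩ else ⊤, I.card, ?_, ?_, ?_, ?_⟩
  · intro i j hij
    dsimp only
    split_ifs with h1 h2
    · exact (I.orderEmbOfFin rfl).monotone hij
    · exact le_top
    · omega
    · exact le_rfl
  · simp
  · intro t ht
    have : t ∈ Set.range (I.orderEmbOfFin rfl) := by
      rw [Finset.range_orderEmbOfFin]; exact ht
    obtain ⟨k, rfl⟩ := this
    exact ⟨k, k.2.le, by simp⟩
  · intro k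
    dsimp only
    split_ifs with h
    · exact Or.inl (Finset.orderEmbOfFin_mem _ _ _)
    · exact Or.inr rfl

/-- The filtration `(F_{τ k})_k` along a nondecreasing sequence of times. -/
def sampledFiltration (𝓕 : Filtration (TimeSet T) mΩ) {τ : ℕ → TimeSet T} (hτ : Monotone τ) :
    Filtration ℕ mΩ where
  seq k := 𝓕 (τ k)
  mono' _ _ hij := 𝓕.mono (hτ hij)
  le' k := 𝓕.le (τ k)

/-- Monotone convergence leaves finitely many times, which are sorted so that the discrete maximal
inequality applies. The sampled maximum inherits a finite moment because all its times, the padding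
T included, belong to `timeSeq`. -/
theorem lintegral_iSup_rpow_le_of_submartingale {Z : TimeSet T → Ω → ℝ}
    (hZ : Submartingale Z 𝓕 P) (hZ0 : 0 ≤ Z) {r : ℝ} (hr : 1 < r)
    (hfin : ∫⁻ ω, (⨆ n, ENNReal.ofReal (Z (timeSeq T n) ω)) ^ r ∂P ≠ ∞) :
    ∫⁻ ω, (⨆ n, ENNReal.ofReal (Z (timeSeq T n) ω)) ^ r ∂P ≤
      ENNReal.ofReal (r / (r - 1)) ^ r * ∫⁻ ω, ENNReal.ofReal (Z ⊤ ω) ^ r ∂P := by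
  classical
  have hr0 : 0 < r := by linarith
  have hZm : ∀ t, Measurable (Z t) := fun t => ((hZ.1 t).mono (𝓕.le t)).measurable
  let G : ℕ → Ω → ℝ≥0∞ := fun N ω =>
    (Finset.range (N + 1)).sup fun n => ENNReal.ofReal (Z (timeSeq T n) ω)
  have hGm : ∀ N, Measurable (G N) := fun N => by
    simp only [G, Finset.sup_eq_iSup]
    exact Measurable.iSup fun n => Measurable.iSup fun _ => (hZm _).ennreal_ofReal
  have hGmono : ∀ ω, Monotone fun N => G N ω := fun ω i j hij =>
    Finset.sup_mono (Finset.range_mono (by omega))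
  have hGsup : ∀ ω, (⨆ n, ENNReal.ofReal (Z (timeSeq T n) ω)) = ⨆ N, G N ω := by
    intro ω
    refine le_antisymm (iSup_le fun n => le_iSup_of_le n ?_) (iSup_le fun N => Finset.sup_le
      fun n _ => le_iSup (fun n => ENNReal.ofReal (Z (timeSeq T n) ω)) n)
    exact Finset.le_sup (f := fun n => ENNReal.ofReal (Z (timeSeq T n) ω))
      (Finset.self_mem_range_succ n)
  have hpow : ∀ ω, (⨆ n, ENNReal.ofReal (Z (timeSeq T n) ω)) ^ r = ⨆ N, G N ω ^ r := fun ω => by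
    rw [hGsup]
    exact (ENNReal.orderIsoRpow r hr0).map_iSup _
  calc ∫⁻ ω, (⨆ n, ENNReal.ofReal (Z (timeSeq T n) ω)) ^ r ∂P
      = ⨆ N, ∫⁻ ω, G N ω ^ r ∂P := by
        simp_rw [hpow]
        exact lintegral_iSup (fun N => (hGm N).pow_const r)
          fun i j hij ω => ENNReal.rpow_le_rpow (hGmono ω hij) hr0.le
    _ ≤ _ := iSup_le fun N => ?_
  obtain ⟨τ, K, hτ, hτK, hI, hτI⟩ := exists_monotone_enum ((Finset.range (N + 1)).image (timeSeq T))
  let f : ℕ → Ω → ℝ := fun k => Z (τ k)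
  have hf : Submartingale f (sampledFiltration 𝓕 hτ) P :=
    ⟨fun k => hZ.1 (τ k), fun i j hij => hZ.2.1 _ _ (hτ hij), fun k => hZ.2.2 (τ k)⟩
  let S : Ω → ℝ := fun ω =>
    (Finset.range (K + 1)).sup' Finset.nonempty_range_add_one fun k => f k ω
  have hSm : Measurable S := by
    have := Finset.measurable_range_sup'' (f := f) (n := K) fun k _ => hZm (τ k)
    exact this
  have hS0 : 0 ≤ S := fun ω => (hZ0 (τ 0) ω).trans
    (Finset.le_sup' (fun k => f k ω) (Finset.mem_range.2 (Nat.succ_pos K)))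
  have hGS : ∀ ω, G N ω ≤ ENNReal.ofReal (S ω) := fun ω => Finset.sup_le fun n hn => by
    obtain ⟨k, hk, hkn⟩ := hI _ (Finset.mem_image_of_mem _ hn)
    refine ENNReal.ofReal_le_ofReal ?_
    rw [← hkn]
    exact Finset.le_sup' (fun k => f k ω) (Finset.mem_range.2 (Nat.lt_succ_of_le hk))
  have hSG : ∀ ω, ENNReal.ofReal (S ω) ≤ ⨆ n, ENNReal.ofReal (Z (timeSeq T n) ω) := fun ω => by
    obtain ⟨k, hk, hkS⟩ := Finset.exists_mem_eq_sup' (Finset.nonempty_range_add_one (n := K))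
      fun k => f k ω
    change ENNReal.ofReal ((Finset.range (K + 1)).sup' _ fun k => f k ω) ≤ _
    rw [hkS]
    have : ∃ n, timeSeq T n = τ k := by
      rcases hτI k with h | h
      · obtain ⟨n, -, hn⟩ := Finset.mem_image.1 h
        exact ⟨n, hn⟩
      · exact ⟨0, h.symm⟩
    obtain ⟨n, hn⟩ := this
    change ENNReal.ofReal (Z (τ k) ω) ≤ _
    rw [← hn]
    exact le_iSup (fun n => ENNReal.ofReal (Z (timeSeq T n) ω)) n
  refine (lintegral_mono fun ω => ENNReal.rpow_le_rpow (hGS ω) hr0.le).trans ?_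
  refine lintegral_rpow_le_of_maximal_ineq hr hSm.aemeasurable hS0 (hZm ⊤).aemeasurable
    (fun t ht => ?_) (ne_top_of_le_ne_top hfin
      (lintegral_mono fun ω => ENNReal.rpow_le_rpow (hSG ω) hr0.le))
  have h := maximal_ineq hf (fun k ω => hZ0 (τ k) ω) (ε := t.toNNReal) K
  rw [Real.coe_toNNReal t ht.le] at h
  refine h.trans ?_
  rw [ofReal_integral_eq_lintegral_ofReal (hf.2.2 K).integrableOn
    (Eventually.of_forall fun ω => hZ0 _ ω)]
  simp only [f, hτK]
  exact le_rfl

end DoobAbstract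

/-! ### The conditional Doob inequality and L² orthogonality -/

section DoobConditional

variable {T : ℝ≥0} {Ω : Type*} {mΩ : MeasurableSpace Ω} {P : Measure Ω} [IsProbabilityMeasure P]
  {d : ℕ} {𝓕 : Filtration (TimeSet T) mΩ} {p : ℝ≥0∞} {X : Proc T P d} {B : Set Ω}

/-- The norm of the martingale 1_B X is a submartingale. It is built from an RCLL version since a
submartingale must be adapted exactly, not just up to null sets. -/
theorem MartOn.lintegral_seqSup_rpow_le (hX : X ∈ spaceS 𝓕 P d) (hB : MeasurableSet[𝓕 ⊥] B)
    (hM : MartOn 𝓕 P B X) {r : ℝ} (hr : 1 < r) (hfin : ∫⁻ ω in B, seqSup X ω ^ r ∂P ≠ ∞) :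
    ∫⁻ ω in B, seqSup X ω ^ r ∂P ≤
      ENNReal.ofReal (r / (r - 1)) ^ r * ∫⁻ ω in B, ‖X ⊤ ω‖ₑ ^ r ∂P := by
  have hBm := 𝓕.le ⊥ _ hB
  have hr0 : 0 < r := by linarith
  obtain ⟨x, hx⟩ := hX
  let Z : TimeSet T → Ω → ℝ := fun t => B.indicator fun ω => ‖x t ω‖
  have hZ0 : 0 ≤ Z := fun t ω => Set.indicator_nonneg (fun _ _ => norm_nonneg _) ω
  have hZX : ∀ t, Z t =ᵐ[P] fun ω => ‖B.indicator (X t) ω‖ := fun t => by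
    filter_upwards [hx.version t] with ω hω
    rw [norm_indicator_eq_indicator_norm]
    simp only [Z, Set.indicator, hω]
  have hind : ∀ t, Integrable (B.indicator (X t)) P := fun t =>
    (integrable_indicator_iff hBm).2 (hM.1 t)
  have hZ : Submartingale Z 𝓕 P := by
    refine ⟨fun t => (hx.adapted t).norm.indicator (measurableSet_of_bot hB t),
      fun s t hst => ?_, fun t => (hind t).norm.congr (hZX t).symm⟩
    filter_upwards [hZX s, hM.2 s t hst, norm_condExp_le (μ := P) (m := 𝓕 s) (B.indicator (X t)),
      condExp_congr_ae (m := 𝓕 s) (hZX t)] with ω h1 h2 h3 h4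
    rw [h1, h4, ← h2]
    exact h3
  have hof : ∀ t, (fun ω => ENNReal.ofReal (Z t ω)) =ᵐ[P] B.indicator fun ω => ‖X t ω‖ₑ := by
    intro t
    filter_upwards [hZX t] with ω hω
    rw [hω, ofReal_norm, enorm_indicator_eq_indicator_enorm]
  have hsup : (fun ω => (⨆ n, ENNReal.ofReal (Z (timeSeq T n) ω)) ^ r) =ᵐ[P]
      B.indicator fun ω => seqSup X ω ^ r := by
    filter_upwards [ae_all_iff.2 fun n => hof (timeSeq T n)] with ω hω
    simp_rw [hω]
    by_cases h : ω ∈ B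
    · simp [h, seqSup]
    · simp [h, hr0]
  have htop : (fun ω => ENNReal.ofReal (Z ⊤ ω) ^ r) =ᵐ[P] B.indicator fun ω => ‖X ⊤ ω‖ₑ ^ r := by
    filter_upwards [hof ⊤] with ω hω
    rw [hω]
    by_cases h : ω ∈ B
    · simp [h]
    · simp [h, hr0]
  have key := lintegral_iSup_rpow_le_of_submartingale hZ hZ0 hr
  rwa [lintegral_congr_ae hsup, lintegral_congr_ae htop, lintegral_indicator hBm,
    lintegral_indicator hBm, imp_iff_right hfin] at key

/-- An F_0-measurable bound of the terminal value is unchanged by E[· | F_t]. This is Doob's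
inequality for p = ∞, with constant 1. -/
theorem MartOn.norm_le (hB : MeasurableSet[𝓕 ⊥] B) (hM : MartOn 𝓕 P B X) {η : Ω → ℝ}
    (hη : Measurable[𝓕 ⊥] η) (hint : IntegrableOn η B P)
    (hle : ∀ᵐ ω ∂P, ω ∈ B → ‖X ⊤ ω‖ ≤ η ω) (t : TimeSet T) :
    ∀ᵐ ω ∂P, ω ∈ B → ‖X t ω‖ ≤ η ω := by
  have hBm := 𝓕.le ⊥ _ hB
  have hi : Integrable (B.indicator η) P := (integrable_indicator_iff hBm).2 hint
  have hη' : StronglyMeasurable[𝓕 t] (B.indicator η) :=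
    ((hη.mono (𝓕.mono bot_le) le_rfl).indicator (measurableSet_of_bot hB t)).stronglyMeasurable
  have h1 : (fun ω => ‖B.indicator (X ⊤) ω‖) ≤ᵐ[P] B.indicator η := by
    filter_upwards [hle] with ω hω
    by_cases h : ω ∈ B
    · simpa [h] using hω h
    · simp [h]
  have h2 := condExp_mono (m := 𝓕 t) ((integrable_indicator_iff hBm).2 (hM.1 ⊤)).norm hi h1
  rw [condExp_of_stronglyMeasurable (𝓕.le t) hη' hi] at h2
  filter_upwards [h2, norm_condExp_le (μ := P) (m := 𝓕 t) (B.indicator (X ⊤)),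
    hM.2 t ⊤ le_top] with ω a1 a2 a3 hω
  rw [a3] at a2
  simpa [hω] using a2.trans a1

/-- The constant of Doob's `L^p` inequality. -/
noncomputable def doobConst (p : ℝ≥0∞) : ℝ≥0∞ :=
  open Classical in if p = ∞ then 1 else ENNReal.ofReal (p.toReal / (p.toReal - 1))

/-- Doob's `L^p` inequality for the conditional norm. -/
theorem IsGenMartingale.procNorm_le (hp : 1 < p) (hX : X ∈ spaceSp 𝓕 P p d)
    (hM : IsGenMartingale 𝓕 P X) :
    ∀ᵐ ω ∂P, procNorm 𝓕 P p X ω ≤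
      doobConst p * condNorm (𝓕.le ⊥) P p (fun ω => ‖X ⊤ ω‖ₑ) ω := by
  obtain ⟨hS, hN⟩ := (mem_spaceSp_iff hp.le).1 hX
  obtain ⟨B, hmono, hB, hBu, hMB, hle⟩ := hM.exists_martOn hp.le hX (h := fun _ => 0)
    measurable_const (Eventually.of_forall fun _ => ENNReal.zero_lt_top)
  have hBm := fun n => 𝓕.le ⊥ _ (hB n)
  have hKm := measurable_condNorm (P := P) (𝓕.le ⊥) p (fun ω => ‖X ⊤ ω‖ₑ)
  by_cases hpt : p = ∞
  · subst hpt
    have hKN : condNorm (𝓕.le ⊥) P ∞ (fun ω => ‖X ⊤ ω‖ₑ) ≤ᵐ[P] procNorm 𝓕 P ∞ X :=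
      condNorm_le_procNorm hp.le hS (enorm_le_seqSup hS ⊤)
    have hKlt : ∀ᵐ ω ∂P, condNorm (𝓕.le ⊥) P ∞ (fun ω => ‖X ⊤ ω‖ₑ) ω < ∞ := by
      filter_upwards [hKN, hN] with ω h1 h2 using h1.trans_lt h2
    simp only [doobConst, if_true, one_mul]
    refine condNorm_le_of_le (𝓕.le ⊥) hp.le hKm ((pathSup_ae_eq hS).le.trans ?_)
    have hX' : ∀ t, ∀ᵐ ω ∂P, ‖X t ω‖ₑ ≤ condNorm (𝓕.le ⊥) P ∞ (fun ω => ‖X ⊤ ω‖ₑ) ω := by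
      intro t
      have hn : ∀ n, ∀ᵐ ω ∂P, ω ∈ B n →
          ‖X t ω‖ ≤ (condNorm (𝓕.le ⊥) P ∞ (fun ω => ‖X ⊤ ω‖ₑ) ω).toReal := by
        intro n
        refine (hMB n).norm_le (hB n) hKm.ennreal_toReal ?_ ?_ t
        · refine Integrable.of_bound (C := n)
            ((hKm.ennreal_toReal.mono (𝓕.le ⊥) le_rfl).aestronglyMeasurable) ?_
          refine (ae_restrict_iff' (hBm n)).2 ?_
          filter_upwards [hle n, hKN] with ω h1 h2 hω
          rw [Real.norm_of_nonneg ENNReal.toReal_nonneg]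
          exact ENNReal.toReal_le_of_le_ofReal (by positivity)
            (by simpa using h2.trans (le_self_add.trans (h1 hω)))
        · filter_upwards [(condNorm_top (P := P) (𝓕.le ⊥) (fun ω => ‖X ⊤ ω‖ₑ)).2.1, hKlt]
            with ω h1 h2 _
          rw [← toReal_enorm]
          exact ENNReal.toReal_mono h2.ne h1
      filter_upwards [ae_all_iff.2 hn, hKlt] with ω h1 h2
      obtain ⟨n, hnω⟩ := Set.mem_iUnion.1 (hBu ▸ Set.mem_univ ω)
      rw [← ofReal_norm]
      exact ENNReal.ofReal_le_of_le_toReal (h1 n hnω)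
    filter_upwards [ae_all_iff.2 fun n => hX' (timeSeq T n)] with ω hω using iSup_le hω
  · have hr : 1 < p.toReal := by
      simpa using (ENNReal.toReal_lt_toReal ENNReal.one_ne_top hpt).2 hp
    have hr0 : 0 < p.toReal := by linarith
    simp only [doobConst, if_neg hpt]
    refine condNorm_le_of_setLIntegral_le (𝓕.le ⊥) hp.le hpt (Measurable.const_mul hKm _)
      fun s hs => ?_
    have hsm := 𝓕.le ⊥ _ hs
    have e1 : ∫⁻ ω in s, pathSup 𝓕 P X ω ^ p.toReal ∂P = ∫⁻ ω in s, seqSup X ω ^ p.toReal ∂P := by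
      refine lintegral_congr_ae (ae_restrict_of_ae ?_)
      filter_upwards [pathSup_ae_eq hS] with ω hω
      rw [hω]
    have e2 : ∫⁻ ω in s, (ENNReal.ofReal (p.toReal / (p.toReal - 1)) *
        condNorm (𝓕.le ⊥) P p (fun ω => ‖X ⊤ ω‖ₑ) ω) ^ p.toReal ∂P =
        ENNReal.ofReal (p.toReal / (p.toReal - 1)) ^ p.toReal *
          ∫⁻ ω in s, ‖X ⊤ ω‖ₑ ^ p.toReal ∂P := by
      rw [← setLIntegral_condNorm_rpow (𝓕.le ⊥) hp.le hpt (fun ω => ‖X ⊤ ω‖ₑ) hs,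
        ← lintegral_const_mul _ ((hKm.mono (𝓕.le ⊥) le_rfl).pow_const _)]
      refine lintegral_congr fun ω => ?_
      rw [ENNReal.mul_rpow_of_nonneg _ _ hr0.le]
    -- The unconditional inequality requires a finite left side, so it is applied on s ∩ `B n`,
    -- where the conditional norm is at most n, before n tends to infinity.
    rw [e1, e2, setLIntegral_eq_iSup_inter hmono hBm hBu hsm]
    refine iSup_le fun n => ?_
    have hsB : MeasurableSet[𝓕 ⊥] (s ∩ B n) := MeasurableSet.inter hs (hB n)
    refine (((hMB n).mono hsB (hB n) Set.inter_subset_right).lintegral_seqSup_rpow_le hS hsB hr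
      ?_).trans ?_
    · rw [← setLIntegral_condNorm_rpow (𝓕.le ⊥) hp.le hpt _ hsB]
      refine ne_top_of_le_ne_top (b := ((n : ℝ≥0∞) ^ p.toReal * P (s ∩ B n))) ?_ ?_
      · exact ENNReal.mul_ne_top (ENNReal.rpow_ne_top_of_nonneg hr0.le (by simp))
          (measure_ne_top _ _)
      · rw [← setLIntegral_const]
        refine lintegral_mono_ae ((ae_restrict_iff' (hsm.inter (hBm n))).2 ?_)
        filter_upwards [hle n, procNorm_ae_eq hp.le hS] with ω h1 h2 hω
        rw [← h2]
        exact ENNReal.rpow_le_rpow (le_self_add.trans (h1 hω.2)) hr0.le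
    · gcongr
      exact Set.inter_subset_left

theorem integral_inner_condExp {E : Type*} [NormedAddCommGroup E] [InnerProductSpace ℝ E]
    [CompleteSpace E] {m : MeasurableSpace Ω} (hm : m ≤ mΩ) {u g : Ω → E}
    (hu : AEStronglyMeasurable[m] u P) (hg : Integrable g P)
    (hug : Integrable (fun ω => inner ℝ (u ω) (g ω)) P) :
    ∫ ω, inner ℝ (u ω) (P[g | m] ω) ∂P = ∫ ω, inner ℝ (u ω) (g ω) ∂P := by
  have h : P[fun ω => inner ℝ (u ω) (g ω) | m] =ᵐ[P] fun ω => inner ℝ (u ω) (P[g | m] ω) :=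
    condExp_bilin_of_aestronglyMeasurable_left (innerSL ℝ) hu hug hg
  rw [← integral_congr_ae h, integral_condExp hm]

/-- In L² the conditional expectation is an orthogonal projection, and removing a projection does
not increase the norm. -/
theorem lintegral_enorm_sub_condExp_sq_le {E : Type*} [NormedAddCommGroup E]
    [InnerProductSpace ℝ E] [CompleteSpace E] {m : MeasurableSpace Ω} (hm : m ≤ mΩ) {a : Ω → E}
    (ha : MemLp a 2 P) :
    ∫⁻ ω, ‖a ω - P[a | m] ω‖ₑ ^ (2 : ℝ) ∂P ≤ ∫⁻ ω, ‖a ω‖ₑ ^ (2 : ℝ) ∂P := by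
  have hb : MemLp (P[a | m]) 2 P := ha.condExp one_le_two
  have hab : MemLp (fun ω => a ω - P[a | m] ω) 2 P := ha.sub hb
  have hconv : ∀ {f : Ω → E}, MemLp f 2 P →
      ∫⁻ ω, ‖f ω‖ₑ ^ (2 : ℝ) ∂P = ENNReal.ofReal (∫ ω, ‖f ω‖ ^ 2 ∂P) := by
    intro f hf
    rw [ofReal_integral_eq_lintegral_ofReal hf.integrable_norm_pow'
      (Eventually.of_forall fun ω => by positivity)]
    refine lintegral_congr fun ω => ?_
    rw [ENNReal.ofReal_pow (norm_nonneg _), ofReal_norm]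
    norm_cast
  have hinner : Integrable (fun ω => inner ℝ (P[a | m] ω) (a ω)) P := by
    refine (hb.norm.integrable_mul ha.norm).mono
      (hb.aestronglyMeasurable.inner (𝕜 := ℝ) ha.aestronglyMeasurable)
      (Eventually.of_forall fun ω => ?_)
    rw [Pi.mul_apply, norm_mul, norm_norm, norm_norm]
    exact norm_inner_le_norm _ _
  have horth := integral_inner_condExp hm
    (stronglyMeasurable_condExp (f := a)).aestronglyMeasurable
    (ha.integrable one_le_two) hinner
  rw [hconv ha, hconv hab]
  refine ENNReal.ofReal_le_ofReal ?_
  have e : ∀ ω, ‖a ω - P[a | m] ω‖ ^ 2 =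
      ‖a ω‖ ^ 2 - 2 * inner ℝ (P[a | m] ω) (a ω) + ‖P[a | m] ω‖ ^ 2 := fun ω => by
    rw [norm_sub_sq_real, real_inner_comm]
  have ha2 : Integrable (fun ω => ‖a ω‖ ^ 2) P := ha.integrable_norm_pow'
  have hb2 : Integrable (fun ω => ‖P[a | m] ω‖ ^ 2) P := hb.integrable_norm_pow'
  have e2 : ∫ ω, ‖a ω - P[a | m] ω‖ ^ 2 ∂P = ∫ ω, ‖a ω‖ ^ 2 ∂P -
      2 * ∫ ω, inner ℝ (P[a | m] ω) (a ω) ∂P + ∫ ω, ‖P[a | m] ω‖ ^ 2 ∂P := by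
    simp_rw [e]
    rw [← integral_const_mul, ← integral_sub ha2 (hinner.const_mul 2)]
    exact integral_add (ha2.sub (hinner.const_mul 2)) hb2
  rw [e2, ← horth]
  simp_rw [real_inner_self_eq_norm_sq]
  have : 0 ≤ ∫ ω, ‖P[a | m] ω‖ ^ 2 ∂P := integral_nonneg fun ω => by positivity
  linarith

/-- X_T - X_0 is the part of X_T orthogonal to F_0. Using this instead of the triangle inequality
lowers the step constant from 7 to 5 when p = 2. -/
theorem IsGenMartingale.condNorm_two_sub_bot_le (hX : X ∈ spaceSp 𝓕 P 2 d)
    (hM : IsGenMartingale 𝓕 P X) :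
    condNorm (𝓕.le ⊥) P 2 (fun ω => ‖X ⊤ ω - X ⊥ ω‖ₑ) ≤ᵐ[P]
      condNorm (𝓕.le ⊥) P 2 (fun ω => ‖X ⊤ ω‖ₑ) := by
  have h12 : (1 : ℝ≥0∞) ≤ 2 := one_le_two
  have h2t : (2 : ℝ≥0∞) ≠ ∞ := by simp
  obtain ⟨hS, hN⟩ := (mem_spaceSp_iff h12).1 hX
  obtain ⟨B, hmono, hB, hBu, hMB, hle⟩ := hM.exists_martOn h12 hX (h := fun _ => 0)
    measurable_const (Eventually.of_forall fun _ => ENNReal.zero_lt_top)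
  have hBm := fun n => 𝓕.le ⊥ _ (hB n)
  refine condNorm_le_of_setLIntegral_le (𝓕.le ⊥) h12 h2t (measurable_condNorm _ _ _) fun s hs => ?_
  have hsm := 𝓕.le ⊥ _ hs
  rw [setLIntegral_condNorm_rpow (𝓕.le ⊥) h12 h2t _ hs,
    setLIntegral_eq_iSup_inter hmono hBm hBu hsm]
  refine iSup_le fun n => le_trans ?_ (lintegral_mono_set (Set.inter_subset_left (t := B n)))
  have hsB : MeasurableSet[𝓕 ⊥] (s ∩ B n) := MeasurableSet.inter hs (hB n)
  have hsBm := 𝓕.le ⊥ _ hsB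
  have hMn := (hMB n).mono hsB (hB n) Set.inter_subset_right
  have hL2 : MemLp ((s ∩ B n).indicator (X ⊤)) 2 P := by
    refine (memLp_indicator_iff_restrict hsBm).2 ⟨(X ⊤).aestronglyMeasurable.restrict, ?_⟩
    rw [eLpNorm_lt_top_iff_lintegral_rpow_enorm_lt_top (by simp) h2t,
      ← setLIntegral_condNorm_rpow (𝓕.le ⊥) h12 h2t _ hsB]
    refine lt_of_le_of_lt (b := ((n : ℝ≥0∞) ^ (2 : ℝ≥0∞).toReal * P (s ∩ B n))) ?_ ?_
    · rw [← setLIntegral_const]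
      refine lintegral_mono_ae ((ae_restrict_iff' hsBm).2 ?_)
      filter_upwards [hle n, condNorm_le_procNorm h12 hS (enorm_le_seqSup hS ⊤)] with ω h1 h2 hω
      exact ENNReal.rpow_le_rpow (h2.trans (le_self_add.trans (h1 hω.2))) (by simp)
    · exact ENNReal.mul_lt_top (ENNReal.rpow_lt_top_of_nonneg (by simp) (by simp))
        (measure_lt_top _ _)
  have key := lintegral_enorm_sub_condExp_sq_le (𝓕.le ⊥) hL2
  have e1 : (fun ω => ‖(s ∩ B n).indicator (X ⊤) ω -
      (P[(s ∩ B n).indicator (X ⊤) | 𝓕 ⊥]) ω‖ₑ ^ (2 : ℝ)) =ᵐ[P]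
      (s ∩ B n).indicator fun ω => ‖X ⊤ ω - X ⊥ ω‖ₑ ^ (2 : ℝ) := by
    filter_upwards [hMn.2 ⊥ ⊤ bot_le] with ω hω
    rw [hω]
    by_cases h : ω ∈ s ∩ B n <;> simp [h]
  have e2 : (fun ω => ‖(s ∩ B n).indicator (X ⊤) ω‖ₑ ^ (2 : ℝ)) =
      (s ∩ B n).indicator fun ω => ‖X ⊤ ω‖ₑ ^ (2 : ℝ) := by
    funext ω
    by_cases h : ω ∈ s ∩ B n <;> simp [h]
  rw [lintegral_congr_ae e1, e2, lintegral_indicator hsBm, lintegral_indicator hsBm] at key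
  simpa using key

end DoobConditional

/-! ### Paths with finitely many oscillations and their right limits -/

section Oscillations

variable {E : Type*} [NormedAddCommGroup E] {ε : ℝ} {g : ℕ → E}

open Classical in
/-- The value of `g` at the last time before `n` at which it had moved by `ε`. -/
noncomputable def anchor (ε : ℝ) (g : ℕ → E) : ℕ → E
  | 0 => g 0
  | n + 1 => if ε ≤ ‖g (n + 1) - anchor ε g n‖ then g (n + 1) else anchor ε g n

open Classical in
/-- The number of times before `n` at which `g` has moved by `ε`. -/
noncomputable def oscCount (ε : ℝ) (g : ℕ → E) : ℕ → ℕ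
  | 0 => 0
  | n + 1 => if ε ≤ ‖g (n + 1) - anchor ε g n‖ then oscCount ε g n + 1 else oscCount ε g n

theorem norm_sub_anchor_lt (hε : 0 < ε) (n : ℕ) : ‖g n - anchor ε g n‖ < ε := by
  cases n with
  | zero => simpa [anchor] using hε
  | succ n =>
    rw [anchor]
    split_ifs with h
    · simpa using hε
    · exact not_le.1 h

theorem monotone_oscCount (ε : ℝ) (g : ℕ → E) : Monotone (oscCount ε g) := by
  refine monotone_nat_of_le_succ fun n => ?_
  rw [oscCount]
  split_ifs
  · exact Nat.le_succ _
  · exact le_rfl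

theorem oscCount_le (ε : ℝ) (g : ℕ → E) (n : ℕ) : oscCount ε g n ≤ n := by
  induction n with
  | zero => simp [oscCount]
  | succ n ih => rw [oscCount]; split_ifs <;> omega

/-- If the count did not change between i and j, neither would the anchor, and both values would lie
at distance less than ε from it. -/
theorem oscCount_lt (hε : 0 < ε) {i j : ℕ} (hij : i ≤ j) (h : 2 * ε ≤ ‖g j - g i‖) :
    oscCount ε g i < oscCount ε g j := by
  by_contra hcon
  have hconst : ∀ k, i ≤ k → oscCount ε g k ≤ oscCount ε g i → anchor ε g k = anchor ε g i := by
    intro k hk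
    induction k, hk using Nat.le_induction with
    | base => exact fun _ => rfl
    | succ k hk ih =>
      intro hle
      have h1 := monotone_oscCount ε g hk
      rw [oscCount] at hle
      rw [anchor]
      split_ifs at hle ⊢
      · omega
      · exact ih hle
  have h1 := hconst j hij (not_lt.1 hcon)
  have h2 := norm_sub_anchor_lt (g := g) hε i
  have h3 := norm_sub_anchor_lt (g := g) hε j
  rw [h1] at h3
  have h4 : g j - g i = (g j - anchor ε g i) - (g i - anchor ε g i) := by abel
  have h5 := norm_sub_le (g j - anchor ε g i) (g i - anchor ε g i)
  rw [← h4] at h5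
  linarith

theorem norm_anchor_le {c : ℝ} (h : ∀ n, ‖g n‖ ≤ c) (n : ℕ) : ‖anchor ε g n‖ ≤ c := by
  induction n with
  | zero => exact h 0
  | succ n ih =>
    rw [anchor]
    split_ifs
    · exact h _
    · exact ih

variable {T : ℝ≥0}

/-- From the point `u` of `I`, the path `h` makes `k` successive moves of size at least `δ` between
points of `I`. -/
def ChainUp (I : Set (TimeSet T)) (h : TimeSet T → E) (δ : ℝ) : ℕ → TimeSet T → Prop
  | 0, u => u ∈ I
  | k + 1, u => u ∈ I ∧ ∃ v, u < v ∧ δ ≤ ‖h v - h u‖ ∧ ChainUp I h δ k v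

theorem ChainUp.mono {I J : Set (TimeSet T)} (hIJ : I ⊆ J) {h : TimeSet T → E} {δ : ℝ} {k : ℕ}
    {u : TimeSet T} (hc : ChainUp I h δ k u) : ChainUp J h δ k u := by
  induction k generalizing u with
  | zero => exact hIJ hc
  | succ k ih =>
    obtain ⟨hu, v, hv, hd, hc⟩ := hc
    exact ⟨hIJ hu, v, hv, hd, ih hc⟩

theorem ChainUp.exists_finite {h : TimeSet T → E} {δ : ℝ} {k : ℕ} {u : TimeSet T}
    (hc : ChainUp (Set.range (timeSeq T)) h δ k u) :
    ∃ N, ChainUp (timeSeq T '' Set.Iio N) h δ k u := by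
  induction k generalizing u with
  | zero =>
    obtain ⟨n, rfl⟩ := hc
    exact ⟨n + 1, n, Nat.lt_succ_self n, rfl⟩
  | succ k ih =>
    obtain ⟨⟨n, rfl⟩, v, hv, hd, hc⟩ := hc
    obtain ⟨N, hN⟩ := ih hc
    refine ⟨max N (n + 1), ⟨n, ?_, rfl⟩, v, hv, hd, hN.mono (Set.image_mono ?_)⟩
    · exact (Nat.lt_succ_self n).trans_le (le_max_right _ _)
    · exact Set.Iio_subset_Iio (le_max_left _ _)

/-- Each move of size 2ε raises the count by at least one, because τ runs through all points of I in
increasing order. -/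
theorem ChainUp.le_oscCount (hε : 0 < ε) {I : Set (TimeSet T)} {h : TimeSet T → E}
    {τ : ℕ → TimeSet T} (hτ : Monotone τ) {n : ℕ} (hI : ∀ t ∈ I, ∃ k ≤ n, τ k = t) {k : ℕ}
    {u : TimeSet T} (hc : ChainUp I h (2 * ε) k u) : k ≤ oscCount ε (fun i => h (τ i)) n := by
  have key : ∀ k i, i ≤ n → ChainUp I h (2 * ε) k (τ i) →
      oscCount ε (fun i => h (τ i)) i + k ≤ oscCount ε (fun i => h (τ i)) n := by
    intro k
    induction k with
    | zero => exact fun i hi _ => monotone_oscCount _ _ hi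
    | succ k ih =>
      rintro i hi ⟨-, v, hv, hd, hc⟩
      have hvI : v ∈ I := by
        cases k with
        | zero => exact hc
        | succ k => exact hc.1
      obtain ⟨j, hj, rfl⟩ := hI v hvI
      have hij : i ≤ j := by
        by_contra hcon
        exact absurd (hτ (not_le.1 hcon).le) (not_le.2 hv)
      have h1 := oscCount_lt (g := fun i => h (τ i)) hε hij hd
      have h2 := ih j hj hc
      omega
  have huI : u ∈ I := by
    cases k with
    | zero => exact hc
    | succ k => exact hc.1
  obtain ⟨i, hi, rfl⟩ := hI u huI
  exact (Nat.le_add_left _ _).trans (key k i hi hc)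

/-- The path `h`, restricted to `timeSeq`, makes only finitely many moves of a given size. -/
def HasFiniteOsc (h : TimeSet T → E) : Prop :=
  ∀ δ : ℝ, 0 < δ → ∃ k, ∀ u, ¬ ChainUp (Set.range (timeSeq T)) h δ k u

variable [CompleteSpace E] {h : TimeSet T → E}

/-- If there were no limit, every right neighbourhood of t would contain two sequence points at
distance at least ε. One of them is at least ε/2 away from the start of a given chain; prepending it
produces arbitrarily long chains. -/
theorem HasFiniteOsc.exists_tendsto_right (hh : HasFiniteOsc h) (t : TimeSet T) :
    ∃ l, Tendsto h (𝓝[Set.Ioi t ∩ Set.range (timeSeq T)] t) (𝓝 l) := by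
  rcases eq_or_neBot (𝓝[Set.Ioi t ∩ Set.range (timeSeq T)] t) with hbot | hne
  · exact ⟨0, by rw [hbot]; exact tendsto_bot⟩
  refine cauchy_map_iff_exists_tendsto.1 ?_
  rw [Metric.cauchy_iff]
  refine ⟨inferInstance, fun ε hε => ?_⟩
  by_contra hcon
  push Not at hcon
  have hosc : ∀ U ∈ 𝓝[Set.Ioi t ∩ Set.range (timeSeq T)] t, ∃ s ∈ U, ∃ s' ∈ U,
      ε ≤ dist (h s) (h s') := by
    intro U hU
    obtain ⟨_, ⟨s, hs, rfl⟩, _, ⟨s', hs', rfl⟩, hd⟩ := hcon (h '' U) (image_mem_map hU)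
    exact ⟨s, hs, s', hs', hd⟩
  obtain ⟨k, hk⟩ := hh (ε / 2) (by positivity)
  have key : ∀ k, ∃ u, t < u ∧ ChainUp (Set.range (timeSeq T)) h (ε / 2) k u := by
    intro k
    induction k with
    | zero =>
      obtain ⟨s, hs, -⟩ := hosc _ self_mem_nhdsWithin
      exact ⟨s, hs.1, hs.2⟩
    | succ k ih =>
      obtain ⟨u, htu, hc⟩ := ih
      have hU : Set.Ioi t ∩ Set.range (timeSeq T) ∩ Set.Iio u ∈
          𝓝[Set.Ioi t ∩ Set.range (timeSeq T)] t :=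
        inter_mem_nhdsWithin _ (Iio_mem_nhds htu)
      obtain ⟨s, hs, s', hs', hd⟩ := hosc _ hU
      have := dist_triangle_right (h s) (h s') (h u)
      rcases le_total (ε / 2) (dist (h s) (h u)) with h1 | h1
      · refine ⟨s, hs.1.1, hs.1.2, u, hs.2, ?_, hc⟩
        rwa [← dist_eq_norm, dist_comm]
      · refine ⟨s', hs'.1.1, hs'.1.2, u, hs'.2, ?_, hc⟩
        rw [← dist_eq_norm, dist_comm]
        linarith
  obtain ⟨u, -, hu⟩ := key k
  exact hk u hu

/-- As on the right, but moves now go towards t, so the induction must provide a long chain from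
every sequence point before t. -/
theorem HasFiniteOsc.exists_tendsto_left (hh : HasFiniteOsc h) (t : TimeSet T) :
    ∃ l, Tendsto h (𝓝[Set.Iio t ∩ Set.range (timeSeq T)] t) (𝓝 l) := by
  rcases eq_or_neBot (𝓝[Set.Iio t ∩ Set.range (timeSeq T)] t) with hbot | hne
  · exact ⟨0, by rw [hbot]; exact tendsto_bot⟩
  refine cauchy_map_iff_exists_tendsto.1 ?_
  rw [Metric.cauchy_iff]
  refine ⟨inferInstance, fun ε hε => ?_⟩
  by_contra hcon
  push Not at hcon
  have hosc : ∀ U ∈ 𝓝[Set.Iio t ∩ Set.range (timeSeq T)] t, ∃ s ∈ U, ∃ s' ∈ U,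
      ε ≤ dist (h s) (h s') := by
    intro U hU
    obtain ⟨_, ⟨s, hs, rfl⟩, _, ⟨s', hs', rfl⟩, hd⟩ := hcon (h '' U) (image_mem_map hU)
    exact ⟨s, hs, s', hs', hd⟩
  obtain ⟨k, hk⟩ := hh (ε / 2) (by positivity)
  have key : ∀ k u, u < t → u ∈ Set.range (timeSeq T) →
      ChainUp (Set.range (timeSeq T)) h (ε / 2) k u := by
    intro k
    induction k with
    | zero => exact fun u _ hu => hu
    | succ k ih =>
      intro u hut hu
      have hU : Set.Iio t ∩ Set.range (timeSeq T) ∩ Set.Ioi u ∈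
          𝓝[Set.Iio t ∩ Set.range (timeSeq T)] t :=
        inter_mem_nhdsWithin _ (Ioi_mem_nhds hut)
      obtain ⟨s, hs, s', hs', hd⟩ := hosc _ hU
      have := dist_triangle_right (h s) (h s') (h u)
      rcases le_total (ε / 2) (dist (h s) (h u)) with h1 | h1
      · exact ⟨hu, s, hs.2, by rwa [← dist_eq_norm], ih s hs.1.1 hs.1.2⟩
      · refine ⟨hu, s', hs'.2, ?_, ih s' hs'.1.1 hs'.1.2⟩
        rw [← dist_eq_norm]
        linarith
  obtain ⟨s, hs, -⟩ := hosc _ self_mem_nhdsWithin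
  exact hk s (key k s hs.1 hs.2)

omit [CompleteSpace E] in
open Classical in
/-- The right limits of `h` along `timeSeq`. -/
noncomputable def rightLimits (h : TimeSet T → E) (t : TimeSet T) : E :=
  if t = ⊤ then h ⊤ else limUnder (𝓝[Set.Ioi t ∩ Set.range (timeSeq T)] t) h

theorem HasFiniteOsc.tendsto_rightLimits (hh : HasFiniteOsc h) {t : TimeSet T} (ht : t ≠ ⊤) :
    Tendsto h (𝓝[Set.Ioi t ∩ Set.range (timeSeq T)] t) (𝓝 (rightLimits h t)) := by
  rw [rightLimits, if_neg ht]
  exact tendsto_nhds_limUnder (hh.exists_tendsto_right t)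

/-- The right limit at s in [a, b) only sees h on (s, b), so a closed constraint on (a, b) persists.
Used with closed balls, this gives both right continuity and left limits. -/
theorem HasFiniteOsc.rightLimits_mem (hh : HasFiniteOsc h) {a b s : TimeSet T} {V : Set E}
    (hV : IsClosed V) (hab : ∀ s ∈ Set.Ioo a b, s ∈ Set.range (timeSeq T) → h s ∈ V)
    (has : a ≤ s) (hsb : s < b) : rightLimits h s ∈ V := by
  have hs : s ≠ ⊤ := (hsb.trans_le le_top).ne
  have := nhdsWithin_Ioi_inter_timeSeq_neBot hs
  refine hV.mem_of_tendsto (hh.tendsto_rightLimits hs) ?_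
  filter_upwards [inter_mem_nhdsWithin _ (Iio_mem_nhds hsb)] with u hu
  exact hab u ⟨has.trans_lt hu.1.1, hu.2⟩ hu.1.2

theorem HasFiniteOsc.isRCLL_rightLimits (hh : HasFiniteOsc h) : IsRCLL (rightLimits h) := by
  intro t
  constructor
  · rcases eq_or_ne t ⊤ with rfl | ht
    · rw [Set.Ici_top]
      exact continuousWithinAt_singleton
    · rw [ContinuousWithinAt, Metric.tendsto_nhds]
      intro ε hε
      have h1 := (hh.tendsto_rightLimits ht).eventually
        (Metric.closedBall_mem_nhds (rightLimits h t) (half_pos hε))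
      rw [nhdsWithin_inter', eventually_inf_principal] at h1
      obtain ⟨b, hb, hsub⟩ := (mem_nhdsGT_iff_exists_Ioo_subset' (lt_top_iff_ne_top.2 ht)).1 h1
      filter_upwards [Ico_mem_nhdsGE hb] with s hs
      have := hh.rightLimits_mem Metric.isClosed_closedBall (fun s hs hsD => hsub hs hsD) hs.1 hs.2
      exact (Metric.mem_closedBall.1 this).trans_lt (half_lt_self hε)
  · obtain ⟨l, hl⟩ := hh.exists_tendsto_left t
    refine ⟨l, ?_⟩
    rcases eq_or_ne t ⊥ with rfl | ht
    · simp
    rw [Metric.tendsto_nhds]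
    intro ε hε
    have h1 := hl.eventually (Metric.closedBall_mem_nhds l (half_pos hε))
    rw [nhdsWithin_inter', eventually_inf_principal] at h1
    obtain ⟨a, ha, hsub⟩ := (mem_nhdsLT_iff_exists_Ioo_subset' (bot_lt_iff_ne_bot.2 ht)).1 h1
    filter_upwards [Ico_mem_nhdsLT ha] with s hs
    have := hh.rightLimits_mem Metric.isClosed_closedBall (fun s hs hsD => hsub hs hsD) hs.1 hs.2
    exact (Metric.mem_closedBall.1 this).trans_lt (half_lt_self hε)

end Oscillations

/-! ### An L² estimate for oscillation counts -/

section Regularization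

variable {T : ℝ≥0} {Ω : Type*} {mΩ : MeasurableSpace Ω} {P : Measure Ω} [IsProbabilityMeasure P]
  {d : ℕ} {𝓕 : Filtration (TimeSet T) mΩ} {f : TimeSet T → Ω → EuclideanSpace ℝ (Fin d)} {c : ℝ}

omit [IsProbabilityMeasure P] in
theorem stronglyMeasurable_anchor (hf : ∀ t, StronglyMeasurable[𝓕 t] (f t)) {τ : ℕ → TimeSet T}
    (hτ : Monotone τ) (ε : ℝ) (n : ℕ) :
    StronglyMeasurable[𝓕 (τ n)] fun ω => anchor ε (fun k => f (τ k) ω) n := by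
  classical
  induction n with
  | zero => exact hf (τ 0)
  | succ n ih =>
    have ih' := ih.mono (𝓕.mono (hτ (Nat.le_succ n)))
    simp only [anchor]
    exact StronglyMeasurable.ite (stronglyMeasurable_const.measurableSet_le
      ((hf (τ (n + 1))).sub ih').norm) (hf (τ (n + 1))) ih'

omit [IsProbabilityMeasure P] in
theorem measurable_oscCount (hf : ∀ t, StronglyMeasurable[𝓕 t] (f t)) {τ : ℕ → TimeSet T}
    (hτ : Monotone τ) (ε : ℝ) (n : ℕ) :
    Measurable fun ω => oscCount ε (fun k => f (τ k) ω) n := by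
  classical
  induction n with
  | zero => exact measurable_const
  | succ n ih =>
    have h1 := (stronglyMeasurable_anchor hf hτ ε n).mono (𝓕.le (τ n))
    simp only [oscCount]
    exact Measurable.ite (stronglyMeasurable_const.measurableSet_le
      (((hf (τ (n + 1))).mono (𝓕.le _)).sub h1).norm) (ih.add_const 1) ih

/-- An energy argument replaces upcrossings and works for vectors directly. With the anchor held
fixed, E|f - anchor|² grows exactly as E|f|² does, because the anchor is known at time `τ n`; a
reset then trades at least ε² of |f - anchor|² for one more count. -/
theorem integral_oscCount_le (hf : Martingale f 𝓕 P) (hc : ∀ t ω, ‖f t ω‖ ≤ c)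
    {τ : ℕ → TimeSet T} (hτ : Monotone τ) {ε : ℝ} (hε : 0 ≤ ε) (n : ℕ) :
    ∫ ω, (ε ^ 2 * (oscCount ε (fun k => f (τ k) ω) n : ℝ) +
      ‖f (τ n) ω - anchor ε (fun k => f (τ k) ω) n‖ ^ 2) ∂P ≤ ∫ ω, ‖f (τ n) ω‖ ^ 2 ∂P := by
  have hfm : ∀ t, StronglyMeasurable (f t) := fun t => (hf.1 t).mono (𝓕.le t)
  have ham : ∀ n, StronglyMeasurable fun ω => anchor ε (fun k => f (τ k) ω) n := fun n =>
    (stronglyMeasurable_anchor hf.1 hτ ε n).mono (𝓕.le _)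
  have hac : ∀ n ω, ‖anchor ε (fun k => f (τ k) ω) n‖ ≤ c := fun n ω =>
    norm_anchor_le (fun k => hc (τ k) ω) n
  have hcount : ∀ n, Integrable (fun ω => ε ^ 2 * (oscCount ε (fun k => f (τ k) ω) n : ℝ)) P := by
    intro n
    refine Integrable.const_mul (Integrable.of_bound (C := n) ?_ (Eventually.of_forall fun ω => ?_)) _
    · exact (measurable_from_nat.comp (measurable_oscCount hf.1 hτ ε n)).aestronglyMeasurable
    · rw [Real.norm_natCast]
      exact_mod_cast oscCount_le _ _ _
  have hdiff : ∀ n k, Integrable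
      (fun ω => ‖f (τ n) ω - anchor ε (fun k => f (τ k) ω) k‖ ^ 2) P := by
    intro n k
    refine Integrable.of_bound (C := (c + c) ^ 2)
      (((hfm _).sub (ham k)).norm.pow 2).aestronglyMeasurable (Eventually.of_forall fun ω => ?_)
    rw [norm_pow, norm_norm]
    gcongr
    exact (norm_sub_le _ _).trans (add_le_add (hc _ _) (hac _ _))
  have hsq : ∀ t, Integrable (fun ω => ‖f t ω‖ ^ 2) P := by
    intro t
    refine Integrable.of_bound (C := c ^ 2) ((hfm t).norm.pow 2).aestronglyMeasurable
      (Eventually.of_forall fun ω => ?_)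
    rw [norm_pow, norm_norm]
    gcongr
    exact hc _ _
  have hinner : ∀ n t, Integrable
      (fun ω => inner ℝ (anchor ε (fun k => f (τ k) ω) n) (f t ω)) P := by
    intro n t
    refine Integrable.of_bound (C := c * c) ((ham n).inner (hfm t)).aestronglyMeasurable
      (Eventually.of_forall fun ω => (norm_inner_le_norm _ _).trans ?_)
    exact mul_le_mul (hac _ _) (hc _ _) (norm_nonneg _) ((norm_nonneg _).trans (hac n ω))
  induction n with
  | zero => simpa [oscCount, anchor] using integral_nonneg fun ω => by positivity
  | succ n ih =>
    have hstep : ∀ ω, ε ^ 2 * (oscCount ε (fun k => f (τ k) ω) (n + 1) : ℝ) +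
        ‖f (τ (n + 1)) ω - anchor ε (fun k => f (τ k) ω) (n + 1)‖ ^ 2 ≤
        ε ^ 2 * (oscCount ε (fun k => f (τ k) ω) n : ℝ) +
        ‖f (τ (n + 1)) ω - anchor ε (fun k => f (τ k) ω) n‖ ^ 2 := by
      intro ω
      rw [oscCount, anchor]
      split_ifs with h
      · have := pow_le_pow_left₀ hε h 2
        rw [sub_self, norm_zero]
        push_cast
        linarith
      · exact le_rfl
    have hexp : ∀ ω, ε ^ 2 * (oscCount ε (fun k => f (τ k) ω) n : ℝ) +
        ‖f (τ (n + 1)) ω - anchor ε (fun k => f (τ k) ω) n‖ ^ 2 =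
        (ε ^ 2 * (oscCount ε (fun k => f (τ k) ω) n : ℝ) +
        ‖f (τ n) ω - anchor ε (fun k => f (τ k) ω) n‖ ^ 2) +
        ((‖f (τ (n + 1)) ω‖ ^ 2 - ‖f (τ n) ω‖ ^ 2) -
        2 * (inner ℝ (anchor ε (fun k => f (τ k) ω) n) (f (τ (n + 1)) ω) -
          inner ℝ (anchor ε (fun k => f (τ k) ω) n) (f (τ n) ω))) := by
      intro ω
      rw [norm_sub_sq_real, norm_sub_sq_real, real_inner_comm, real_inner_comm (f (τ n) ω)]
      ring
    have horth : ∫ ω, inner ℝ (anchor ε (fun k => f (τ k) ω) n) (f (τ (n + 1)) ω) ∂P =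
        ∫ ω, inner ℝ (anchor ε (fun k => f (τ k) ω) n) (f (τ n) ω) ∂P := by
      rw [← integral_inner_condExp (𝓕.le (τ n))
        (stronglyMeasurable_anchor hf.1 hτ ε n).aestronglyMeasurable
        (hf.integrable _) (hinner n (τ (n + 1)))]
      refine integral_congr_ae ?_
      filter_upwards [hf.2 (τ n) (τ (n + 1)) (hτ (Nat.le_succ n))] with ω hω
      rw [hω]
    have i1 : Integrable (fun ω => ε ^ 2 * (oscCount ε (fun k => f (τ k) ω) n : ℝ) +
        ‖f (τ n) ω - anchor ε (fun k => f (τ k) ω) n‖ ^ 2) P := (hcount n).add (hdiff n n)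
    have i2 : Integrable (fun ω => ‖f (τ (n + 1)) ω‖ ^ 2 - ‖f (τ n) ω‖ ^ 2) P :=
      (hsq _).sub (hsq _)
    have i3 : Integrable (fun ω =>
        2 * (inner ℝ (anchor ε (fun k => f (τ k) ω) n) (f (τ (n + 1)) ω) -
          inner ℝ (anchor ε (fun k => f (τ k) ω) n) (f (τ n) ω))) P :=
      ((hinner n _).sub (hinner n _)).const_mul 2
    refine (integral_mono ((hcount (n + 1)).add (hdiff (n + 1) (n + 1)))
      ((hcount n).add (hdiff (n + 1) n)) hstep).trans ?_
    refine (integral_congr_ae (Eventually.of_forall hexp)).trans_le ?_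
    have i4 : Integrable (fun ω => (‖f (τ (n + 1)) ω‖ ^ 2 - ‖f (τ n) ω‖ ^ 2) -
        2 * (inner ℝ (anchor ε (fun k => f (τ k) ω) n) (f (τ (n + 1)) ω) -
          inner ℝ (anchor ε (fun k => f (τ k) ω) n) (f (τ n) ω))) P := i2.sub i3
    rw [integral_add i1 i4, integral_sub i2 i3, integral_sub (hsq _) (hsq _), integral_const_mul,
      integral_sub (hinner n _) (hinner n _), horth]
    linarith

end Regularization

/-! ### RCLL versions of bounded martingales -/

section Regularization

variable {T : ℝ≥0} {Ω : Type*} {mΩ : MeasurableSpace Ω} {P : Measure Ω} [IsProbabilityMeasure P]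
  {d : ℕ} {𝓕 : Filtration (TimeSet T) mΩ} {f : TimeSet T → Ω → EuclideanSpace ℝ (Fin d)} {c : ℝ}

/-- Markov's inequality. What matters is that the bound does not depend on the number n of sampled
times. -/
theorem mul_measure_le_oscCount_le (hf : Martingale f 𝓕 P) (hc : ∀ t ω, ‖f t ω‖ ≤ c)
    {τ : ℕ → TimeSet T} (hτ : Monotone τ) {ε : ℝ} (hε : 0 < ε) (n k : ℕ) :
    (k : ℝ≥0∞) * P {ω | k ≤ oscCount ε (fun k => f (τ k) ω) n} ≤ ENNReal.ofReal (c ^ 2 / ε ^ 2) := by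
  have hm := measurable_oscCount hf.1 hτ ε n
  have hmr : Measurable fun ω => (oscCount ε (fun k => f (τ k) ω) n : ℝ) :=
    measurable_from_nat.comp hm
  have hint : Integrable (fun ω => (oscCount ε (fun k => f (τ k) ω) n : ℝ)) P := by
    refine Integrable.of_bound (C := n) hmr.aestronglyMeasurable (Eventually.of_forall fun ω => ?_)
    rw [Real.norm_natCast]
    exact_mod_cast oscCount_le _ _ _
  have hbound : ∫ ω, (oscCount ε (fun k => f (τ k) ω) n : ℝ) ∂P ≤ c ^ 2 / ε ^ 2 := by
    rw [le_div_iff₀ (by positivity), mul_comm, ← integral_const_mul]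
    calc ∫ ω, ε ^ 2 * (oscCount ε (fun k => f (τ k) ω) n : ℝ) ∂P
        ≤ ∫ ω, (ε ^ 2 * (oscCount ε (fun k => f (τ k) ω) n : ℝ) +
            ‖f (τ n) ω - anchor ε (fun k => f (τ k) ω) n‖ ^ 2) ∂P := by
          refine integral_mono (hint.const_mul _) ((hint.const_mul _).add ?_)
            fun ω => le_add_of_nonneg_right (by positivity)
          refine Integrable.of_bound (C := (c + c) ^ 2) ?_ (Eventually.of_forall fun ω => ?_)
          · exact ((((hf.1 _).mono (𝓕.le _)).sub
              ((stronglyMeasurable_anchor hf.1 hτ ε n).mono (𝓕.le _))).norm.pow 2).aestronglyMeasurable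
          · rw [norm_pow, norm_norm]
            gcongr
            exact (norm_sub_le _ _).trans (add_le_add (hc _ _) (norm_anchor_le (fun k => hc _ _) n))
      _ ≤ ∫ ω, ‖f (τ n) ω‖ ^ 2 ∂P := integral_oscCount_le hf hc hτ hε.le n
      _ ≤ ∫ ω, c ^ 2 ∂P := by
          refine integral_mono_of_nonneg (Eventually.of_forall fun ω => by positivity)
            (integrable_const _) (Eventually.of_forall fun ω => ?_)
          exact pow_le_pow_left₀ (norm_nonneg _) (hc _ _) 2
      _ = c ^ 2 := by simp
  calc (k : ℝ≥0∞) * P {ω | k ≤ oscCount ε (fun k => f (τ k) ω) n}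
      = (k : ℝ≥0∞) * P {ω | (k : ℝ≥0∞) ≤ ENNReal.ofReal (oscCount ε (fun k => f (τ k) ω) n : ℝ)} := by
        simp only [ENNReal.ofReal_natCast, Nat.cast_le]
    _ ≤ ∫⁻ ω, ENNReal.ofReal (oscCount ε (fun k => f (τ k) ω) n : ℝ) ∂P :=
        mul_meas_ge_le_lintegral₀ hmr.ennreal_ofReal.aemeasurable _
    _ = ENNReal.ofReal (∫ ω, (oscCount ε (fun k => f (τ k) ω) n : ℝ) ∂P) :=
        (ofReal_integral_eq_lintegral_ofReal hint (Eventually.of_forall fun ω => by positivity)).symm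
    _ ≤ _ := ENNReal.ofReal_le_ofReal hbound

/-- A chain of length k uses finitely many points of `timeSeq`, and chains of length k within a
finite set of times have probability at most c²/(ε² k). Hence arbitrarily long chains have
probability 0. -/
theorem ae_hasFiniteOsc (hf : Martingale f 𝓕 P) (hc : ∀ t ω, ‖f t ω‖ ≤ c) :
    ∀ᵐ ω ∂P, HasFiniteOsc fun t => f t ω := by
  classical
  have key : ∀ ε : ℝ, 0 < ε → ∀ᵐ ω ∂P, ∃ k, ∀ u,
      ¬ ChainUp (Set.range (timeSeq T)) (fun t => f t ω) (2 * ε) k u := by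
    intro ε hε
    let O : ℕ → ℕ → Set Ω := fun k N =>
      {ω | ∃ u, ChainUp (timeSeq T '' Set.Iio N) (fun t => f t ω) (2 * ε) k u}
    have hOmono : ∀ k, Monotone (O k) := fun k i j hij ω ⟨u, hu⟩ =>
      ⟨u, hu.mono (Set.image_mono (Set.Iio_subset_Iio hij))⟩
    have hO : ∀ k N : ℕ, (k : ℝ≥0∞) * P (O k N) ≤ ENNReal.ofReal (c ^ 2 / ε ^ 2) := by
      intro k N
      obtain ⟨τ, n, hτ, -, hI, -⟩ := exists_monotone_enum ((Finset.range N).image (timeSeq T))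
      refine le_trans ?_ (mul_measure_le_oscCount_le hf hc hτ hε n k)
      gcongr
      rintro ω ⟨u, hu⟩
      refine hu.le_oscCount hε hτ fun t ht => ?_
      obtain ⟨i, hi, rfl⟩ := ht
      exact hI _ (Finset.mem_image_of_mem _ (Finset.mem_range.2 hi))
    have hU : ∀ k : ℕ, (k : ℝ≥0∞) * P (⋃ N, O k N) ≤ ENNReal.ofReal (c ^ 2 / ε ^ 2) := by
      intro k
      rw [(hOmono k).measure_iUnion, ENNReal.mul_iSup]
      exact iSup_le (hO k)
    have hzero : P (⋂ k, ⋃ N, O k N) = 0 := by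
      by_contra hne
      have h1 : ∀ k : ℕ, (k : ℝ≥0∞) ≤ ENNReal.ofReal (c ^ 2 / ε ^ 2) / P (⋂ k, ⋃ N, O k N) := by
        intro k
        rw [ENNReal.le_div_iff_mul_le (Or.inl hne) (Or.inl (measure_ne_top _ _))]
        exact (mul_le_mul_right (measure_mono (Set.iInter_subset _ k)) _).trans (hU k)
      obtain ⟨k, hk⟩ := ENNReal.exists_nat_gt (ENNReal.div_lt_top ENNReal.ofReal_ne_top hne).ne
      exact absurd (h1 k) (not_le.2 hk)
    rw [ae_iff]
    refine measure_mono_null (fun ω hω => ?_) hzero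
    simp only [Set.mem_ofPred_eq, not_exists, not_forall, not_not] at hω
    refine Set.mem_iInter.2 fun k => ?_
    obtain ⟨u, hu⟩ := hω k
    obtain ⟨N, hN⟩ := hu.exists_finite
    exact Set.mem_iUnion.2 ⟨N, u, hN⟩
  have hall := ae_all_iff.2 fun m : ℕ => key (1 / ((m : ℝ) + 1)) (by positivity)
  filter_upwards [hall] with ω hω δ hδ
  obtain ⟨m, hm⟩ := exists_nat_one_div_lt (half_pos hδ)
  obtain ⟨k, hk⟩ := hω m
  refine ⟨k, fun u hu => hk u ?_⟩
  have hle : 2 * (1 / ((m : ℝ) + 1)) ≤ δ := by linarith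
  clear hk hω
  induction k generalizing u with
  | zero => exact hu
  | succ k ih =>
    obtain ⟨h1, v, h2, h3, h4⟩ := hu
    exact ⟨h1, v, h2, hle.trans h3, ih v h4⟩

omit [IsProbabilityMeasure P] in
theorem UsualConditions.measurableSet_of_ae (h𝓕 : UsualConditions 𝓕 P) {G : Set Ω}
    (hG : ∀ᵐ ω ∂P, ω ∈ G) : MeasurableSet[𝓕 ⊥] G := by
  have := h𝓕.null Gᶜ hG
  exact (@MeasurableSet.compl_iff Ω G (𝓕 ⊥)).1 this

omit [IsProbabilityMeasure P] in
theorem measurableSet_of_forall_gt (h𝓕 : UsualConditions 𝓕 P) {t : TimeSet T} (ht : t ≠ ⊤)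
    {A : Set Ω} (hA : ∀ u, t < u → MeasurableSet[𝓕 u] A) : MeasurableSet[𝓕 t] A := by
  refine h𝓕.rightCont.RC t A ?_
  have : (𝓝[>] t).NeBot := nhdsGT_neBot_of_exists_gt ⟨⊤, lt_top_iff_ne_top.2 ht⟩
  rw [Filtration.rightCont_eq_of_neBot_nhdsGT]
  simp only [MeasurableSpace.measurableSet_iInf]
  exact hA

/-- A bounded martingale has an RCLL version. -/
theorem exists_rcll_of_martingale (h𝓕 : UsualConditions 𝓕 P) (hf : Martingale f 𝓕 P)
    (hc : ∀ t ω, ‖f t ω‖ ≤ c) :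
    ∃ x : TimeSet T → Ω → EuclideanSpace ℝ (Fin d), (∀ t, StronglyMeasurable[𝓕 t] (x t)) ∧
      (∀ ω, IsRCLL fun t => x t ω) ∧ ∀ t, x t =ᵐ[P] f t := by
  classical
  have hG := ae_hasFiniteOsc hf hc
  set G : Set Ω := {ω | HasFiniteOsc fun t => f t ω} with hGdef
  -- The full-measure event G lies in F_0, so setting the paths to 0 off G does not disturb
  -- adaptedness.
  have hGm : MeasurableSet[𝓕 ⊥] G := h𝓕.measurableSet_of_ae hG
  let x : TimeSet T → Ω → EuclideanSpace ℝ (Fin d) := fun t =>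
    G.indicator fun ω => rightLimits (fun t => f t ω) t
  have hlim : ∀ t : TimeSet T, t ≠ ⊤ → ∀ u, t < u → ∃ s : ℕ → TimeSet T, (∀ n, t < s n) ∧
      (∀ n, s n < u) ∧ ∀ ω, Tendsto (fun n => G.indicator (f (s n)) ω) atTop (𝓝 (x t ω)) := by
    intro t ht u htu
    have := nhdsWithin_Ioi_inter_timeSeq_neBot ht
    obtain ⟨s, hs⟩ := exists_seq_tendsto (𝓝[Set.Ioi t ∩ Set.range (timeSeq T)] t)
    have hev := hs.eventually (inter_mem_nhdsWithin _ (Iio_mem_nhds htu))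
    obtain ⟨N, hN⟩ := eventually_atTop.1 hev
    refine ⟨fun n => s (n + N), fun n => (hN _ (Nat.le_add_left _ _)).1.1,
      fun n => (hN _ (Nat.le_add_left _ _)).2, fun ω => ?_⟩
    by_cases hω : ω ∈ G
    · simp only [x, Set.indicator_of_mem hω]
      exact ((HasFiniteOsc.tendsto_rightLimits hω ht).comp hs).comp (tendsto_add_atTop_nat N)
    · simp only [x, Set.indicator_of_notMem hω]
      exact tendsto_const_nhds
  have hxm : ∀ t, StronglyMeasurable[𝓕 t] (x t) := by
    intro t
    rcases eq_or_ne t ⊤ with rfl | ht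
    · simp only [x, rightLimits, if_true]
      exact (hf.1 ⊤).indicator (measurableSet_of_bot hGm ⊤)
    -- The right limit at t is F_u-measurable for every u > t, and right continuity of the
    -- filtration brings this down to F_t.
    · refine Measurable.stronglyMeasurable fun A hA =>
        measurableSet_of_forall_gt h𝓕 ht fun u htu => ?_
      obtain ⟨s, -, hsu, hs⟩ := hlim t ht u htu
      have : StronglyMeasurable[𝓕 u] (x t) :=
        stronglyMeasurable_of_tendsto atTop (fun n => ((hf.1 (s n)).mono
          (𝓕.mono (hsu n).le)).indicator (measurableSet_of_bot hGm u)) (tendsto_pi_nhds.2 hs)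
      exact this.measurable hA
  refine ⟨x, hxm, fun ω => ?_, fun t => ?_⟩
  · by_cases hω : ω ∈ G
    · simp only [x, Set.indicator_of_mem hω]
      exact HasFiniteOsc.isRCLL_rightLimits hω
    · simp only [x, Set.indicator_of_notMem hω]
      exact isRCLL_const 0
  · rcases eq_or_ne t ⊤ with rfl | ht
    · filter_upwards [hG] with ω hω
      simp only [x, rightLimits, if_true]
      exact Set.indicator_of_mem hω _
    · obtain ⟨s, hts, -, hs⟩ := hlim t ht ⊤ (lt_top_iff_ne_top.2 ht)
      have hxc : ∀ ω, ‖x t ω‖ ≤ c := fun ω => by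
        refine le_of_tendsto' (hs ω).norm fun n => ?_
        rw [norm_indicator_eq_indicator_norm]
        exact Set.indicator_le_self' (fun _ _ => norm_nonneg _) ω |>.trans (hc _ _)
      have hxi : Integrable (x t) P := Integrable.of_bound (C := c)
        ((hxm t).mono (𝓕.le t)).aestronglyMeasurable (Eventually.of_forall hxc)
      -- For A in F_t, the integrals of `f (s n)` over A all equal that of f at T. Dominated
      -- convergence along `s n` → t passes this on to `x t`.
      have h1 : x t =ᵐ[P] P[f ⊤ | 𝓕 t] := by
        refine ae_eq_condExp_of_forall_setIntegral_eq (𝓕.le t) (hf.integrable ⊤)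
          (fun A _ _ => hxi.integrableOn) (fun A hA _ => ?_) (hxm t).aestronglyMeasurable
        have hl : Tendsto (fun n => ∫ ω in A, G.indicator (f (s n)) ω ∂P) atTop
            (𝓝 (∫ ω in A, x t ω ∂P)) := by
          refine tendsto_integral_of_dominated_convergence (fun _ => c) (fun n => ?_)
            (integrable_const c) (fun n => Eventually.of_forall fun ω => ?_)
            (Eventually.of_forall hs)
          · exact (((hf.1 _).mono (𝓕.le _)).indicator (𝓕.le ⊥ _ hGm)).aestronglyMeasurable
          · rw [norm_indicator_eq_indicator_norm]
            exact Set.indicator_le_self' (fun _ _ => norm_nonneg _) ω |>.trans (hc _ _)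
        refine tendsto_nhds_unique hl (tendsto_const_nhds.congr fun n => ?_)
        have e1 : ∫ ω in A, G.indicator (f (s n)) ω ∂P = ∫ ω in A, f (s n) ω ∂P := by
          refine integral_congr_ae (ae_restrict_of_ae ?_)
          filter_upwards [hG] with ω hω using Set.indicator_of_mem hω _
        rw [e1]
        exact (hf.setIntegral_eq le_top (𝓕.mono (hts n).le _ hA)).symm
      exact h1.trans (hf.2 t ⊤ le_top)

/-- For a bounded random vector `V`, there is an RCLL version of the martingale `E[V | F_t]`. -/
theorem exists_rcll_condExp (h𝓕 : UsualConditions 𝓕 P) {V : Ω → EuclideanSpace ℝ (Fin d)}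
    (hV : StronglyMeasurable[𝓕 ⊤] V) (hc : ∀ ω, ‖V ω‖ ≤ c) :
    ∃ X ∈ spaceS 𝓕 P d, MartOn 𝓕 P Set.univ X ∧ (∀ t, ∀ᵐ ω ∂P, ‖X t ω‖ ≤ c) ∧ X ⊤ =ᵐ[P] V := by
  have hVi : Integrable V P := Integrable.of_bound (C := c)
    (hV.mono (𝓕.le ⊤)).aestronglyMeasurable (Eventually.of_forall hc)
  -- The conditional expectation is cut off where it exceeds c, a null set, to obtain a bound at
  -- every ω.
  let f : TimeSet T → Ω → EuclideanSpace ℝ (Fin d) := fun t =>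
    {ω | ‖P[V | 𝓕 t] ω‖ ≤ c}.indicator (P[V | 𝓕 t])
  have hfV : ∀ t, f t =ᵐ[P] P[V | 𝓕 t] := fun t => by
    filter_upwards [ae_bdd_norm_condExp_of_ae_bdd_norm (m := 𝓕 t) (μ := P)
      (Eventually.of_forall hc)] with ω hω
    exact Set.indicator_of_mem (s := {ω | ‖P[V | 𝓕 t] ω‖ ≤ c}) hω _
  have hfm : ∀ t, StronglyMeasurable[𝓕 t] (f t) := fun t =>
    stronglyMeasurable_condExp.indicator
      (stronglyMeasurable_condExp.norm.measurableSet_le stronglyMeasurable_const)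
  have hf : Martingale f 𝓕 P := by
    refine ⟨hfm, fun s t hst => ?_⟩
    exact (condExp_congr_ae (hfV t)).trans
      ((condExp_condExp_of_le (𝓕.mono hst) (𝓕.le t)).trans (hfV s).symm)
  have hfc : ∀ t ω, ‖f t ω‖ ≤ c := fun t ω => by
    by_cases h : ‖P[V | 𝓕 t] ω‖ ≤ c
    · simp [f, h]
    · simpa [f, h] using (norm_nonneg _).trans (hc ω)
  obtain ⟨x, hx1, hx2, hx3⟩ := exists_rcll_of_martingale h𝓕 hf hfc
  let X : Proc T P d := fun t => AEEqFun.mk (x t) ((hx1 t).mono (𝓕.le t)).aestronglyMeasurable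
  have hX : ∀ t, X t =ᵐ[P] f t := fun t => (AEEqFun.coeFn_mk _ _).trans (hx3 t)
  refine ⟨X, ⟨x, hx1, hx2, fun t => (AEEqFun.coeFn_mk _ _).symm⟩, ⟨fun t => ?_, fun s t hst => ?_⟩,
    fun t => ?_, ?_⟩
  · exact ((hf.integrable t).congr (hX t).symm).integrableOn
  · simp only [Set.indicator_univ]
    exact (condExp_congr_ae (hX t)).trans ((hf.2 s t hst).trans (hX s).symm)
  · filter_upwards [hX t] with ω hω
    rw [hω]
    exact hfc t ω
  · refine (hX ⊤).trans ((hfV ⊤).trans ?_)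
    rw [condExp_of_stronglyMeasurable (𝓕.le ⊤) hV hVi]

end Regularization

/-! ### Completeness of S^p and of its generalized martingales -/

section Completeness

variable {T : ℝ≥0} {Ω : Type*} {mΩ : MeasurableSpace Ω} {P : Measure Ω} [IsProbabilityMeasure P]
  {d : ℕ} {𝓕 : Filtration (TimeSet T) mΩ} {p : ℝ≥0∞}

omit [IsProbabilityMeasure P] in
/-- A sequence of RCLL processes whose increments have a.s. summable suprema converges uniformly. -/
theorem exists_rcll_limit (h𝓕 : UsualConditions 𝓕 P) {X : ℕ → Proc T P d}
    (hX : ∀ n, X n ∈ spaceS 𝓕 P d)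
    (hsum : ∀ᵐ ω ∂P, ∑' n, seqSup (X (n + 1) - X n) ω < ∞) :
    ∃ Y ∈ spaceS 𝓕 P d, ∀ n, ∀ᵐ ω ∂P,
      seqSup (Y - X n) ω ≤ ∑' k, seqSup (X (n + k + 1) - X (n + k)) ω := by
  choose x hx using hX
  let D : ℕ → Ω → ℝ≥0∞ := fun n ω => ⨆ t, edist (x n t ω) (x (n + 1) t ω)
  have hD : ∀ n, D n =ᵐ[P] seqSup (X (n + 1) - X n) := by
    intro n
    have hv : IsRCLLVersion 𝓕 P (fun t ω => x (n + 1) t ω - x n t ω) (X (n + 1) - X n) := by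
      refine ⟨fun t => ((hx _).adapted t).sub ((hx _).adapted t),
        fun ω => ((hx _).rcll ω).sub ((hx _).rcll ω), fun t => ?_⟩
      filter_upwards [(hx (n + 1)).version t, (hx n).version t,
        AEEqFun.coeFn_sub (X (n + 1) t) (X n t)] with ω h1 h2 h3
      rw [Pi.sub_apply, h3, Pi.sub_apply, h1, h2]
    filter_upwards [hv.iSup_enorm_ae_eq] with ω hω
    rw [← hω]
    exact iSup_congr fun t => by rw [edist_comm, edist_eq_enorm_sub]
  -- On G the paths converge uniformly; off G the limit is set to 0. As G has full measure it lies
  -- in F_0, so the limit is adapted.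
  let G : Set Ω := {ω | ∑' n, D n ω < ∞}
  have hGae : ∀ᵐ ω ∂P, ω ∈ G := by
    filter_upwards [hsum, ae_all_iff.2 hD] with ω h1 h2
    simpa only [G, Set.mem_ofPred_eq, h2] using h1
  have hG : MeasurableSet[𝓕 ⊥] G := h𝓕.measurableSet_of_ae hGae
  have hle : ∀ ω t n, edist (x n t ω) (x (n + 1) t ω) ≤ D n ω := fun ω t n =>
    le_iSup (fun t => edist (x n t ω) (x (n + 1) t ω)) t
  have hlim : ∀ ω ∈ G, ∀ t, ∃ l, Tendsto (fun n => x n t ω) atTop (𝓝 l) := fun ω hω t =>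
    cauchySeq_tendsto_of_complete
      (cauchySeq_of_edist_le_of_tsum_ne_top _ (hle ω t) (ne_of_lt hω))
  have hex : ∀ ω t, ∃ l, (ω ∈ G → Tendsto (fun n => x n t ω) atTop (𝓝 l)) ∧ (ω ∉ G → l = 0) := by
    intro ω t
    by_cases hω : ω ∈ G
    · obtain ⟨l, hl⟩ := hlim ω hω t
      exact ⟨l, fun _ => hl, fun h => absurd hω h⟩
    · exact ⟨0, fun h => absurd h hω, fun _ => rfl⟩
  choose y hy1 hy0 using hex
  have hdist : ∀ ω ∈ G, ∀ n t, edist (x n t ω) (y ω t) ≤ ∑' k, D (n + k) ω := fun ω hω n t =>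
    edist_le_tsum_of_edist_le_of_tendsto _ (hle ω t) (hy1 ω t hω) n
  have hmeas : ∀ t, StronglyMeasurable[𝓕 t] fun ω => y ω t := by
    intro t
    refine @stronglyMeasurable_of_tendsto _ _ _ (𝓕 t) _ _ atTop _ _
      (fun n => G.indicator (x n t)) _
      (fun n => ((hx n).adapted t).indicator (measurableSet_of_bot hG t)) ?_
    refine tendsto_pi_nhds.2 fun ω => ?_
    by_cases hω : ω ∈ G
    · simpa only [Set.indicator_of_mem hω] using hy1 ω t hω
    · simpa only [Set.indicator_of_notMem hω, hy0 ω t hω] using tendsto_const_nhds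
  have hrcll : ∀ ω, IsRCLL fun t => y ω t := by
    intro ω
    by_cases hω : ω ∈ G
    · refine isRCLL_of_tendstoUniformly (fun n => (hx n).rcll ω) ?_
      rw [EMetric.tendstoUniformly_iff]
      intro ε hε
      have h0 := ENNReal.tendsto_sum_nat_add (fun n => D n ω) (ne_of_lt hω)
      filter_upwards [(tendsto_order.1 h0).2 ε hε] with n hn t
      rw [edist_comm]
      refine (hdist ω hω n t).trans_lt ?_
      simpa only [add_comm n] using hn
    · simp only [hy0 ω _ hω]
      exact isRCLL_const 0
  obtain ⟨Y, hY⟩ : ∃ Y : Proc T P d, ∀ t, Y t =ᵐ[P] fun ω => y ω t :=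
    ⟨fun t => AEEqFun.mk (fun ω => y ω t) ((hmeas t).mono (𝓕.le t)).aestronglyMeasurable,
      fun t => AEEqFun.coeFn_mk _ _⟩
  refine ⟨Y, ⟨fun t ω => y ω t, hmeas, hrcll, fun t => (hY t).symm⟩, fun n => ?_⟩
  have hv := ae_all_iff.2 fun k => (hx n).version (timeSeq T k)
  have hs := ae_all_iff.2 fun k => AEEqFun.coeFn_sub (Y (timeSeq T k)) (X n (timeSeq T k))
  have hk := ae_all_iff.2 fun k => hY (timeSeq T k)
  filter_upwards [hGae, ae_all_iff.2 hD, hv, hs, hk] with ω h1 h2 h3 h4 h5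
  simp only [← h2]
  refine iSup_le fun k => ?_
  rw [Pi.sub_apply, h4 k, Pi.sub_apply, h5 k, ← h3 k, ← edist_eq_enorm_sub, edist_comm]
  exact hdist ω h1 n _

/-- Completeness of `S^p`: a sequence with a.s. summable conditional norms of increments converges,
with an a.s. rate. -/
theorem exists_spaceSp_limit (h𝓕 : UsualConditions 𝓕 P) (hp1 : 1 ≤ p) {X : ℕ → Proc T P d}
    (hX : ∀ n, X n ∈ spaceSp 𝓕 P p d)
    (hsum : ∀ᵐ ω ∂P, ∑' n, procNorm 𝓕 P p (X (n + 1) - X n) ω < ∞) :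
    ∃ Y ∈ spaceSp 𝓕 P p d, ∀ n, ∀ᵐ ω ∂P,
      procNorm 𝓕 P p (Y - X n) ω ≤ ∑' k, procNorm 𝓕 P p (X (n + k + 1) - X (n + k)) ω := by
  have hS := fun n => ((mem_spaceSp_iff hp1).1 (hX n)).1
  have hR : ∀ n, AEMeasurable (seqSup (X (n + 1) - X n)) P := fun n =>
    (measurable_seqSup _).aemeasurable
  have hN := ae_all_iff.2 fun n => procNorm_ae_eq hp1 (sub_mem_spaceS (hS (n + 1)) (hS n))
  -- By the countable triangle inequality the sum has a finite conditional norm, hence is itself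
  -- finite almost surely.
  have hfin : ∀ᵐ ω ∂P, ∑' n, seqSup (X (n + 1) - X n) ω < ∞ := by
    refine ae_lt_top_of_condNorm_lt_top (𝓕.le ⊥) hp1
      (AEMeasurable.tsum hR) ?_
    filter_upwards [condNorm_tsum_le (𝓕.le ⊥) hp1 hR, hsum, hN] with ω h1 h2 h3
    refine h1.trans_lt ?_
    simpa only [← h3] using h2
  obtain ⟨Y, hYS, hY⟩ := exists_rcll_limit h𝓕 hS hfin
  have key : ∀ n, ∀ᵐ ω ∂P,
      procNorm 𝓕 P p (Y - X n) ω ≤ ∑' k, procNorm 𝓕 P p (X (n + k + 1) - X (n + k)) ω := by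
    intro n
    filter_upwards [procNorm_le_condNorm hp1 (sub_mem_spaceS hYS (hS n)) (hY n), hN,
      condNorm_tsum_le (𝓕.le ⊥) hp1 fun k => hR (n + k)] with ω h1 h2 h3
    refine h1.trans (h3.trans_eq ?_)
    simp only [h2]
  refine ⟨Y, ?_, key⟩
  have h0 : Y - X 0 ∈ spaceSp 𝓕 P p d := by
    refine (mem_spaceSp_iff hp1).2 ⟨sub_mem_spaceS hYS (hS 0), ?_⟩
    filter_upwards [key 0, hsum] with ω h1 h2
    simp only [zero_add] at h1
    exact h1.trans_lt h2
  have e : Y = (Y - X 0) - (0 - X 0) := by abel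
  rw [e]
  exact sub_mem_spaceSp hp1 h0 (sub_mem_spaceSp hp1 (zero_mem_spaceSp hp1) (hX 0))

/-- Limits, in conditional norm, of generalized martingales are generalized martingales. -/
theorem isGenMartingale_of_tendsto (hp1 : 1 ≤ p) {X : ℕ → Proc T P d} {Y : Proc T P d}
    (hX : ∀ n, X n ∈ spaceSp 𝓕 P p d) (hM : ∀ n, IsGenMartingale 𝓕 P (X n))
    (hY : Y ∈ spaceSp 𝓕 P p d) (hbd : ∀ᵐ ω ∂P, ⨆ n, procNorm 𝓕 P p (Y - X n) ω < ∞)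
    (hlim : ∀ᵐ ω ∂P, Tendsto (fun n => procNorm 𝓕 P p (Y - X n) ω) atTop (𝓝 0)) :
    IsGenMartingale 𝓕 P Y := by
  obtain ⟨hYS, hYN⟩ := (mem_spaceSp_iff hp1).1 hY
  have hXS := fun n => ((mem_spaceSp_iff hp1).1 (hX n)).1
  -- One exhausting sequence serves all n: on `B k` the norms of Y and of all Y - `X n` are at most
  -- k. Dominated convergence then turns a.s. convergence of the norms into L¹ convergence on `B k`.
  obtain ⟨B, hmono, hB, hBu, hBn⟩ := exists_levels (P := P) (m := 𝓕 ⊥)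
    (h := fun ω => procNorm 𝓕 P p Y ω + ⨆ n, procNorm 𝓕 P p (Y - X n) ω)
    (Measurable.add (measurable_procNorm Y) (Measurable.iSup fun n => measurable_procNorm _))
    (by filter_upwards [hYN, hbd] with ω h1 h2 using ENNReal.add_lt_top.2 ⟨h1, h2⟩)
  refine isGenMartingale_of_martOn hYS hmono hB hBu fun k => ?_
  have hBm := 𝓕.le ⊥ _ (hB k)
  have hYi : ∀ t, IntegrableOn (Y t) (B k) P :=
    integrableOn_of_procNorm_le hp1 hYS (hB k) (c := k) (by simp) (by
      filter_upwards [hBn k] with ω h1 h2 using le_self_add.trans (h1 h2))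
  have hXi : ∀ n t, IntegrableOn (X n t) (B k) P := fun n =>
    integrableOn_of_procNorm_le hp1 (hXS n) (hB k) (c := k) (by simp) (by
      filter_upwards [hBn k, procNorm_sub_le hp1 hYS (sub_mem_spaceS hYS (hXS n))] with ω h1 h2 h3
      rw [sub_sub_cancel] at h2
      exact h2.trans ((add_le_add_right (le_iSup (fun n => procNorm 𝓕 P p (Y - X n) ω) n) _).trans
        (h1 h3)))
  have hL1 : ∀ t, Tendsto (fun n => ∫⁻ ω, ‖(B k).indicator (X n t) ω - (B k).indicator (Y t) ω‖ₑ ∂P)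
      atTop (𝓝 0) := by
    intro t
    have hdom : Tendsto (fun n => 2 * ∫⁻ ω in B k, procNorm 𝓕 P p (Y - X n) ω ∂P) atTop
        (𝓝 (2 * ∫⁻ ω in B k, 0 ∂P)) := by
      refine ENNReal.Tendsto.const_mul ?_ (Or.inr (by simp))
      refine tendsto_lintegral_of_dominated_convergence (fun _ => (k : ℝ≥0∞))
        (fun n => (measurable_procNorm _).mono (𝓕.le ⊥) le_rfl) (fun n => ?_) ?_
        (ae_restrict_of_ae hlim)
      · refine (ae_restrict_iff' hBm).2 ?_
        filter_upwards [hBn k] with ω h1 h2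
        exact (le_iSup (fun n => procNorm 𝓕 P p (Y - X n) ω) n).trans
          (le_add_self.trans (h1 h2))
      · rw [setLIntegral_const]
        exact ENNReal.mul_ne_top (by simp) (measure_ne_top _ _)
    simp only [lintegral_zero, mul_zero] at hdom
    refine tendsto_of_tendsto_of_tendsto_of_le_of_le tendsto_const_nhds hdom
      (fun _ => zero_le) fun n => ?_
    calc ∫⁻ ω, ‖(B k).indicator (X n t) ω - (B k).indicator (Y t) ω‖ₑ ∂P
        ≤ ∫⁻ ω in B k, seqSup (Y - X n) ω ∂P := by
          rw [← lintegral_indicator hBm]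
          refine lintegral_mono_ae ?_
          filter_upwards [enorm_le_seqSup (sub_mem_spaceS hYS (hXS n)) t,
            AEEqFun.coeFn_sub (Y t) (X n t)] with ω h1 h2
          by_cases hω : ω ∈ B k
          · simp only [Set.indicator_of_mem hω]
            rw [Pi.sub_apply, h2, Pi.sub_apply, ← edist_eq_enorm_sub, edist_comm,
              edist_eq_enorm_sub] at h1
            exact h1
          · simp [Set.indicator_of_notMem hω]
      _ ≤ 2 * ∫⁻ ω in B k, condNorm (𝓕.le ⊥) P p (seqSup (Y - X n)) ω ∂P :=
          setLIntegral_le_two_mul_condNorm (𝓕.le ⊥) hp1 (measurable_seqSup _).aemeasurable (hB k)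
      _ = 2 * ∫⁻ ω in B k, procNorm 𝓕 P p (Y - X n) ω ∂P := by
          rw [lintegral_congr_ae (ae_restrict_of_ae
            (procNorm_ae_eq hp1 (sub_mem_spaceS hYS (hXS n))))]
  have hXint : ∀ n t, Integrable ((B k).indicator (X n t)) P := fun n t =>
    (integrable_indicator_iff hBm).2 (hXi n t)
  have hYint : ∀ t, Integrable ((B k).indicator (Y t)) P := fun t =>
    (integrable_indicator_iff hBm).2 (hYi t)
  have hmart : ∀ n, MartOn 𝓕 P (B k) (X n) := fun n => (hM n).martOn (hXS n) (hB k) (hXi n)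
  refine ⟨hYi, fun s t hst => ?_⟩
  refine (ae_eq_condExp_of_forall_setIntegral_eq (𝓕.le s) (hYint t)
    (fun A _ _ => (hYint s).integrableOn) (fun A hA _ => ?_)
    (aestronglyMeasurable_indicator_of_bot (aestronglyMeasurable_of_mem_spaceS hYS s) (hB k))).symm
  have hconv : ∀ u, Tendsto (fun n => ∫ ω in A, (B k).indicator (X n u) ω ∂P) atTop
      (𝓝 (∫ ω in A, (B k).indicator (Y u) ω ∂P)) := fun u =>
    tendsto_setIntegral_of_L1 _ (hYint u).aestronglyMeasurable
      (Eventually.of_forall fun n => hXint n u) (hL1 u) A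
  refine tendsto_nhds_unique (hconv s) ((hconv t).congr fun n => ?_)
  rw [← setIntegral_condExp (𝓕.le s) (hXint n t) hA]
  exact integral_congr_ae (ae_restrict_of_ae ((hmart n).2 s t hst))

/-- Completeness of the space of generalized martingales in `S^p`. -/
theorem exists_genMartingale_limit (h𝓕 : UsualConditions 𝓕 P) (hp1 : 1 ≤ p) {X : ℕ → Proc T P d}
    (hX : ∀ n, X n ∈ spaceSp 𝓕 P p d) (hM : ∀ n, IsGenMartingale 𝓕 P (X n))
    (hsum : ∀ᵐ ω ∂P, ∑' n, procNorm 𝓕 P p (X (n + 1) - X n) ω < ∞) :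
    ∃ Y ∈ spaceSp 𝓕 P p d, IsGenMartingale 𝓕 P Y ∧
      ∀ᵐ ω ∂P, Tendsto (fun n => procNorm 𝓕 P p (Y - X n) ω) atTop (𝓝 0) := by
  obtain ⟨Y, hY, hlim⟩ := exists_spaceSp_limit h𝓕 hp1 hX hsum
  have hlim' := ae_all_iff.2 hlim
  have h0 : ∀ᵐ ω ∂P, Tendsto (fun n => procNorm 𝓕 P p (Y - X n) ω) atTop (𝓝 0) := by
    filter_upwards [hlim', hsum] with ω h1 h2
    have h3 := ENNReal.tendsto_sum_nat_add
      (fun n => procNorm 𝓕 P p (X (n + 1) - X n) ω) h2.ne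
    refine tendsto_of_tendsto_of_tendsto_of_le_of_le tendsto_const_nhds h3
      (fun _ => zero_le) fun n => (h1 n).trans_eq ?_
    simp only [add_comm n]
  refine ⟨Y, hY, isGenMartingale_of_tendsto hp1 hX hM hY ?_ h0, h0⟩
  filter_upwards [hlim', hsum] with ω h1 h2
  refine (iSup_le fun n => (h1 n).trans ?_).trans_lt h2
  exact ENNReal.tsum_comp_le_tsum_of_injective (add_right_injective n)
    fun k => procNorm 𝓕 P p (X (k + 1) - X k) ω

end Completeness

/-! ### Multiplication by F_0-measurable random variables -/

section Scaling

variable {T : ℝ≥0} {Ω : Type*} {mΩ : MeasurableSpace Ω} {P : Measure Ω}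
  {d : ℕ} {𝓕 : Filtration (TimeSet T) mΩ} {p : ℝ≥0∞} {η : Ω → ℝ} {X : Proc T P d}

/-- The product of a process with a real random variable. -/
noncomputable def scaleProc (η : Ω → ℝ) (hη : Measurable η) (X : Proc T P d) : Proc T P d :=
  fun t => AEEqFun.mk (fun ω => η ω • X t ω)
    (hη.stronglyMeasurable.aestronglyMeasurable.smul (X t).aestronglyMeasurable)

theorem scaleProc_ae_eq (hη : Measurable η) (t : TimeSet T) :
    scaleProc η hη X t =ᵐ[P] fun ω => η ω • X t ω :=
  AEEqFun.coeFn_mk _ _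

theorem scaleProc_mem_spaceS (hη : Measurable[𝓕 ⊥] η) (hX : X ∈ spaceS 𝓕 P d) :
    scaleProc η (hη.mono (𝓕.le ⊥) le_rfl) X ∈ spaceS 𝓕 P d := by
  obtain ⟨x, hx⟩ := hX
  refine ⟨fun t ω => η ω • x t ω, fun t => ?_, fun ω => (hx.rcll ω).const_smul _, fun t => ?_⟩
  · exact (hη.mono (𝓕.mono bot_le) le_rfl).stronglyMeasurable.smul (hx.adapted t)
  · filter_upwards [scaleProc_ae_eq (hη.mono (𝓕.le ⊥) le_rfl) t, hx.version t] with ω h1 h2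
    rw [h1, h2]

theorem seqSup_scaleProc (hη : Measurable η) (X : Proc T P d) :
    ∀ᵐ ω ∂P, seqSup (scaleProc η hη X) ω = ‖η ω‖ₑ * seqSup X ω := by
  filter_upwards [ae_all_iff.2 fun k => scaleProc_ae_eq (X := X) hη (timeSeq T k)] with ω h1
  simp only [seqSup, h1, enorm_smul, ENNReal.mul_iSup]

variable [IsProbabilityMeasure P]

theorem scaleProc_mem_spaceSp (hp1 : 1 ≤ p) (hη : Measurable[𝓕 ⊥] η) (hX : X ∈ spaceSp 𝓕 P p d) :
    scaleProc η (hη.mono (𝓕.le ⊥) le_rfl) X ∈ spaceSp 𝓕 P p d := by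
  obtain ⟨hS, hN⟩ := (mem_spaceSp_iff hp1).1 hX
  have hS' := scaleProc_mem_spaceS hη hS
  refine (mem_spaceSp_iff hp1).2 ⟨hS', ?_⟩
  filter_upwards [procNorm_le_condNorm hp1 hS'
      ((seqSup_scaleProc (hη.mono (𝓕.le ⊥) le_rfl) X).mono fun ω h => h.le),
    condNorm_mul_le (p := p) (𝓕.le ⊥) hp1 (g := fun ω => ‖η ω‖ₑ) (measurable_enorm.comp hη)
      (measurable_seqSup X).aemeasurable, procNorm_ae_eq hp1 hS, hN] with ω h1 h2 h3 h4
  refine (h1.trans h2).trans_lt (ENNReal.mul_lt_top enorm_lt_top ?_)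
  rwa [← h3]

/-- η comes out of conditional expectations given F_s. The levels are chosen to bound η as well,
which keeps the products integrable. -/
theorem IsGenMartingale.scaleProc (hp1 : 1 ≤ p) (hη : Measurable[𝓕 ⊥] η)
    (hX : X ∈ spaceSp 𝓕 P p d) (hM : IsGenMartingale 𝓕 P X) :
    IsGenMartingale 𝓕 P (scaleProc η (hη.mono (𝓕.le ⊥) le_rfl) X) := by
  obtain ⟨hS, hN⟩ := (mem_spaceSp_iff hp1).1 hX
  have hη' : Measurable η := hη.mono (𝓕.le ⊥) le_rfl
  obtain ⟨B, h1, h2, h3, h4, h5⟩ := hM.exists_martOn hp1 hX (h := fun ω => ‖η ω‖ₑ) (measurable_enorm.comp hη)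
    (Eventually.of_forall fun ω => enorm_lt_top)
  refine isGenMartingale_of_martOn (scaleProc_mem_spaceS hη hS) h1 h2 h3 fun n => ?_
  have hBm := 𝓕.le ⊥ _ (h2 n)
  have e : ∀ t, (B n).indicator (RandomBSE.scaleProc η hη' X t) =ᵐ[P]
      η • (B n).indicator (X t) := by
    intro t
    filter_upwards [scaleProc_ae_eq (X := X) hη' t] with ω hω
    by_cases h : ω ∈ B n <;> simp [h, hω]
  have hXi : ∀ t, Integrable ((B n).indicator (X t)) P := fun t =>
    (integrable_indicator_iff hBm).2 ((h4 n).1 t)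
  have hi : ∀ t, Integrable (η • (B n).indicator (X t)) P := by
    intro t
    refine ((hXi t).norm.const_mul n).mono'
      (hη'.stronglyMeasurable.aestronglyMeasurable.smul (hXi t).aestronglyMeasurable) ?_
    filter_upwards [h5 n] with ω hω
    rw [Pi.smul_apply', norm_smul]
    by_cases h : ω ∈ B n
    · gcongr
      have := le_add_self.trans (hω h)
      rw [← ofReal_norm, ← ENNReal.ofReal_natCast] at this
      exact (ENNReal.ofReal_le_ofReal_iff (Nat.cast_nonneg n)).1 this
    · simp [h]
  refine ⟨fun t => (integrable_indicator_iff hBm).1 ((hi t).congr (e t).symm), fun s t hst => ?_⟩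
  have h6 := condExp_smul_of_aestronglyMeasurable_left (m := 𝓕 s)
    (hη.mono (𝓕.mono bot_le) le_rfl).stronglyMeasurable.aestronglyMeasurable (hi t) (hXi t)
  filter_upwards [condExp_congr_ae (m := 𝓕 s) (e t), h6, (h4 n).2 s t hst, e s] with ω a1 a2 a3 a4
  rw [a1, a2, a4, Pi.smul_apply', Pi.smul_apply', a3]

end Scaling

/-! ### RCLL martingales with a prescribed terminal value -/

section MartingaleClosure

variable {T : ℝ≥0} {Ω : Type*} {mΩ : MeasurableSpace Ω} {P : Measure Ω} [IsProbabilityMeasure P]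
  {d : ℕ} {𝓕 : Filtration (TimeSet T) mΩ} {p : ℝ≥0∞}

/-- A bounded random vector closes a martingale in `S^p`. -/
theorem exists_genMartingale_of_bounded (h𝓕 : UsualConditions 𝓕 P) (hp1 : 1 ≤ p)
    {V : Ω → EuclideanSpace ℝ (Fin d)} {c : ℝ} (hV : StronglyMeasurable[𝓕 ⊤] V)
    (hc : ∀ ω, ‖V ω‖ ≤ c) :
    ∃ K ∈ spaceSp 𝓕 P p d, IsGenMartingale 𝓕 P K ∧ K ⊤ =ᵐ[P] V := by
  obtain ⟨X, hX, hM, hXc, hXV⟩ := exists_rcll_condExp h𝓕 hV hc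
  have hsup : seqSup X ≤ᵐ[P] fun _ => ENNReal.ofReal c := by
    filter_upwards [ae_all_iff.2 fun n => hXc (timeSeq T n)] with ω hω
    refine iSup_le fun n => ?_
    rw [← ofReal_norm]
    exact ENNReal.ofReal_le_ofReal (hω n)
  refine ⟨X, (mem_spaceSp_iff hp1).2 ⟨hX, ?_⟩, ?_, hXV⟩
  · filter_upwards [procNorm_le_condNorm hp1 hX hsup,
      condNorm_le_of_le (p := p) (𝓕.le ⊥) hp1 (R := fun _ => ENNReal.ofReal c)
        (N := fun _ => ENNReal.ofReal c) measurable_const (Eventually.of_forall fun _ => le_rfl)] with ω h1 h2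
    exact (h1.trans h2).trans_lt ENNReal.ofReal_lt_top
  · exact isGenMartingale_of_martOn hX (B := fun _ => Set.univ) monotone_const
      (fun _ => MeasurableSet.univ) (Set.iUnion_const _) fun _ => hM

omit [IsProbabilityMeasure P] in
theorem doobConst_ne_top (p : ℝ≥0∞) : doobConst p ≠ ∞ := by
  unfold doobConst
  split_ifs <;> simp

/-- A random vector with conditional norm at most `1` closes a generalized martingale in `S^p`. -/
theorem exists_genMartingale_of_condNorm_le_one (h𝓕 : UsualConditions 𝓕 P) (hp : 1 < p)
    {V : Ω → EuclideanSpace ℝ (Fin d)} (hV : StronglyMeasurable[𝓕 ⊤] V)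
    (hN : ∀ᵐ ω ∂P, condNorm (𝓕.le ⊥) P p (fun ω => ‖V ω‖ₑ) ω ≤ 1) :
    ∃ K ∈ spaceSp 𝓕 P p d, IsGenMartingale 𝓕 P K ∧ K ⊤ =ᵐ[P] V := by
  have hp1 := hp.le
  have hVm : StronglyMeasurable V := hV.mono (𝓕.le ⊤)
  by_cases hpt : p = ∞
  · subst hpt
    have hle : ∀ᵐ ω ∂P, ‖V ω‖ ≤ 1 := by
      filter_upwards [hN, (condNorm_top (P := P) (𝓕.le ⊥) fun ω => ‖V ω‖ₑ).2.1] with ω h1 h2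
      have := h2.trans h1
      rwa [← ofReal_norm, ENNReal.ofReal_le_one] at this
    obtain ⟨K, h1, h2, h3⟩ := exists_genMartingale_of_bounded (p := ∞) h𝓕 hp1
      (V := {ω | ‖V ω‖ ≤ 1}.indicator V) (c := 1)
      (hV.indicator (hV.norm.measurableSet_le stronglyMeasurable_const)) (fun ω => by
        by_cases h : ‖V ω‖ ≤ 1
        · simp [h]
        · simp [h])
    refine ⟨K, h1, h2, h3.trans ?_⟩
    filter_upwards [hle] with ω hω
    exact Set.indicator_of_mem (s := {ω | ‖V ω‖ ≤ 1}) hω _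
  have hp0 : p ≠ 0 := (zero_lt_one.trans hp).ne'
  have hrpos : 0 < p.toReal := toReal_pos_of_one_le hp1 hpt
  have hint : ∀ R : Ω → ℝ≥0∞, ∫⁻ ω, condNorm (𝓕.le ⊥) P p R ω ^ p.toReal ∂P =
      ∫⁻ ω, R ω ^ p.toReal ∂P := by
    intro R
    simpa only [Measure.restrict_univ] using
      setLIntegral_condNorm_rpow (P := P) (𝓕.le ⊥) hp1 hpt R MeasurableSet.univ
  have hVp : MemLp V p (P.trim (𝓕.le ⊤)) := by
    refine ⟨hV.aestronglyMeasurable, ?_⟩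
    rw [eLpNorm_trim (𝓕.le ⊤) hV, eLpNorm_eq_lintegral_rpow_enorm_toReal hp0 hpt,
      ← hint fun ω => ‖V ω‖ₑ]
    refine ENNReal.rpow_lt_top_of_nonneg (by positivity) ?_
    refine ne_top_of_le_ne_top ENNReal.one_ne_top ?_
    calc ∫⁻ ω, condNorm (𝓕.le ⊥) P p (fun ω => ‖V ω‖ₑ) ω ^ p.toReal ∂P ≤ ∫⁻ ω, 1 ∂P := by
          refine lintegral_mono_ae ?_
          filter_upwards [hN] with ω hω
          exact ENNReal.rpow_le_one hω hrpos.le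
      _ = 1 := by simp
  -- Working with the measure trimmed to F_T makes the simple functions F_T-measurable. The
  -- conditional norms `N n` of the errors have expectation at most 2^(-n), hence are a.s. summable,
  -- and Doob's inequality makes the increments of the closing martingales summable too.
  choose g hg hgm using fun n : ℕ => @MemLp.exists_simpleFunc_eLpNorm_sub_lt Ω (𝓕 ⊤) p _ _ V
    (P.trim (𝓕.le ⊤)) hVp hpt ((2⁻¹ : ℝ≥0∞) ^ n) (pow_ne_zero _ (by simp))
  have hgs : ∀ n, StronglyMeasurable[𝓕 ⊤] (g n) := fun n =>
    @SimpleFunc.stronglyMeasurable _ _ (𝓕 ⊤) _ (g n)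
  have hb : ∀ n, ∃ c, ∀ ω, ‖g n ω‖ ≤ c := fun n => @SimpleFunc.exists_forall_norm_le _ _ (𝓕 ⊤) _ (g n)
  choose c hc using hb
  choose K hK hKM hKg using fun n => exists_genMartingale_of_bounded h𝓕 hp1 (hgs n) (hc n)
  have hKS := fun n => ((mem_spaceSp_iff hp1).1 (hK n)).1
  let N : ℕ → Ω → ℝ≥0∞ := fun n => condNorm (𝓕.le ⊥) P p fun ω => ‖V ω - g n ω‖ₑ
  have hNm : ∀ n, Measurable (N n) := fun n => measurable_condNorm' _ _ _
  have hVg : ∀ n, AEMeasurable (fun ω => ‖V ω - g n ω‖ₑ) P := fun n =>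
    (hVm.sub ((hgs n).mono (𝓕.le ⊤))).measurable.enorm.aemeasurable
  have hNle : ∀ n, ∫⁻ ω, N n ω ∂P ≤ (2⁻¹ : ℝ≥0∞) ^ n := by
    intro n
    refine le_trans ?_ (hg n).le
    rw [eLpNorm_trim (𝓕.le ⊤) (hV.sub (hgs n)), eLpNorm_eq_lintegral_rpow_enorm_toReal hp0 hpt]
    have h1 := eLpNorm_le_eLpNorm_of_exponent_le (μ := P) hp1 (hNm n).aestronglyMeasurable
    rw [eLpNorm_one_eq_lintegral_enorm, eLpNorm_eq_lintegral_rpow_enorm_toReal hp0 hpt] at h1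
    simp only [enorm_eq_self] at h1
    rw [hint] at h1
    exact h1
  have hNsum : ∀ᵐ ω ∂P, ∑' n, N n ω < ∞ := by
    refine ae_lt_top (Measurable.tsum hNm) ?_
    rw [lintegral_tsum fun n => (hNm n).aemeasurable]
    refine ne_top_of_le_ne_top ?_ (ENNReal.tsum_le_tsum hNle)
    rw [ENNReal.tsum_geometric, ENNReal.one_sub_inv_two, inv_inv]
    exact ENNReal.ofNat_ne_top
  have hstep : ∀ n, ∀ᵐ ω ∂P,
      procNorm 𝓕 P p (K (n + 1) - K n) ω ≤ doobConst p * (N (n + 1) ω + N n ω) := by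
    intro n
    have hle : (fun ω => ‖(K (n + 1) - K n) ⊤ ω‖ₑ) ≤ᵐ[P]
        fun ω => ‖V ω - g (n + 1) ω‖ₑ + ‖V ω - g n ω‖ₑ := by
      filter_upwards [AEEqFun.coeFn_sub (K (n + 1) ⊤) (K n ⊤), hKg (n + 1), hKg n] with ω h1 h2 h3
      rw [Pi.sub_apply, h1, Pi.sub_apply, h2, h3,
        show g (n + 1) ω - g n ω = (V ω - g n ω) - (V ω - g (n + 1) ω) by abel]
      exact enorm_sub_le.trans_eq (add_comm _ _)
    filter_upwards [((hKM (n + 1)).sub hp1 (hK _) (hK _) (hKM n)).procNorm_le hp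
      (sub_mem_spaceSp hp1 (hK _) (hK _)), condNorm_mono (p := p) (𝓕.le ⊥) hp1 hle,
      condNorm_add_le (p := p) (𝓕.le ⊥) hp1 (hVg (n + 1)) (hVg n)] with ω h1 h2 h3
    exact h1.trans (mul_le_mul_right (h2.trans h3) _)
  obtain ⟨Y, hY, hYM, hlim⟩ := exists_genMartingale_limit h𝓕 hp1 hK hKM (by
    filter_upwards [ae_all_iff.2 hstep, hNsum] with ω h1 h2
    refine (ENNReal.tsum_le_tsum h1).trans_lt ?_
    rw [ENNReal.tsum_mul_left, ENNReal.tsum_add]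
    refine ENNReal.mul_lt_top (doobConst_ne_top p).lt_top (ENNReal.add_lt_top.2 ⟨?_, h2⟩)
    exact (ENNReal.tsum_comp_le_tsum_of_injective (add_left_injective 1) fun n => N n ω).trans_lt h2)
  have hYS := ((mem_spaceSp_iff hp1).1 hY).1
  refine ⟨Y, hY, hYM, ?_⟩
  -- The limit's terminal value is compared with V through `g n`; the left side does not depend on n
  -- and the right side tends to 0.
  have hterm : ∀ n, ∀ᵐ ω ∂P, condNorm (𝓕.le ⊥) P p (fun ω => ‖Y ⊤ ω - V ω‖ₑ) ω ≤
      procNorm 𝓕 P p (Y - K n) ω + N n ω := by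
    intro n
    have hle : (fun ω => ‖Y ⊤ ω - V ω‖ₑ) ≤ᵐ[P]
        fun ω => seqSup (Y - K n) ω + ‖V ω - g n ω‖ₑ := by
      filter_upwards [AEEqFun.coeFn_sub (Y ⊤) (K n ⊤), hKg n,
        enorm_le_seqSup (sub_mem_spaceS hYS (hKS n)) ⊤] with ω h1 h2 h3
      rw [Pi.sub_apply, h1, Pi.sub_apply, h2] at h3
      rw [show Y ⊤ ω - V ω = (Y ⊤ ω - g n ω) - (V ω - g n ω) by abel]
      exact enorm_sub_le.trans (add_le_add_left h3 _)
    filter_upwards [condNorm_mono (p := p) (𝓕.le ⊥) hp1 hle,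
      condNorm_add_le (p := p) (𝓕.le ⊥) hp1 (measurable_seqSup (Y - K n)).aemeasurable (hVg n),
      procNorm_ae_eq hp1 (sub_mem_spaceS hYS (hKS n))] with ω h1 h2 h3
    rw [h3]
    exact h1.trans h2
  have hz := ae_eq_zero_of_condNorm_eq_zero (p := p) (P := P) (𝓕.le ⊥) hp1
    (R := fun ω => ‖Y ⊤ ω - V ω‖ₑ)
    (((Y ⊤).stronglyMeasurable.sub hVm).measurable.enorm.aemeasurable) (by
      filter_upwards [ae_all_iff.2 hterm, hlim, hNsum] with ω h1 h2 h3
      have h4 := h2.add (ENNReal.tendsto_atTop_zero_of_tsum_ne_top h3.ne)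
      rw [add_zero] at h4
      exact le_antisymm (ge_of_tendsto' h4 h1) zero_le)
  filter_upwards [hz] with ω hω
  exact sub_eq_zero.1 (enorm_eq_zero.1 hω)

/-- A random vector with a.s. finite conditional norm closes a generalized martingale in `S^p`. -/
theorem exists_genMartingale (h𝓕 : UsualConditions 𝓕 P) (hp : 1 < p)
    {V : Ω → EuclideanSpace ℝ (Fin d)} (hV : AEStronglyMeasurable[𝓕 ⊤] V P)
    (hN : ∀ᵐ ω ∂P, condNorm (𝓕.le ⊥) P p (fun ω => ‖V ω‖ₑ) ω < ∞) :
    ∃ K ∈ spaceSp 𝓕 P p d, IsGenMartingale 𝓕 P K ∧ K ⊤ =ᵐ[P] V := by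
  have hp1 := hp.le
  obtain ⟨W, hW, hVW⟩ := hV
  have hN' : ∀ᵐ ω ∂P, condNorm (𝓕.le ⊥) P p (fun ω => ‖W ω‖ₑ) ω < ∞ := by
    filter_upwards [hN, condNorm_congr (p := p) (𝓕.le ⊥) hp1
      (hVW.mono fun ω h => show ‖V ω‖ₑ = ‖W ω‖ₑ by rw [h])] with ω h1 h2
    rwa [← h2]
  -- Dividing by η brings the conditional norm down to at most 1; the summand 1 keeps the divisor
  -- positive.
  let η : Ω → ℝ := fun ω => 1 + (condNorm (𝓕.le ⊥) P p (fun ω => ‖W ω‖ₑ) ω).toReal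
  have hη : Measurable[𝓕 ⊥] η := Measurable.const_add
    (ENNReal.measurable_toReal.comp (measurable_condNorm _ _ _)) 1
  have hηpos : ∀ ω, 0 < η ω := fun ω => by positivity
  have hinv : Measurable[𝓕 ⊥] fun ω => (η ω)⁻¹ := Measurable.inv hη
  obtain ⟨K, hK, hKM, hKW⟩ := exists_genMartingale_of_condNorm_le_one h𝓕 hp
    (V := fun ω => (η ω)⁻¹ • W ω)
    ((hinv.mono (𝓕.mono bot_le) le_rfl).stronglyMeasurable.smul hW) (by
      filter_upwards [hN', condNorm_mul_le (p := p) (P := P) (𝓕.le ⊥) hp1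
        (g := fun ω => ‖(η ω)⁻¹‖ₑ) (R := fun ω => ‖W ω‖ₑ) (measurable_enorm.comp hinv)
        (hW.mono (𝓕.le ⊤)).measurable.enorm.aemeasurable] with ω h1 h2
      simp only [enorm_smul]
      refine h2.trans ?_
      rw [← ENNReal.ofReal_toReal h1.ne, ← ofReal_norm, norm_inv, Real.norm_of_nonneg (hηpos ω).le,
        ← ENNReal.ofReal_mul (by have := hηpos ω; positivity), ENNReal.ofReal_le_one,
        inv_mul_le_one₀ (hηpos ω)]
      simp [η])
  refine ⟨_, scaleProc_mem_spaceSp hp1 hη hK, hKM.scaleProc hp1 hη hK, ?_⟩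
  filter_upwards [scaleProc_ae_eq (X := K) (hη.mono (𝓕.le ⊥) le_rfl) ⊤, hKW, hVW] with ω h1 h2 h3
  rw [h1, h2, h3, smul_smul, mul_inv_cancel₀ (hηpos ω).ne', one_smul]

/-- The conditional norm of the elements of `L^p_{F_0}(F_T)` is a.s. finite. -/
theorem condNorm_lt_top_of_mem_spaceLp (hp1 : 1 ≤ p) {V : Ω →ₘ[P] EuclideanSpace ℝ (Fin d)}
    (hV : V ∈ spaceLp 𝓕 P p d) :
    ∀ᵐ ω ∂P, condNorm (𝓕.le ⊥) P p (fun ω => ‖V ω‖ₑ) ω < ∞ := by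
  obtain ⟨η, x, hη, hx, hxp, hVx⟩ := hV
  have hxN : ∀ᵐ ω ∂P, condNorm (𝓕.le ⊥) P p (fun ω => ‖x ω‖ₑ) ω < ∞ := by
    by_cases hpt : p = ∞
    · subst hpt
      have h1 := hxp.2
      rw [eLpNorm_exponent_top] at h1
      filter_upwards [condNorm_le_of_le (P := P) (𝓕.le ⊥) hp1 (R := fun ω => ‖x ω‖ₑ)
        (N := fun _ => eLpNormEssSup x P) measurable_const (enorm_ae_le_eLpNormEssSup x P)]
        with ω hω
      exact hω.trans_lt h1
    · refine condNorm_lt_top_of_lintegral_lt_top (𝓕.le ⊥) hpt ?_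
      exact (lintegral_rpow_enorm_lt_top_of_eLpNorm_lt_top
        (zero_lt_one.trans_le hp1).ne' hpt hxp.2).ne
  filter_upwards [hxN, condNorm_mul_le (p := p) (P := P) (𝓕.le ⊥) hp1
      (g := fun ω => ‖η ω‖ₑ) (R := fun ω => ‖x ω‖ₑ) (measurable_enorm.comp hη)
      (hx.mono (𝓕.le ⊤)).measurable.enorm.aemeasurable,
    condNorm_congr (p := p) (P := P) (𝓕.le ⊥) hp1
      (hVx.mono fun ω h => show ‖V ω‖ₑ = ‖η ω‖ₑ * ‖x ω‖ₑ by rw [h, enorm_smul])] with ω h1 h2 h3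
  rw [h3]
  exact h2.trans_lt (ENNReal.mul_lt_top enorm_lt_top h1)

end MartingaleClosure

/-! ### A fixed point theorem with a random contraction factor -/

section RandomContraction

theorem ennreal_eq_zero_of_le_mul_self {θ x : ℝ≥0∞} (hθ : θ < 1) (hx : x < ∞) (h : x ≤ θ * x) :
    x = 0 := by
  by_contra h0
  have := (ENNReal.mul_lt_mul_iff_left h0 hx.ne).2 hθ
  rw [one_mul] at this
  exact absurd h (not_le.2 this)

variable {Ω : Type*} {mΩ : MeasurableSpace Ω} {P : Measure Ω}

/-- Banach's fixed point theorem for a distance with values in the random variables and a random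
contraction factor. -/
theorem existsUnique_fixedPoint_of_random_contraction {A : Type*} [Nonempty A]
    (e : A → A → Ω → ℝ≥0∞) (hsymm : ∀ x y, ∀ᵐ ω ∂P, e x y ω = e y x ω)
    (htri : ∀ x y z, ∀ᵐ ω ∂P, e x z ω ≤ e x y ω + e y z ω)
    (hfin : ∀ x y, ∀ᵐ ω ∂P, e x y ω < ∞) (hsep : ∀ x y, (∀ᵐ ω ∂P, e x y ω = 0) → x = y)
    (hcomp : ∀ x : ℕ → A, (∀ᵐ ω ∂P, ∑' n, e (x (n + 1)) (x n) ω < ∞) →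
      ∃ y, ∀ᵐ ω ∂P, Tendsto (fun n => e y (x n) ω) atTop (𝓝 0))
    {Φ : A → A} {θ : Ω → ℝ≥0∞} (hθ : ∀ᵐ ω ∂P, θ ω < 1)
    (hΦ : ∀ x y, ∀ᵐ ω ∂P, e (Φ x) (Φ y) ω ≤ θ ω * e x y ω) : ∃! x, Φ x = x := by
  obtain ⟨a⟩ := ‹Nonempty A›
  let x : ℕ → A := fun n => Φ^[n] a
  have hx : ∀ n, x (n + 1) = Φ (x n) := fun n => Function.iterate_succ_apply' Φ n a
  -- θ may come arbitrarily close to 1, so the geometric series is summed separately for each ω;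
  -- only countably many null sets are discarded.
  have hgeom : ∀ n, ∀ᵐ ω ∂P, e (x (n + 1)) (x n) ω ≤ θ ω ^ n * e (x 1) (x 0) ω := by
    intro n
    induction n with
    | zero => exact Eventually.of_forall fun ω => by simp
    | succ n ih =>
      filter_upwards [ih, hΦ (x (n + 1)) (x n)] with ω h1 h2
      rw [hx (n + 1)]
      nth_rewrite 2 [hx n]
      refine h2.trans ?_
      rw [pow_succ', mul_assoc]
      exact mul_le_mul_right h1 _
  obtain ⟨y, hy⟩ := hcomp x (by
    filter_upwards [ae_all_iff.2 hgeom, hθ, hfin (x 1) (x 0)] with ω h1 h2 h3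
    refine (ENNReal.tsum_le_tsum h1).trans_lt ?_
    rw [ENNReal.tsum_mul_right, ENNReal.tsum_geometric]
    exact ENNReal.mul_lt_top (ENNReal.inv_lt_top.2 (tsub_pos_of_lt h2)) h3)
  have hyy : Φ y = y := hsep _ _ (by
    filter_upwards [hy, hθ, ae_all_iff.2 fun n => htri (Φ y) (x (n + 1)) y,
      ae_all_iff.2 fun n => hΦ y (x n), ae_all_iff.2 fun n => hsymm (x (n + 1)) y]
      with ω h1 h2 h3 h4 h5
    have hb : ∀ n, e (Φ y) y ω ≤ θ ω * e y (x n) ω + e y (x (n + 1)) ω := by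
      intro n
      refine (h3 n).trans ?_
      rw [h5 n]
      refine add_le_add_left ?_ _
      rw [hx n]
      exact h4 n
    have hl := (ENNReal.Tendsto.const_mul (a := θ ω) h1 (Or.inr h2.ne_top)).add
      (h1.comp (tendsto_add_atTop_nat 1))
    rw [mul_zero, add_zero] at hl
    exact le_antisymm (ge_of_tendsto' hl hb) zero_le)
  refine ⟨y, hyy, fun z hz => hsep _ _ ?_⟩
  filter_upwards [hΦ z y, hθ, hfin z y] with ω h1 h2 h3
  rw [hz, hyy] at h1
  exact ennreal_eq_zero_of_le_mul_self h2 h3 h1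

end RandomContraction

/-! ### Concatenation along the events {L = k} and the random iterates -/

section Concatenation

theorem measurable_apply_nat {Ω E : Type*} [MeasurableSpace E] {m : MeasurableSpace Ω} {L : Ω → ℕ}
    (hL : Measurable L) {x : ℕ → Ω → E} (hx : ∀ k, Measurable (x k)) :
    Measurable fun ω => x (L ω) ω :=
  (measurable_from_prod_countable_right (f := fun q : ℕ × Ω => x q.1 q.2) hx).comp
    (hL.prodMk measurable_id)

variable {T : ℝ≥0} {Ω : Type*} {mΩ : MeasurableSpace Ω} {P : Measure Ω} [IsProbabilityMeasure P]
  {d : ℕ} {𝓕 : Filtration (TimeSet T) mΩ} {p : ℝ≥0∞}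

/-- Concatenations of processes in `S^p` along a countable partition in `F_0` are in `S^p`. -/
theorem concat_mem_spaceSp (hp1 : 1 ≤ p) {X : ℕ → Proc T P d} (hX : ∀ k, X k ∈ spaceSp 𝓕 P p d)
    {L : Ω → ℕ} (hL : Measurable[𝓕 ⊥] L) {Z : Proc T P d}
    (hZ : ∀ t, Z t =ᵐ[P] fun ω => X (L ω) t ω) : Z ∈ spaceSp 𝓕 P p d := by
  have hS := fun k => ((mem_spaceSp_iff hp1).1 (hX k)).1
  have hZS : Z ∈ spaceS 𝓕 P d := by
    choose x hx using hS
    refine ⟨fun t ω => x (L ω) t ω, fun t => ?_, fun ω => (hx (L ω)).rcll ω, fun t => ?_⟩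
    · exact (measurable_apply_nat (m := 𝓕 t) (hL.mono (𝓕.mono bot_le) le_rfl)
        (x := fun k => x k t) fun k => ((hx k).adapted t).measurable).stronglyMeasurable
    · filter_upwards [hZ t, ae_all_iff.2 fun k => (hx k).version t] with ω h1 h2
      rw [h1, h2]
  have hLk : ∀ k, Measurable[𝓕 ⊥] ((L ⁻¹' {k}).indicator (1 : Ω → ℝ≥0∞)) := fun k =>
    Measurable.indicator measurable_const (hL (measurableSet_singleton k))
  -- The events {L = k} partition Ω, so the series has one nonzero term. Written this way, the
  -- concatenation falls under the countable triangle inequality.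
  have hsum : ∀ (f : ℕ → Ω → ℝ≥0∞) ω,
      ∑' k, (L ⁻¹' {k}).indicator (1 : Ω → ℝ≥0∞) ω * f k ω = f (L ω) ω := by
    intro f ω
    rw [tsum_eq_single (L ω) fun k hk => by
      rw [Set.indicator_of_notMem (by simpa using hk.symm), zero_mul]]
    rw [Set.indicator_of_mem (by simp), Pi.one_apply, one_mul]
  have hle : seqSup Z ≤ᵐ[P] fun ω => ∑' k, (L ⁻¹' {k}).indicator (1 : Ω → ℝ≥0∞) ω * seqSup (X k) ω := by
    filter_upwards [ae_all_iff.2 fun n => hZ (timeSeq T n)] with ω h1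
    rw [hsum]
    simp only [seqSup, h1, le_refl]
  refine (mem_spaceSp_iff hp1).2 ⟨hZS, ?_⟩
  filter_upwards [procNorm_le_condNorm hp1 hZS hle,
    condNorm_tsum_le (p := p) (P := P) (𝓕.le ⊥) hp1
      (R := fun k ω => (L ⁻¹' {k}).indicator (1 : Ω → ℝ≥0∞) ω * seqSup (X k) ω) fun k =>
        (((hLk k).mono (𝓕.le ⊥) le_rfl).mul (measurable_seqSup _)).aemeasurable,
    ae_all_iff.2 fun k => condNorm_mul_le (p := p) (P := P) (𝓕.le ⊥) hp1 (hLk k)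
      (measurable_seqSup (X k)).aemeasurable,
    ae_all_iff.2 fun k => procNorm_ae_eq hp1 (hS k),
    ae_all_iff.2 fun k => ((mem_spaceSp_iff hp1).1 (hX k)).2] with ω h1 h2 h3 h4 h5
  refine ((h1.trans h2).trans (ENNReal.tsum_le_tsum h3)).trans_lt ?_
  simp only [← h4]
  rw [hsum fun k => procNorm 𝓕 P p (X k)]
  exact h5 _

variable {F : Proc T P d → Proc T P d → Proc T P d}

theorem picard_mem_spaceSp (hp1 : 1 ≤ p)
    (hF : ∀ Y ∈ spaceSp 𝓕 P p d, ∀ M ∈ spaceMp0 𝓕 P p d, F Y M ∈ spaceSp0 𝓕 P p d)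
    {Y M : Proc T P d} (hY : Y ∈ spaceSp 𝓕 P p d) (hM : M ∈ spaceMp0 𝓕 P p d) (n : ℕ) :
    picard F Y M n ∈ spaceSp 𝓕 P p d := by
  induction n with
  | zero => exact hY
  | succ n ih =>
    exact sub_mem_spaceSp hp1 (sub_mem_spaceSp hp1 (const_bot_mem_spaceSp hp1 hY)
      (hF _ ih _ hM).1) hM.1.1

omit [IsProbabilityMeasure P] in
theorem randIterGen_ae_eq {L : Ω → ℕ} (hL : Measurable L) (Y M : Proc T P d) (t : TimeSet T) :
    randIterGen F L hL Y M t =ᵐ[P] fun ω => iterGen F (L ω) Y M t ω :=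
  AEEqFun.coeFn_mk _ _

theorem randIterGen_mem_spaceSp0 (hp1 : 1 ≤ p)
    (hF : ∀ Y ∈ spaceSp 𝓕 P p d, ∀ M ∈ spaceMp0 𝓕 P p d, F Y M ∈ spaceSp0 𝓕 P p d)
    {L : Ω → ℕ} (hL : Measurable[𝓕 ⊥] L)
    {Y M : Proc T P d} (hY : Y ∈ spaceSp 𝓕 P p d) (hM : M ∈ spaceMp0 𝓕 P p d) :
    randIterGen F L (hL.mono (𝓕.le ⊥) le_rfl) Y M ∈ spaceSp0 𝓕 P p d := by
  have hI : ∀ k, iterGen F k Y M ∈ spaceSp0 𝓕 P p d := fun k =>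
    hF _ (picard_mem_spaceSp hp1 hF hY hM _) _ hM
  refine ⟨concat_mem_spaceSp hp1 (fun k => (hI k).1) hL fun t => randIterGen_ae_eq _ _ _ t, ?_⟩
  refine AEEqFun.ext ?_
  filter_upwards [randIterGen_ae_eq (F := F) (hL.mono (𝓕.le ⊥) le_rfl) Y M ⊥] with ω h1
  rw [h1, (hI (L ω)).2]

end Concatenation

/-! ### The solution map and its contraction property -/

section Step

variable {T : ℝ≥0} {Ω : Type*} {mΩ : MeasurableSpace Ω} {P : Measure Ω} [IsProbabilityMeasure P]
  {d : ℕ} {𝓕 : Filtration (TimeSet T) mΩ} {p : ℝ≥0∞}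

open Classical in
/-- The factor by which the solution map of the backward equation with a given driver expands
conditional norms; it is the inverse of `cConst p`. -/
noncomputable def stepConst (p : ℝ≥0∞) : ℝ≥0∞ := if p = 2 then 5 else 1 + 3 * doobConst p

theorem doobConst_two : doobConst 2 = 2 := by
  rw [doobConst, if_neg (by simp)]
  norm_num

/-- Outside p = 2 and p = ∞ this is 1 + 3p/(p-1) = (4p-1)/(p-1). -/
theorem stepConst_mul_cConst (hp : 1 < p) : ENNReal.ofReal (cConst p) * stepConst p = 1 := by
  unfold cConst stepConst
  split_ifs with h2 ht
  · rw [show (5 : ℝ≥0∞) = ENNReal.ofReal 5 by simp, ← ENNReal.ofReal_mul (by norm_num)]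
    norm_num
  · subst ht
    rw [doobConst, if_pos rfl,
      show (1 + 3 * 1 : ℝ≥0∞) = ENNReal.ofReal 4 by norm_num, ← ENNReal.ofReal_mul (by norm_num)]
    norm_num
  · have hr : 1 < p.toReal := by
      rw [← ENNReal.toReal_one]
      exact (ENNReal.toReal_lt_toReal ENNReal.one_ne_top ht).2 hp
    have h1 : 0 < p.toReal - 1 := by linarith
    have h4 : 0 < 4 * p.toReal - 1 := by linarith
    rw [doobConst, if_neg ht, show (3 : ℝ≥0∞) = ENNReal.ofReal 3 by simp, ← ENNReal.ofReal_one,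
      ← ENNReal.ofReal_mul (by norm_num), ← ENNReal.ofReal_add (by norm_num) (by positivity),
      ← ENNReal.ofReal_mul (by positivity)]
    congr 1
    rw [div_mul_eq_mul_div, div_eq_one_iff_eq h4.ne']
    field_simp
    ring

theorem ofReal_mul_stepConst_lt_one (hp : 1 < p) {c : ℝ} (hc0 : 0 ≤ c) (hc : c < cConst p) :
    ENNReal.ofReal c * stepConst p < 1 := by
  have h := stepConst_mul_cConst hp
  have h0 : stepConst p ≠ 0 := fun h0 => by simp [h0] at h
  have ht : stepConst p ≠ ∞ := by
    unfold stepConst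
    split_ifs
    · simp
    · exact ENNReal.add_ne_top.2 ⟨by simp, ENNReal.mul_ne_top (by simp) (doobConst_ne_top p)⟩
  rw [← h]
  exact (ENNReal.mul_lt_mul_iff_left h0 ht).2
    ((ENNReal.ofReal_lt_ofReal_iff (hc0.trans_lt hc)).2 hc)

theorem procNorm_const_bot_le (hp1 : 1 ≤ p) {X : Proc T P d} (hX : X ∈ spaceS 𝓕 P d) :
    ∀ᵐ ω ∂P, procNorm 𝓕 P p (fun _ => X ⊥ : Proc T P d) ω ≤ procNorm 𝓕 P p X ω := by
  filter_upwards [procNorm_le_condNorm hp1 (const_bot_mem_spaceS hX) (seqSup_const_bot_le hX),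
    procNorm_ae_eq hp1 hX] with ω h1 h2
  rwa [h2]

/-- The a priori estimate behind the contraction argument. -/
theorem procNorm_step_le (hp : 1 < p) {K G : Proc T P d} (hK : K ∈ spaceSp 𝓕 P p d)
    (hKM : IsGenMartingale 𝓕 P K) (hG : G ∈ spaceSp 𝓕 P p d) (hKG : K ⊤ = G ⊤) :
    ∀ᵐ ω ∂P, procNorm 𝓕 P p (K - G) ω + procNorm 𝓕 P p ((fun _ => K ⊥) - K) ω ≤
      stepConst p * procNorm 𝓕 P p G ω := by
  have hp1 := hp.le
  have hKS := ((mem_spaceSp_iff hp1).1 hK).1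
  have hGS := ((mem_spaceSp_iff hp1).1 hG).1
  have hbot := const_bot_mem_spaceSp hp1 hK
  have hterm : ∀ᵐ ω ∂P, condNorm (𝓕.le ⊥) P p (fun ω => ‖K ⊤ ω‖ₑ) ω ≤ procNorm 𝓕 P p G ω :=
    condNorm_le_procNorm hp1 hGS (by rw [hKG]; exact enorm_le_seqSup hGS ⊤)
  have hKq : ∀ᵐ ω ∂P, procNorm 𝓕 P p K ω ≤ doobConst p * procNorm 𝓕 P p G ω := by
    filter_upwards [hKM.procNorm_le hp hK, hterm] with ω h1 h2
    exact h1.trans (mul_le_mul_right h2 _)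
  unfold stepConst
  split_ifs with h2
  -- K - G contributes 2 + 1. Doob's inequality for the martingale K_0 - K contributes 2, since by
  -- orthogonality its terminal value is no larger than K_T.
  · subst h2
    have hdiff := ((isGenMartingale_const_bot hp1 hK).sub hp1 hbot hK hKM).procNorm_le hp
      (sub_mem_spaceSp hp1 hbot hK)
    have he : (fun ω => ‖((fun _ => K ⊥ : Proc T P d) - K) ⊤ ω‖ₑ) =ᵐ[P] fun ω => ‖K ⊤ ω - K ⊥ ω‖ₑ := by
      filter_upwards [AEEqFun.coeFn_sub (K ⊥) (K ⊤)] with ω h1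
      rw [Pi.sub_apply, h1, Pi.sub_apply, ← edist_eq_enorm_sub, edist_comm, edist_eq_enorm_sub]
    filter_upwards [procNorm_sub_le hp1 hKS hGS, hKq, hdiff, hterm,
      condNorm_congr (p := 2) (𝓕.le ⊥) hp1 he, hKM.condNorm_two_sub_bot_le hK]
      with ω a1 a2 a3 a4 a5 a6
    rw [doobConst_two] at a2 a3
    rw [a5] at a3
    calc _ ≤ (2 * procNorm 𝓕 P 2 G ω + procNorm 𝓕 P 2 G ω) + 2 * procNorm 𝓕 P 2 G ω :=
          add_le_add (a1.trans (add_le_add_left a2 _))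
            (a3.trans (mul_le_mul_right (a6.trans a4) _))
      _ = 5 * procNorm 𝓕 P 2 G ω := by ring
  -- With q the Doob constant, K - G contributes q + 1 and K_0 - K contributes 2q by the triangle
  -- inequality.
  · filter_upwards [procNorm_sub_le hp1 hKS hGS, hKq,
      procNorm_sub_le hp1 (const_bot_mem_spaceS hKS) hKS, procNorm_const_bot_le (p := p) hp1 hKS]
      with ω a1 a2 a3 a4
    calc _ ≤ (doobConst p * procNorm 𝓕 P p G ω + procNorm 𝓕 P p G ω) +
          (doobConst p * procNorm 𝓕 P p G ω + doobConst p * procNorm 𝓕 P p G ω) :=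
          add_le_add (a1.trans (add_le_add_left a2 _))
            (a3.trans (add_le_add (a4.trans a2) a2))
      _ = (1 + 3 * doobConst p) * procNorm 𝓕 P p G ω := by ring

/-- Starting at `0` is preserved by limits in conditional norm. -/
theorem bot_eq_zero_of_tendsto (hp1 : 1 ≤ p) {X : ℕ → Proc T P d} {Y : Proc T P d}
    (hX : ∀ n, X n ∈ spaceSp0 𝓕 P p d) (hY : Y ∈ spaceSp 𝓕 P p d)
    (hlim : ∀ᵐ ω ∂P, Tendsto (fun n => procNorm 𝓕 P p (Y - X n) ω) atTop (𝓝 0)) : Y ⊥ = 0 := by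
  have hle : ∀ n, ∀ᵐ ω ∂P, condNorm (𝓕.le ⊥) P p (fun ω => ‖Y ⊥ ω‖ₑ) ω ≤
      procNorm 𝓕 P p (Y - X n) ω := by
    intro n
    have hS := sub_mem_spaceS hY.1 (hX n).1.1
    refine condNorm_le_procNorm hp1 hS ?_
    filter_upwards [enorm_le_seqSup hS ⊥] with ω h1
    rwa [Pi.sub_apply, (hX n).2, sub_zero] at h1
  have hz := ae_eq_zero_of_condNorm_eq_zero (p := p) (P := P) (𝓕.le ⊥) hp1
    (R := fun ω => ‖Y ⊥ ω‖ₑ) (Y ⊥).measurable.enorm.aemeasurable (by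
      filter_upwards [ae_all_iff.2 hle, hlim] with ω h1 h2
      exact le_antisymm (ge_of_tendsto' h2 h1) zero_le)
  refine AEEqFun.ext ?_
  filter_upwards [hz, AEEqFun.coeFn_zero (α := Ω) (μ := P) (β := EuclideanSpace ℝ (Fin d))]
    with ω h1 h2
  rw [h2]
  exact enorm_eq_zero.1 h1

variable {Φ : Proc T P d → Proc T P d → Proc T P d} {ξ : Ω →ₘ[P] EuclideanSpace ℝ (Fin d)}

/-- A solution of the backward equation is a fixed point of the solution map for a given driver. -/
theorem solvesBSE_iff_exists (hp1 : 1 ≤ p)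
    (hΦ : ∀ Y ∈ spaceSp 𝓕 P p d, ∀ M ∈ spaceMp0 𝓕 P p d, Φ Y M ∈ spaceSp0 𝓕 P p d)
    {Y M : Proc T P d} (hY : Y ∈ spaceSp 𝓕 P p d) (hM : M ∈ spaceMp0 𝓕 P p d) :
    SolvesBSE Φ ξ Y M ↔ ∃ K ∈ spaceSp 𝓕 P p d, IsGenMartingale 𝓕 P K ∧ K ⊤ = ξ + Φ Y M ⊤ ∧
      K - Φ Y M = Y ∧ (fun _ => K ⊥) - K = M := by
  have hΦ0 : Φ Y M ⊥ = 0 := (hΦ Y hY M hM).2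
  constructor
  · intro h
    have h0 := h ⊥
    rw [hΦ0, hM.1.2, add_zero, add_zero] at h0
    have hc := const_bot_mem_spaceSp hp1 hY
    -- The equation at time 0 reads Y_0 = ξ + Φ_T(Y, M) + M_T, so Y_0 - M has the required terminal
    -- value.
    refine ⟨(fun _ => Y ⊥) - M, sub_mem_spaceSp hp1 hc hM.1.1,
      (isGenMartingale_const_bot hp1 hY).sub hp1 hc hM.1.1 hM.2, ?_, ?_, ?_⟩
    · rw [Pi.sub_apply, h0]
      abel
    · ext1 t
      rw [Pi.sub_apply, Pi.sub_apply, h0, ← h t]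
      abel
    · ext1 t
      rw [Pi.sub_apply, Pi.sub_apply, Pi.sub_apply, hM.1.2]
      abel
  · rintro ⟨K, -, -, h1, h2, h3⟩ t
    have h2' : ∀ t, Y t = K t - Φ Y M t := fun t => (congrFun h2 t).symm
    have h3' : ∀ t, M t = K ⊥ - K t := fun t => (congrFun h3 t).symm
    rw [h2' t, h3' t, h3' ⊤, h1]
    abel

/-- The backward equation is uniquely solvable for a generator with a small random Lipschitz
constant. -/
theorem existsUnique_solvesBSE (h𝓕 : UsualConditions 𝓕 P) (hp : 1 < p)
    (hΦ : ∀ Y ∈ spaceSp 𝓕 P p d, ∀ M ∈ spaceMp0 𝓕 P p d, Φ Y M ∈ spaceSp0 𝓕 P p d)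
    (hξ : ξ ∈ spaceLp 𝓕 P p d) {C : Ω → ℝ} (hC0 : ∀ᵐ ω ∂P, 0 ≤ C ω)
    (hCp : ∀ᵐ ω ∂P, C ω < cConst p)
    (hLip : ∀ Y ∈ spaceSp 𝓕 P p d, ∀ Y' ∈ spaceSp 𝓕 P p d,
      ∀ M ∈ spaceMp0 𝓕 P p d, ∀ M' ∈ spaceMp0 𝓕 P p d, ∀ᵐ ω ∂P,
        procNorm 𝓕 P p (Φ Y M - Φ Y' M') ω ≤ ENNReal.ofReal (C ω) *
          (procNorm 𝓕 P p (Y - Y') ω + procNorm 𝓕 P p (M - M') ω)) :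
    ∃! Z : Proc T P d × Proc T P d,
      Z.1 ∈ spaceSp 𝓕 P p d ∧ Z.2 ∈ spaceMp0 𝓕 P p d ∧ SolvesBSE Φ ξ Z.1 Z.2 := by
  have hp1 := hp.le
  let A := {Z : Proc T P d × Proc T P d // Z.1 ∈ spaceSp 𝓕 P p d ∧ Z.2 ∈ spaceMp0 𝓕 P p d}
  have hS : ∀ Z : A, Z.1.1 ∈ spaceS 𝓕 P d ∧ Z.1.2 ∈ spaceS 𝓕 P d := fun Z =>
    ⟨Z.2.1.1, Z.2.2.1.1.1⟩
  have hξm : AEStronglyMeasurable[𝓕 ⊤] ξ P := by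
    obtain ⟨η, x, hη, hx, -, hV⟩ := hξ
    exact ⟨fun ω => η ω • x ω, (hη.mono (𝓕.mono bot_le) le_rfl).stronglyMeasurable.smul hx, hV⟩
  have hKex : ∀ Z : A, ∃ K ∈ spaceSp 𝓕 P p d, IsGenMartingale 𝓕 P K ∧
      K ⊤ = ξ + Φ Z.1.1 Z.1.2 ⊤ := by
    intro Z
    have hG := (hΦ _ Z.2.1 _ Z.2.2).1
    obtain ⟨hGS, hGN⟩ := (mem_spaceSp_iff hp1).1 hG
    have hadd := AEEqFun.coeFn_add ξ (Φ Z.1.1 Z.1.2 ⊤)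
    obtain ⟨K, h1, h2, h3⟩ := exists_genMartingale h𝓕 hp (V := ⇑(ξ + Φ Z.1.1 Z.1.2 ⊤))
      ((hξm.add (aestronglyMeasurable_of_mem_spaceS hGS ⊤)).congr hadd.symm) (by
        filter_upwards [condNorm_lt_top_of_mem_spaceLp hp1 hξ, hGN,
          condNorm_le_procNorm hp1 hGS (enorm_le_seqSup hGS ⊤),
          condNorm_add_le (p := p) (P := P) (𝓕.le ⊥) hp1 ξ.measurable.enorm.aemeasurable
            (Φ Z.1.1 Z.1.2 ⊤).measurable.enorm.aemeasurable,
          condNorm_mono (p := p) (P := P) (𝓕.le ⊥) hp1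
            (R := fun ω => ‖(ξ + Φ Z.1.1 Z.1.2 ⊤) ω‖ₑ)
            (S := fun ω => ‖ξ ω‖ₑ + ‖Φ Z.1.1 Z.1.2 ⊤ ω‖ₑ) (by
              filter_upwards [hadd] with ω h1
              rw [h1]
              exact enorm_add_le _ _)] with ω a1 a2 a3 a4 a5
        exact (a5.trans a4).trans_lt (ENNReal.add_lt_top.2 ⟨a1, a3.trans_lt a2⟩))
    exact ⟨K, h1, h2, AEEqFun.ext h3⟩
  choose K hK hKM hKt using hKex
  have hG := fun Z : A => (hΦ _ Z.2.1 _ Z.2.2).1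
  let Ψ : A → A := fun Z => ⟨(K Z - Φ Z.1.1 Z.1.2, (fun _ => K Z ⊥) - K Z),
    sub_mem_spaceSp hp1 (hK Z) (hG Z),
    ⟨sub_mem_spaceSp hp1 (const_bot_mem_spaceSp hp1 (hK Z)) (hK Z), sub_self _⟩,
    (isGenMartingale_const_bot hp1 (hK Z)).sub hp1 (const_bot_mem_spaceSp hp1 (hK Z)) (hK Z)
      (hKM Z)⟩
  let e : A → A → Ω → ℝ≥0∞ := fun Z W ω =>
    procNorm 𝓕 P p (Z.1.1 - W.1.1) ω + procNorm 𝓕 P p (Z.1.2 - W.1.2) ω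
  have hsep : ∀ Z W : A, (∀ᵐ ω ∂P, e Z W ω = 0) → Z = W := by
    intro Z W h
    refine Subtype.ext (Prod.ext ?_ ?_)
    · exact eq_of_procNorm_sub_eq_zero hp1 (hS Z).1 (hS W).1
        (h.mono fun ω hω => (add_eq_zero.1 hω).1)
    · exact eq_of_procNorm_sub_eq_zero hp1 (hS Z).2 (hS W).2
        (h.mono fun ω hω => (add_eq_zero.1 hω).2)
  have hcontr : ∀ Z W : A, ∀ᵐ ω ∂P,
      e (Ψ Z) (Ψ W) ω ≤ ENNReal.ofReal (C ω) * stepConst p * e Z W ω := by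
    intro Z W
    -- In the difference ξ cancels, so the martingale and the driver end at the same value, as the a
    -- priori estimate requires.
    have h1 := procNorm_step_le hp (sub_mem_spaceSp hp1 (hK Z) (hK W))
      ((hKM Z).sub hp1 (hK Z) (hK W) (hKM W)) (sub_mem_spaceSp hp1 (hG Z) (hG W)) (by
        rw [Pi.sub_apply, Pi.sub_apply, hKt, hKt]
        abel)
    filter_upwards [h1, hLip _ Z.2.1 _ W.2.1 _ Z.2.2 _ W.2.2] with ω a1 a2
    have e1 : (Ψ Z).1.1 - (Ψ W).1.1 =
        K Z - K W - (Φ Z.1.1 Z.1.2 - Φ W.1.1 W.1.2) := sub_sub_sub_comm _ _ _ _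
    have e2 : (Ψ Z).1.2 - (Ψ W).1.2 = (fun _ => (K Z - K W) ⊥) - (K Z - K W) :=
      sub_sub_sub_comm _ _ _ _
    simp only [e, e1, e2]
    refine a1.trans ((mul_le_mul_right a2 _).trans_eq ?_)
    ring
  have : Nonempty A := ⟨⟨(0, 0), zero_mem_spaceSp hp1, ⟨zero_mem_spaceSp hp1, rfl⟩, by
    have h0 : (0 : Proc T P d) = (fun _ => (0 : Proc T P d) ⊥) := rfl
    rw [h0]
    exact isGenMartingale_const_bot hp1 (zero_mem_spaceSp hp1)⟩⟩
  obtain ⟨Z, hZ, huniq⟩ := existsUnique_fixedPoint_of_random_contraction (P := P) e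
    (fun Z W => by
      filter_upwards [procNorm_sub_comm (p := p) hp1 (hS Z).1 (hS W).1,
        procNorm_sub_comm (p := p) hp1 (hS Z).2 (hS W).2] with ω h1 h2
      simp only [e, h1, h2])
    (fun Z W V => by
      filter_upwards [procNorm_sub_triangle (p := p) hp1 (hS Z).1 (hS W).1 (hS V).1,
        procNorm_sub_triangle (p := p) hp1 (hS Z).2 (hS W).2 (hS V).2] with ω h1 h2
      exact (add_le_add h1 h2).trans_eq (add_add_add_comm _ _ _ _))
    (fun Z W => by
      filter_upwards [((mem_spaceSp_iff hp1).1 (sub_mem_spaceSp hp1 Z.2.1 W.2.1)).2,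
        ((mem_spaceSp_iff hp1).1 (sub_mem_spaceSp hp1 Z.2.2.1.1 W.2.2.1.1)).2] with ω h1 h2
      exact ENNReal.add_lt_top.2 ⟨h1, h2⟩)
    hsep
    (fun Z hsum => by
      have hs : ∀ᵐ ω ∂P, ∑' n, procNorm 𝓕 P p ((Z (n + 1)).1.1 - (Z n).1.1) ω < ∞ ∧
          ∑' n, procNorm 𝓕 P p ((Z (n + 1)).1.2 - (Z n).1.2) ω < ∞ := by
        filter_upwards [hsum] with ω hω
        simp only [e, ENNReal.tsum_add] at hω
        exact ENNReal.add_lt_top.1 hω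
      obtain ⟨Y, hY, hYlim⟩ := exists_spaceSp_limit h𝓕 hp1 (fun n => (Z n).2.1)
        (hs.mono fun _ h => h.1)
      obtain ⟨M, hM, hMM, hMlim⟩ := exists_genMartingale_limit h𝓕 hp1 (fun n => (Z n).2.2.1.1)
        (fun n => (Z n).2.2.2) (hs.mono fun _ h => h.2)
      refine ⟨⟨(Y, M), hY, ⟨hM, bot_eq_zero_of_tendsto hp1 (fun n => (Z n).2.2.1) hM hMlim⟩, hMM⟩,
        ?_⟩
      filter_upwards [ae_all_iff.2 hYlim, hMlim, hs] with ω h1 h2 h3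
      have h4 := ENNReal.tendsto_sum_nat_add
        (fun n => procNorm 𝓕 P p ((Z (n + 1)).1.1 - (Z n).1.1) ω) h3.1.ne
      have h5 : Tendsto (fun n => procNorm 𝓕 P p (Y - (Z n).1.1) ω) atTop (𝓝 0) :=
        tendsto_of_tendsto_of_tendsto_of_le_of_le tendsto_const_nhds h4
          (fun _ => zero_le) fun n => (h1 n).trans_eq (by simp only [add_comm n])
      simpa only [add_zero] using h5.add h2)
    (θ := fun ω => ENNReal.ofReal (C ω) * stepConst p)
    (by filter_upwards [hC0, hCp] with ω h1 h2 using ofReal_mul_stepConst_lt_one hp h1 h2)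
    hcontr
  refine ⟨Z.1, ⟨Z.2.1, Z.2.2, ?_⟩, ?_⟩
  · refine (solvesBSE_iff_exists hp1 hΦ Z.2.1 Z.2.2).2 ⟨K Z, hK Z, hKM Z, hKt Z, ?_, ?_⟩
    · exact congrArg (fun W : A => W.1.1) hZ
    · exact congrArg (fun W : A => W.1.2) hZ
  · rintro ⟨Y, M⟩ ⟨hY, hM, hsol⟩
    let W : A := ⟨(Y, M), hY, hM⟩
    obtain ⟨K', h1, h2, h3, h4, h5⟩ := (solvesBSE_iff_exists hp1 hΦ hY hM).1 hsol
    -- By Doob's inequality two generalized martingales in S^p with equal terminal values coincide,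
    -- so a solution is fixed by Ψ whichever closing martingale was chosen.
    have hKK : K W = K' := by
      have hd := sub_mem_spaceSp hp1 (hK W) h1
      refine eq_of_procNorm_sub_eq_zero hp1 (hK W).1 h1.1 ?_
      have ht : (K W - K') ⊤ = (0 : Proc T P d) ⊤ := by
        rw [Pi.sub_apply, hKt, h3, sub_self]
        rfl
      filter_upwards [((hKM W).sub hp1 (hK W) h1 h2).procNorm_le hp hd,
        condNorm_congr (p := p) (P := P) (𝓕.le ⊥) hp1 (R := fun ω => ‖(K W - K') ⊤ ω‖ₑ)
          (S := fun _ => 0) (by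
            filter_upwards [AEEqFun.coeFn_zero (α := Ω) (μ := P) (β := EuclideanSpace ℝ (Fin d))]
              with ω hω
            rw [ht, Pi.zero_apply, hω, Pi.zero_apply, enorm_zero]),
        condNorm_zero (p := p) (P := P) (𝓕.le ⊥) hp1] with ω b1 b2 b3
      rw [b2, nonpos_iff_eq_zero.1 b3, mul_zero] at b1
      exact nonpos_iff_eq_zero.1 b1
    refine congrArg Subtype.val (huniq W (Subtype.ext (Prod.ext ?_ ?_)))
    · change K W - Φ Y M = Y
      rw [hKK, h4]
    · change (fun _ => K W ⊥) - K W = M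
      rw [hKK, h5]

end Step

/-! ### From the random iterate back to the generator -/

section RandomIterate

variable {T : ℝ≥0} {Ω : Type*} {mΩ : MeasurableSpace Ω} {P : Measure Ω}
  {d : ℕ} {𝓕 : Filtration (TimeSet T) mΩ} {p : ℝ≥0∞}
  {F : Proc T P d → Proc T P d → Proc T P d} {ξ : Ω →ₘ[P] EuclideanSpace ℝ (Fin d)} {L : Ω → ℕ}

/-- Locality of a generator in its first argument on the events `{L = k}`. -/
def IsLocalGen (𝓕 : Filtration (TimeSet T) mΩ) (p : ℝ≥0∞)
    (F : Proc T P d → Proc T P d → Proc T P d) (L : Ω → ℕ) : Prop :=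
  ∀ k, ∀ Y ∈ spaceSp 𝓕 P p d, ∀ Y' ∈ spaceSp 𝓕 P p d, ∀ M ∈ spaceMp0 𝓕 P p d,
    EqOnEvent (L ⁻¹' {k}) Y Y' → EqOnEvent (L ⁻¹' {k}) (F Y M) (F Y' M)

/-- Under stability, Y is the concatenation of Y' on {L = k} and Y elsewhere, for a two-set
partition padded with empty sets. For a constant L the event is either almost sure, so that Y = Y',
or null. -/
theorem isLocalGen_of_stable_or_const (hL : Measurable[𝓕 ⊥] L)
    (hstable : IsStableGen 𝓕 p F ∨ ∃ k : ℕ, ∀ᵐ ω ∂P, L ω = k) : IsLocalGen 𝓕 p F L := by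
  intro k Y hY Y' hY' M hM hYY'
  rcases hstable with hst | ⟨k₀, hk₀⟩
  · have hm : MeasurableSet[𝓕 ⊥] (L ⁻¹' {k}) := hL (measurableSet_singleton k)
    let A : ℕ → Set Ω := fun n => if n = 0 then L ⁻¹' {k} else if n = 1 then (L ⁻¹' {k})ᶜ else ∅
    refine hst A (fun n => ?_) (fun i j hij => ?_) ?_ (fun n => if n = 0 then Y' else Y)
      (fun _ => M) (fun n => ?_) (fun _ => hM) Y hY M hM (fun n => ?_)
      (fun _ _ => Eventually.of_forall fun _ _ => rfl) 0
    · simp only [A]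
      split_ifs
      · exact hm
      · exact hm.compl
      · exact @MeasurableSet.empty _ (𝓕 ⊥)
    · simp only [Function.onFun, A]
      split_ifs with h1 h2 h3 h4 h5 h6 <;>
        first
        | exact absurd (h1.trans h2.symm) hij
        | exact absurd (h4.trans h6.symm) hij
        | exact disjoint_compl_right
        | exact disjoint_compl_left
        | exact Set.disjoint_empty _
        | exact Set.empty_disjoint _
    · refine Set.eq_univ_of_forall fun ω => Set.mem_iUnion.2 ?_
      by_cases hω : ω ∈ L ⁻¹' {k}
      · exact ⟨0, hω⟩
      · exact ⟨1, hω⟩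
    · split_ifs
      exacts [hY', hY]
    · by_cases hn : n = 0
      · subst hn
        exact hYY'
      · simp only [hn, if_false]
        exact fun _ => Eventually.of_forall fun _ _ => rfl
  · by_cases hk : k = k₀
    · subst hk
      have : Y = Y' := by
        ext1 t
        refine AEEqFun.ext ?_
        filter_upwards [hk₀, hYY' t] with ω h1 h2 using h2 h1
      subst this
      exact fun _ => Eventually.of_forall fun _ _ => rfl
    · intro t
      filter_upwards [hk₀] with ω h1 h2
      exact absurd (h2.symm.trans h1) hk

/-- Restarting the recursion from its second term shifts the index by one, provided the initial
value Y_0 it refers to is unchanged. -/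
theorem picard_succ_left {Y M Y' : Proc T P d} (h0 : Y' ⊥ = Y ⊥) (h1 : Y' = picard F Y M 1)
    (n : ℕ) : picard F Y' M n = picard F Y M (n + 1) := by
  induction n with
  | zero => exact h1
  | succ n ih =>
    ext1 t
    rw [picard, ih, h0]
    rfl

theorem ae_eq_of_sub_sub {x y z w : Ω →ₘ[P] EuclideanSpace ℝ (Fin d)} (h : x = y - z - w) :
    x =ᵐ[P] fun ω => y ω - z ω - w ω := by
  filter_upwards [AEEqFun.coeFn_sub (y - z) w, AEEqFun.coeFn_sub y z] with ω h1 h2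
  rw [h, h1, Pi.sub_apply, h2, Pi.sub_apply]

/-- The random iterates of `F` agree with `F` at the solutions of the equation for `F`. -/
theorem randIterGen_eq_of_solvesBSE_gen (hL : Measurable L) {Y M : Proc T P d}
    (hF0 : F Y M ⊥ = 0) (hM0 : M ⊥ = 0) (h : SolvesBSE F ξ Y M) :
    randIterGen F L hL Y M = F Y M := by
  have h0 := h ⊥
  rw [hF0, hM0, add_zero, add_zero] at h0
  -- At a solution Y = Y_0 - F(Y, M) - M, so the recursion is stationary.
  have hpic : ∀ n, picard F Y M n = Y := by
    intro n
    induction n with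
    | zero => rfl
    | succ n ih =>
      ext1 t
      rw [picard, ih, h0, ← h t]
      beta_reduce
      rw [sub_sub, add_assoc, add_sub_cancel_right]
  ext1 t
  refine AEEqFun.ext ?_
  filter_upwards [randIterGen_ae_eq (F := F) hL Y M t] with ω h1
  rw [h1, iterGen, hpic]

variable [IsProbabilityMeasure P]

theorem cConst_lt_one (hp : 1 < p) : cConst p < 1 := by
  unfold cConst
  split_ifs with h2 ht
  · norm_num
  · norm_num
  · have hr : 1 < p.toReal := by
      rw [← ENNReal.toReal_one]
      exact (ENNReal.toReal_lt_toReal ENNReal.one_ne_top ht).2 hp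
    rw [div_lt_one (by linarith)]
    linarith

/-- The random iterates of `F` agree with `F` at the solutions of the equation for `F^(L)`. -/
theorem randIterGen_eq_of_solvesBSE (hp : 1 < p)
    (hF : ∀ Y ∈ spaceSp 𝓕 P p d, ∀ M ∈ spaceMp0 𝓕 P p d, F Y M ∈ spaceSp0 𝓕 P p d)
    (hL : Measurable[𝓕 ⊥] L) (hLpos : ∀ ω, 1 ≤ L ω) {C : Ω → ℝ}
    (hCp : ∀ᵐ ω ∂P, C ω < cConst p)
    (hLip : ∀ Y ∈ spaceSp 𝓕 P p d, ∀ Y' ∈ spaceSp 𝓕 P p d,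
      ∀ M ∈ spaceMp0 𝓕 P p d, ∀ M' ∈ spaceMp0 𝓕 P p d, ∀ᵐ ω ∂P,
        procNorm 𝓕 P p (randIterGen F L (hL.mono (𝓕.le ⊥) le_rfl) Y M -
          randIterGen F L (hL.mono (𝓕.le ⊥) le_rfl) Y' M') ω ≤ ENNReal.ofReal (C ω) *
          (procNorm 𝓕 P p (Y - Y') ω + procNorm 𝓕 P p (M - M') ω))
    (hloc : IsLocalGen 𝓕 p F L)
    {Y M : Proc T P d} (hY : Y ∈ spaceSp 𝓕 P p d) (hM : M ∈ spaceMp0 𝓕 P p d)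
    (h : SolvesBSE (randIterGen F L (hL.mono (𝓕.le ⊥) le_rfl)) ξ Y M) :
    F Y M = randIterGen F L (hL.mono (𝓕.le ⊥) le_rfl) Y M := by
  have hp1 := hp.le
  have hL' : Measurable L := hL.mono (𝓕.le ⊥) le_rfl
  have hG0 : randIterGen F L hL' Y M ⊥ = 0 := (randIterGen_mem_spaceSp0 hp1 hF hL hY hM).2
  have hFix : ∀ t, Y t = Y ⊥ - randIterGen F L hL' Y M t - M t := by
    intro t
    have h0 := h ⊥
    rw [hG0, hM.1.2, add_zero, add_zero] at h0
    rw [h0, ← h t, sub_sub, add_assoc, add_sub_cancel_right]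
  have hpic := picard_mem_spaceSp hp1 hF hY hM
  have hYbot : picard F Y M 1 ⊥ = Y ⊥ := by
    simp only [picard, (hF Y hY M hM).2, hM.1.2, sub_zero]
  -- `picard F Y M k` is Y_0 - F^(k)(Y, M) - M, which on {L = k} equals Y_0 - F^(L)(Y, M) - M = Y.
  -- Started one step later, F^(k) evaluates F at exactly this term, so locality turns it into F(Y,
  -- M) on {L = k}.
  have hkey : randIterGen F L hL' (picard F Y M 1) M = F Y M := by
    ext1 t
    have hk : ∀ k, 1 ≤ k → EqOnEvent (L ⁻¹' {k}) (picard F Y M k) Y := by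
      intro k hk1 t
      have hps : picard F Y M k t = Y ⊥ - iterGen F k Y M t - M t := by
        obtain ⟨j, rfl⟩ := Nat.exists_eq_add_of_le' hk1
        rfl
      filter_upwards [ae_eq_of_sub_sub hps, ae_eq_of_sub_sub (hFix t),
        randIterGen_ae_eq (F := F) hL' Y M t] with ω h1 h2 h3 hω
      rw [h1, h2, h3, show L ω = k from hω]
    have hall : ∀ k, ∀ᵐ ω ∂P, 1 ≤ k → L ω = k →
        iterGen F k (picard F Y M 1) M t ω = F Y M t ω := by
      intro k
      by_cases hk1 : 1 ≤ k
      · filter_upwards [hloc k _ (hpic k) _ hY _ hM (hk k hk1) t] with ω h1 _ h3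
        rw [iterGen, picard_succ_left hYbot rfl, Nat.sub_add_cancel hk1]
        exact h1 h3
      · exact Eventually.of_forall fun _ h1 => absurd h1 hk1
    refine AEEqFun.ext ?_
    filter_upwards [randIterGen_ae_eq (F := F) hL' (picard F Y M 1) M t, ae_all_iff.2 hall]
      with ω h1 h2
    rw [h1]
    exact h2 _ (hLpos ω) rfl
  have hYS := hY.1
  -- The difference between Y and the next term of the recursion is an increment of F^(L) between
  -- the same two processes, so the Lipschitz bound with C < 1 forces it to vanish.
  have hdiff : Y - picard F Y M 1 =
      randIterGen F L hL' (picard F Y M 1) M - randIterGen F L hL' Y M := by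
    rw [hkey]
    ext1 t
    rw [Pi.sub_apply, Pi.sub_apply]
    nth_rewrite 1 [hFix t]
    simp only [picard]
    rw [sub_sub_sub_cancel_right, sub_sub_sub_cancel_left]
  have heq : Y = picard F Y M 1 := by
    refine eq_of_procNorm_sub_eq_zero hp1 hYS (hpic 1).1 ?_
    have hfin := ((mem_spaceSp_iff hp1).1 (sub_mem_spaceSp hp1 hY (hpic 1))).2
    filter_upwards [hLip _ (hpic 1) _ hY _ hM _ hM, hCp, hfin,
      procNorm_sub_comm (p := p) hp1 (hpic 1).1 hYS, procNorm_zero (𝓕 := 𝓕) (P := P) (d := d) hp1]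
      with ω h1 h2 h3 h4 h5
    rw [← hdiff, h4, sub_self, h5, add_zero] at h1
    exact ennreal_eq_zero_of_le_mul_self
      (ENNReal.ofReal_lt_one.2 (h2.trans (cConst_lt_one hp))) h3 h1
  rw [← hkey, ← heq]

end RandomIterate

end RandomBSE

theorem theorem5p4 {Ω : Type*} {mΩ : MeasurableSpace Ω} (P : Measure Ω) [IsProbabilityMeasure P]
    (T : ℝ≥0) (𝓕 : Filtration (RandomBSE.TimeSet T) mΩ) (h𝓕 : RandomBSE.UsualConditions 𝓕 P)
    (d : ℕ) (p : ℝ≥0∞) (hp : 1 < p)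
    -- the generator, a map from `S^p_{F_0} × M^p_{F_0,0}` to `S^p_{F_0,0}`
    (F : RandomBSE.Proc T P d → RandomBSE.Proc T P d → RandomBSE.Proc T P d)
    (hF : ∀ Y ∈ RandomBSE.spaceSp 𝓕 P p d, ∀ M ∈ RandomBSE.spaceMp0 𝓕 P p d,
      F Y M ∈ RandomBSE.spaceSp0 𝓕 P p d)
    (ξ : Ω →ₘ[P] EuclideanSpace ℝ (Fin d)) (hξ : ξ ∈ RandomBSE.spaceLp 𝓕 P p d)
    (L : Ω → ℕ) (hL : Measurable[𝓕 ⊥] L) (hLpos : ∀ ω, 1 ≤ L ω)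
    (C : Ω → ℝ) (hC : Measurable[𝓕 ⊥] C) (hC0 : ∀ᵐ ω ∂P, 0 ≤ C ω)
    (hCp : ∀ᵐ ω ∂P, C ω < RandomBSE.cConst p)
    (hLip : ∀ Y ∈ RandomBSE.spaceSp 𝓕 P p d, ∀ Y' ∈ RandomBSE.spaceSp 𝓕 P p d,
      ∀ M ∈ RandomBSE.spaceMp0 𝓕 P p d, ∀ M' ∈ RandomBSE.spaceMp0 𝓕 P p d,
      ∀ᵐ ω ∂P,
        RandomBSE.procNorm 𝓕 P p
            (RandomBSE.randIterGen F L (hL.mono (𝓕.le ⊥) le_rfl) Y M -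
              RandomBSE.randIterGen F L (hL.mono (𝓕.le ⊥) le_rfl) Y' M') ω ≤
          ENNReal.ofReal (C ω) *
            (RandomBSE.procNorm 𝓕 P p (Y - Y') ω + RandomBSE.procNorm 𝓕 P p (M - M') ω))
    -- stability is needed only if `L` is not constant
    (hstable : RandomBSE.IsStableGen 𝓕 p F ∨ ∃ k : ℕ, ∀ᵐ ω ∂P, L ω = k) :
    ∃! Z : RandomBSE.Proc T P d × RandomBSE.Proc T P d,
      Z.1 ∈ RandomBSE.spaceSp 𝓕 P p d ∧ Z.2 ∈ RandomBSE.spaceMp0 𝓕 P p d ∧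
        RandomBSE.SolvesBSE F ξ Z.1 Z.2 := by
  have hp1 := hp.le
  have hloc := RandomBSE.isLocalGen_of_stable_or_const hL hstable
  -- The equation is solved for F^(L). It has the same solutions as the equation for F, because the
  -- two generators coincide at a solution of either one.
  obtain ⟨Z, ⟨hZ1, hZ2, hZ⟩, huniq⟩ := RandomBSE.existsUnique_solvesBSE h𝓕 hp
    (fun Y hY M hM => RandomBSE.randIterGen_mem_spaceSp0 hp1 hF hL hY hM) hξ hC0 hCp hLip
  refine ⟨Z, ⟨hZ1, hZ2, ?_⟩, fun W hW => huniq W ⟨hW.1, hW.2.1, ?_⟩⟩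
  · have h := RandomBSE.randIterGen_eq_of_solvesBSE hp hF hL hLpos hCp hLip hloc hZ1 hZ2 hZ
    intro t
    rw [h]
    exact hZ t
  · have h := RandomBSE.randIterGen_eq_of_solvesBSE_gen (hL.mono (𝓕.le ⊥) le_rfl)
      (hF _ hW.1 _ hW.2.1).2 hW.2.1.1.2 hW.2.2
    intro t
    beta_reduce
    rw [h]
    exact hW.2.2 t
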